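/- Let $a_1,a_2,a_3,b_1,b_2,b_3,c\in\mathbb C$ with $a_j\neq b_j$ for $j=1,2,3$. For $j=1,2,3$ let $C_j\subset GL(4,\mathbb C)$ be the conjugacy class of diagonalizable matrices with eigenvalues $a_j,a_j,b_j,b_j$, and let $C_4$ be the conjugacy class of matrices with the single eigenvalue $c$ and Jordan blocks of sizes $2,1,1$. A non-genericity relation is an equality $\prod_{j=1}^4\prod_{k\in\Phi_j}\sigma_{k,j}=1$, where $\sigma_{1,j},\dots,\sigma_{4,j}$ are the eigenvalues of $C_j$ listed with multiplicities, and the sets $\Phi_1,\dots,\Phi_4\subset\{1,2,3,4\}$ have one and the same number $s$ of elements, $0<s<4$. Assume that the eigenvalues are relatively generic but not generic, i.e. they satisfy at least one non-genericity relation, and in every one that they satisfy, each $\Phi_j$ contains each eigenvalue of $C_j$ with half of its multiplicity (so that the relation reads $a_1b_1a_2b_2a_3b_3c^2=1$). Let $\mathcal V=\{(M_1,M_2,M_3,M_4) : M_j\in C_j,\ M_1M_2M_3M_4=I\}$, and let $\mathcal U\subset\mathcal V$ be the set of the quadruples that are simultaneously conjugate under $GL(4,\mathbb C)$ to direct sums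 $M_j=\mathrm{diag}(N_j,P_j)$ of two irreducible quadruples of matrices $N_j,P_j\in GL(2,\mathbb C)$ such that, for $j=1,2,3$, $N_j$ and $P_j$ are diagonalizable with eigenvalues $a_j,b_j$, while $N_4=cI$ and $P_4$ is conjugate to a Jordan block of size $2$ with eigenvalue $c$. Then $\mathcal U$ is an irreducible smooth (locally closed) subvariety, of dimension $16$, of the affine space of quadruples of complex $4\times4$ matrices. This exceeds the expected dimension $\dim C_1+\dim C_2+\dim C_3+\dim C_4-4^2+1$ of $\mathcal V$, which equals $15$. -/

import Mathlib

noncomputable section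

/-! ### Subvarieties of complex affine space -/

/-- The Zariski topology on the affine space `σ → ℂ`: the topology induced from the prime spectrum
of the polynomial ring. -/
@[reducible]
def zariskiTopology (σ : Type) : TopologicalSpace (σ → ℂ) :=
  TopologicalSpace.induced
    (MvPolynomial.pointToPoint (k := ℂ) : (σ → ℂ) → PrimeSpectrum (MvPolynomial σ ℂ)) inferInstance

/-- The closed sets of the Zariski topology are the common zero sets of polynomials. -/
theorem isClosed_zariskiTopology_iff {σ : Type} (S : Set (σ → ℂ)) :
    @IsClosed _ (zariskiTopology σ) S ↔
      ∃ F : Set (MvPolynomial σ ℂ), S = {x | ∀ f ∈ F, MvPolynomial.eval x f = 0} := by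
  have key : ∀ F : Set (MvPolynomial σ ℂ),
      (MvPolynomial.pointToPoint (k := ℂ) : (σ → ℂ) → _) ⁻¹' PrimeSpectrum.zeroLocus F
        = {x | ∀ f ∈ F, MvPolynomial.eval x f = 0} := by
    intro F
    ext x
    simp only [Set.mem_preimage, PrimeSpectrum.mem_zeroLocus, Set.mem_ofPred_eq, Set.subset_def,
      SetLike.mem_coe, MvPolynomial.pointToPoint, MvPolynomial.mem_vanishingIdeal_singleton_iff]
    rfl
  constructor
  · intro h
    obtain ⟨T, hT, rfl⟩ := (@isClosed_induced_iff _ _ _ S _).1 h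
    obtain ⟨F, rfl⟩ := (PrimeSpectrum.isClosed_iff_zeroLocus T).1 hT
    exact ⟨F, key F⟩
  · rintro ⟨F, rfl⟩
    exact (@isClosed_induced_iff _ _ _ _ _).2
      ⟨PrimeSpectrum.zeroLocus F, PrimeSpectrum.isClosed_zeroLocus F, key F⟩

/-- A variety in affine space: a Zariski locally closed subset (with its reduced structure). -/
def IsAffineSubvariety {σ : Type} (S : Set (σ → ℂ)) : Prop :=
  @IsLocallyClosed _ (zariskiTopology σ) S

/-- Irreducibility (including non-emptiness) in the Zariski topology. -/
def IsIrreducibleVariety {σ : Type} (S : Set (σ → ℂ)) : Prop :=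
  @IsIrreducible _ (zariskiTopology σ) S

/-- The dimension of a variety `S`: the Krull dimension of the coordinate ring of its closure. -/
def varietyDim {σ : Type} (S : Set (σ → ℂ)) : WithBot ℕ∞ :=
  ringKrullDim (MvPolynomial σ ℂ ⧸ MvPolynomial.vanishingIdeal ℂ S)

/-- The Zariski tangent space of `S` at `x`: the vectors `v` with `∑ i, ∂f/∂Xᵢ (x) * vᵢ = 0` for
every polynomial `f` that vanishes on `S`. -/
def zariskiTangentSpace {σ : Type} [Fintype σ] (S : Set (σ → ℂ)) (x : σ → ℂ) :
    Submodule ℂ (σ → ℂ) :=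
  ⨅ f ∈ MvPolynomial.vanishingIdeal ℂ S,
    LinearMap.ker (∑ i, MvPolynomial.eval x (MvPolynomial.pderiv i f) •
      (LinearMap.proj i : (σ → ℂ) →ₗ[ℂ] ℂ))

/-- Smoothness of an irreducible variety `S`: at each of its points, the Zariski tangent space has
the dimension of `S`. -/
def IsSmoothVariety {σ : Type} [Fintype σ] (S : Set (σ → ℂ)) : Prop :=
  ∀ x ∈ S, ((Module.finrank ℂ (zariskiTangentSpace S x) : ℕ) : WithBot ℕ∞) = varietyDim S

/-! ### Tuples of matrices -/

/-- The entries of a matrix, as a point of affine space. -/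
def matrixPoint {n : ℕ} (A : Matrix (Fin n) (Fin n) ℂ) : Fin n × Fin n → ℂ :=
  fun i => A i.1 i.2

/-- The entries of a tuple of matrices, as a point of affine space. -/
def tuplePoint {n k : ℕ} (M : Fin k → Matrix (Fin n) (Fin n) ℂ) : Fin k × Fin n × Fin n → ℂ :=
  fun i => M i.1 i.2.1 i.2.2

/-- The conjugacy class of a matrix under `GL(n, ℂ)`. -/
def conjClass {n : ℕ} (A : Matrix (Fin n) (Fin n) ℂ) : Set (Matrix (Fin n) (Fin n) ℂ) :=
  {X | ∃ g : GL (Fin n) ℂ,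
    X = (g : Matrix (Fin n) (Fin n) ℂ) * A * ((g⁻¹ : GL (Fin n) ℂ) : Matrix (Fin n) (Fin n) ℂ)}

/-- The variety `𝓥` of the tuples `(M₁, …, Mₖ)` with `Mⱼ ∈ Cⱼ` and `M₁ ⋯ Mₖ = I`. -/
def dsVariety {n k : ℕ} (C : Fin k → Set (Matrix (Fin n) (Fin n) ℂ)) :
    Set (Fin k → Matrix (Fin n) (Fin n) ℂ) :=
  {M | (∀ j, M j ∈ C j) ∧ (List.ofFn M).prod = 1}

/-- The expected dimension `d₁ + ⋯ + dₖ - n² + 1` of `𝓥`, where `dⱼ = dim Cⱼ`. -/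
def expectedDim {n k : ℕ} (C : Fin k → Set (Matrix (Fin n) (Fin n) ℂ)) : ℤ :=
  ∑ j, ((((varietyDim (matrixPoint '' C j)).unbotD 0).toNat : ℕ) : ℤ) - (n : ℤ) ^ 2 + 1

/-- A tuple of matrices is irreducible if it has no common invariant subspace except `0` and the
whole (non-zero) space. -/
def IsIrreducibleTuple {n k : ℕ} (M : Fin k → Matrix (Fin n) (Fin n) ℂ) : Prop :=
  0 < n ∧ ∀ W : Submodule ℂ (Fin n → ℂ), (∀ j, ∀ w ∈ W, (M j).mulVec w ∈ W) → W = ⊥ ∨ W = ⊤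

/-- The block-diagonal matrix `diag(N, P)`. -/
def blockDiag (N P : Matrix (Fin 2) (Fin 2) ℂ) : Matrix (Fin 4) (Fin 4) ℂ :=
  Matrix.reindex (finSumFinEquiv (m := 2) (n := 2)) (finSumFinEquiv (m := 2) (n := 2))
    (Matrix.fromBlocks N 0 0 P)

/-! ### Genericity of eigenvalues -/

/-- `Φ` gives a non-genericity relation for the eigenvalues `e j 0, …, e j (n - 1)` of the `j`-th
matrix, listed with multiplicities. -/
def IsNonGenericityRelation {n k : ℕ} (e : Fin k → Fin n → ℂ) (Φ : Fin k → Finset (Fin n)) : Prop :=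
  (∃ s : ℕ, 0 < s ∧ s < n ∧ ∀ j, (Φ j).card = s) ∧ ∏ j, ∏ i ∈ Φ j, e j i = 1

/-- The eigenvalues are generic if they satisfy no non-genericity relation. -/
def IsGenericEigenvalues {n k : ℕ} (e : Fin k → Fin n → ℂ) : Prop :=
  ∀ Φ, ¬ IsNonGenericityRelation e Φ

/-- The index sets `Φ` contain each eigenvalue `z` of each matrix with half the multiplicity
of `z`. -/
def HasHalvedMultiplicities {n k : ℕ} (e : Fin k → Fin n → ℂ) (Φ : Fin k → Finset (Fin n)) :
    Prop :=
  ∀ j z, 2 * {i | i ∈ Φ j ∧ e j i = z}.ncard = {i | e j i = z}.ncard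

/-- Relative genericity, for eigenvalues whose multiplicities have greatest common divisor `2`: the
only non-genericity relation that the eigenvalues may satisfy is the basic one, which says that the
product of all eigenvalues with halved multiplicities is `1`. -/
def IsRelativelyGenericEigenvalues {n k : ℕ} (e : Fin k → Fin n → ℂ) : Prop :=
  ∀ Φ, IsNonGenericityRelation e Φ → HasHalvedMultiplicities e Φ

/-! ### The quadruples of `4 × 4` matrices -/

/-- The eigenvalues: `aⱼ, aⱼ, bⱼ, bⱼ` for the first three matrices and `c, c, c, c` for the
fourth. -/
def quadEigenvalues (a b : Fin 3 → ℂ) (c : ℂ) : Fin 4 → Fin 4 → ℂ :=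
  ![![a 0, a 0, b 0, b 0], ![a 1, a 1, b 1, b 1], ![a 2, a 2, b 2, b 2], ![c, c, c, c]]

/-- The four conjugacy classes: the first three are diagonalizable, with eigenvalues
`aⱼ, aⱼ, bⱼ, bⱼ`, the fourth has the single eigenvalue `c`, with Jordan blocks of sizes
`2, 1, 1`. -/
def quadClasses (a b : Fin 3 → ℂ) (c : ℂ) : Fin 4 → Set (Matrix (Fin 4) (Fin 4) ℂ) :=
  ![conjClass (Matrix.diagonal ![a 0, a 0, b 0, b 0]),
    conjClass (Matrix.diagonal ![a 1, a 1, b 1, b 1]),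
    conjClass (Matrix.diagonal ![a 2, a 2, b 2, b 2]),
    conjClass !![c, 1, 0, 0; 0, c, 0, 0; 0, 0, c, 0; 0, 0, 0, c]]

/-- The stratum `𝓤` of `𝓥`: the quadruples which are simultaneously conjugate to direct sums
`diag(Nⱼ, Pⱼ)` of two irreducible quadruples of `2 × 2` matrices. For `j = 1, 2, 3` the matrices
`Nⱼ` and `Pⱼ` are diagonalizable, with eigenvalues `aⱼ, bⱼ`, while `N₄` is the scalar matrix `c`
and `P₄` is conjugate to a Jordan block of size `2` with eigenvalue `c`. -/
def stratumU (a b : Fin 3 → ℂ) (c : ℂ) : Set (Fin 4 → Matrix (Fin 4) (Fin 4) ℂ) :=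
  {M | M ∈ dsVariety (quadClasses a b c) ∧
    ∃ (g : GL (Fin 4) ℂ) (N P : Fin 4 → Matrix (Fin 2) (Fin 2) ℂ),
      (∀ j, M j = (g : Matrix (Fin 4) (Fin 4) ℂ) * blockDiag (N j) (P j) *
        ((g⁻¹ : GL (Fin 4) ℂ) : Matrix (Fin 4) (Fin 4) ℂ)) ∧
      IsIrreducibleTuple N ∧ IsIrreducibleTuple P ∧
      (∀ j : Fin 3, N j.castSucc ∈ conjClass (Matrix.diagonal ![a j, b j]) ∧
        P j.castSucc ∈ conjClass (Matrix.diagonal ![a j, b j])) ∧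
      N 3 = Matrix.diagonal ![c, c] ∧ P 3 ∈ conjClass !![c, 1; 0, c]}

end

/-! ### Krull dimension and derivations of affine domains -/

/-! Relative genericity enters only through `StratumCondition`: the product of all eigenvalues with
halved multiplicities is 1, and no choice of one eigenvalue per matrix has product 1. The second
condition excludes common invariant lines, so the irreducibility of the blocks is automatic and the
stratum consists of the conjugates of all direct sums of blocks in the prescribed classes
(`mem_stratumU_iff`).

Dimension and smoothness come from squeezing tangent spaces. From above: a tangent vector at `M`
lies in the product of the tangent spaces of the four classes, of dimension 8 + 8 + 8 + 6 = 30, and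
is killed by the differential of the product map. For the trace form, the annihilator of the image
of this differential lies in the centralizer of `M` (`finrank_range_prodDeriv`), which has dimension
at most 2 by Schur's lemma, since a scalar `N 3` and a non-scalar `P 3` prevent the summands from
being isomorphic. The rank is therefore at least 14, and the tangent spaces have dimension at most
16. For an irreducible quadruple the centralizer has dimension 1, and the same count gives the
expected 15.

From below: in the basis `v`, `P 0 v`, with `v` an eigenvector of `P 3`, the tuple `P` is given by a
point `(ρ, l, w)` of the surface `ρ l w = c p(l, w)`, while `N` is rigid. As `ρ` is a rational
function of `l` and `w`, a dense part of the stratum is the image of an open subset of an affine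
space of dimension 16 + 2. Traces invariant under conjugation recover `ρ`, `ρ w` and `ρ l`, so the
kernel of the differential of this parametrization consists of centralizer directions and its rank
is at least 18 - 2 = 16. By `exists_varietyDim_eq` the dimension of an irreducible variety bounds
all its tangent dimensions from below and is attained on a dense set, so all of them equal 16.

Irreducibility: the stratum lies between the image of the parametrization and its closure in the
classical topology (`stratumU_subset_closure`), and the identity theorem on complex lines does the
rest.

Local closedness: by polarized Cayley–Hamilton, with `R = M 3 - c`, the matrix `R Mᵢ + Mᵢ R - (aᵢ +
bᵢ) R` is `tr(R Mᵢ)` times the projection to the second summand. The splitting is thus a rational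
function of `M` where one of these traces is nonzero, which is always so on the stratum, and the
remaining conditions become polynomial equations. -/

theorem ringKrullDim_eq_of_isIntegral {R S : Type*} [CommRing R] [CommRing S] [Algebra R S]
    [Algebra.IsIntegral R S] (h : Function.Injective (algebraMap R S)) :
    ringKrullDim S = ringKrullDim R := by
  apply le_antisymm
  -- Incomparability gives this inequality; lying over and going up give the other one.
  · refine Order.krullDim_le_of_strictMono (PrimeSpectrum.comap (algebraMap R S)) ?_
    intro I J hIJ
    exact Ideal.IsIntegral.comap_lt_comap (R := R) (I := I.asIdeal) (J := J.asIdeal) hIJ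
  · have : Algebra.HasGoingUp R S := inferInstance
    refine iSup_le fun l => ?_
    obtain ⟨Q, -, hQ, hQ'⟩ := Ideal.exists_ideal_over_prime_of_isIntegral
      (RelSeries.head l).asIdeal (⊥ : Ideal S) (by
        rw [← RingHom.ker_eq_comap_bot, (RingHom.injective_iff_ker_eq_bot _).1 h]
        exact bot_le)
    have : Q.LiesOver (RelSeries.head l).asIdeal := ⟨hQ'.symm⟩
    obtain ⟨L, hL, -⟩ := Ideal.exists_ltSeries_of_hasGoingUp l Q
    rw [← hL]
    exact Order.LTSeries.length_le_krullDim L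

/-- Derivations extend uniquely along formally étale maps. -/
theorem compAlgebraMapL_bijective (R S T M : Type*) [CommRing R] [CommRing S] [CommRing T]
    [Algebra R S] [Algebra R T] [Algebra S T] [IsScalarTower R S T] [Algebra.FormallyEtale S T]
    [AddCommGroup M] [Module R M] [Module S M] [Module T M] [IsScalarTower S T M]
    [IsScalarTower R T M] [IsScalarTower R S M] :
    Function.Bijective (Derivation.compAlgebraMapL R S T M) := by
  -- A derivation is a linear map out of the differentials, and along a formally étale map the
  -- differentials of `T` are the base change of those of `S`.
  have hb := KaehlerDifferential.isBaseChange_of_formallyEtale R S T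
  constructor
  · intro d e hde
    suffices key : d.liftKaehlerDifferential = e.liftKaehlerDifferential by
      rw [← Derivation.liftKaehlerDifferential_comp d, key, Derivation.liftKaehlerDifferential_comp]
    refine hb.algHom_ext _ _ fun x => ?_
    refine LinearMap.congr_fun (f := (d.liftKaehlerDifferential.restrictScalars S).comp
      (KaehlerDifferential.map R R S T)) (g := (e.liftKaehlerDifferential.restrictScalars S).comp
      (KaehlerDifferential.map R R S T)) ?_ x
    refine Derivation.liftKaehlerDifferential_unique _ _ ?_
    ext s
    have := DFunLike.congr_fun hde s
    simpa using this
  · intro d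
    refine ⟨(hb.lift d.liftKaehlerDifferential).compDer (KaehlerDifferential.D R T), ?_⟩
    ext s
    have h1 := hb.lift_eq d.liftKaehlerDifferential (KaehlerDifferential.D R S s)
    rw [KaehlerDifferential.map_D] at h1
    simpa using h1

/-- Noether normalization makes `A` integral over a polynomial ring in `s` variables. In
characteristic zero `K` is formally étale both over that ring and over `A`, so the derivations of
either into `K` are those of `K` itself, and on the polynomial ring they are given by `s` free
values. -/
theorem exists_ringKrullDim_eq_finrank_derivation (k A K : Type*) [Field k] [CharZero k]
    [CommRing A] [IsDomain A] [Algebra k A] [Algebra.FiniteType k A] [Field K] [Algebra A K]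
    [IsFractionRing A K] [Algebra k K] [IsScalarTower k A K] :
    ∃ s : ℕ, ringKrullDim A = s ∧ Module.finrank K (Derivation k A K) = s := by
  obtain ⟨s, g, hg, hi⟩ := exists_integral_inj_algHom_of_fg k A
  refine ⟨s, ?_⟩
  let : Algebra (MvPolynomial (Fin s) k) A := g.toRingHom.toAlgebra
  let : Algebra (MvPolynomial (Fin s) k) K := ((algebraMap A K).comp g.toRingHom).toAlgebra
  have : IsScalarTower (MvPolynomial (Fin s) k) A K := IsScalarTower.of_algebraMap_eq' rfl
  have : IsScalarTower k (MvPolynomial (Fin s) k) A :=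
    IsScalarTower.of_algebraMap_eq' g.comp_algebraMap.symm
  have : IsScalarTower k (MvPolynomial (Fin s) k) K := by
    refine IsScalarTower.of_algebraMap_eq fun x => ?_
    rw [IsScalarTower.algebraMap_apply k A K, IsScalarTower.algebraMap_apply k (MvPolynomial (Fin s) k) A,
      ← IsScalarTower.algebraMap_apply (MvPolynomial (Fin s) k) A K]
  have : Algebra.IsIntegral (MvPolynomial (Fin s) k) A := ⟨hi⟩
  have hinj : Function.Injective (algebraMap (MvPolynomial (Fin s) k) A) := hg
  have hinjK : Function.Injective (algebraMap (MvPolynomial (Fin s) k) K) :=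
    (IsFractionRing.injective A K).comp hg
  have : FaithfulSMul (MvPolynomial (Fin s) k) K := (faithfulSMul_iff_algebraMap_injective _ _).2 hinjK
  have : FaithfulSMul (MvPolynomial (Fin s) k) A := (faithfulSMul_iff_algebraMap_injective _ _).2 hinj
  let : Algebra (FractionRing (MvPolynomial (Fin s) k)) K := FractionRing.liftAlgebra _ K
  have : Algebra.IsAlgebraic (MvPolynomial (Fin s) k) A := inferInstance
  have : Algebra.IsAlgebraic A K := IsLocalization.isAlgebraic K (nonZeroDivisors A)
  have : Algebra.IsAlgebraic (MvPolynomial (Fin s) k) K := Algebra.IsAlgebraic.trans _ A _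
  have : Algebra.IsAlgebraic (FractionRing (MvPolynomial (Fin s) k)) K :=
    (IsFractionRing.comap_isAlgebraic_iff (A := MvPolynomial (Fin s) k)).1 inferInstance
  have : CharZero (FractionRing (MvPolynomial (Fin s) k)) :=
    charZero_of_injective_algebraMap (IsFractionRing.injective (MvPolynomial (Fin s) k) _)
  have : Algebra.FormallyEtale (FractionRing (MvPolynomial (Fin s) k)) K :=
    Algebra.FormallyEtale.of_isSeparable _ _
  have : Algebra.FormallyEtale (MvPolynomial (Fin s) k) (FractionRing (MvPolynomial (Fin s) k)) :=
    Algebra.FormallyEtale.of_isLocalization (nonZeroDivisors _)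
  have : Algebra.FormallyEtale (MvPolynomial (Fin s) k) K :=
    Algebra.FormallyEtale.comp _ (FractionRing (MvPolynomial (Fin s) k)) _
  have : Algebra.FormallyEtale A K := Algebra.FormallyEtale.of_isLocalization (nonZeroDivisors _)
  constructor
  · rw [ringKrullDim_eq_of_isIntegral hinj, MvPolynomial.ringKrullDim_of_isNoetherianRing]
    simp
  · have e1 := LinearEquiv.ofBijective _ (compAlgebraMapL_bijective k A K K)
    have e2 := LinearEquiv.ofBijective _ (compAlgebraMapL_bijective k (MvPolynomial (Fin s) k) K K)
    have e3 : Derivation k (MvPolynomial (Fin s) k) K ≃ₗ[K] (Fin s → K) :=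
      { toFun := fun d i => d (MvPolynomial.X i)
        map_add' := fun _ _ => rfl
        map_smul' := fun _ _ => rfl
        invFun := MvPolynomial.mkDerivation k
        left_inv := fun d => by ext i; simp
        right_inv := fun f => by ext i; simp }
    rw [← e1.finrank_eq, e2.finrank_eq, e3.finrank_eq]
    simp

noncomputable section

/-! ### Common kernels of families of functionals -/

/-- The common kernel of the functionals `v ↦ ∑ i, g i * v i`, for `g ∈ G`. -/
def commonKer {F σ : Type*} [Field F] [Fintype σ] (G : Set (σ → F)) : Submodule F (σ → F) where
  carrier := {v | ∀ g ∈ G, ∑ i, g i * v i = 0}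
  add_mem' := fun {v w} hv hw g hg => by
    simp only [Pi.add_apply, mul_add, Finset.sum_add_distrib, hv g hg, hw g hg, add_zero]
  zero_mem' := fun g _ => by simp
  smul_mem' := fun c v hv g hg => by
    have := hv g hg
    simp only [Pi.smul_apply, smul_eq_mul, mul_left_comm _ c, ← Finset.mul_sum, this, mul_zero]

theorem mem_commonKer {F σ : Type*} [Field F] [Fintype σ] {G : Set (σ → F)} {v : σ → F} :
    v ∈ commonKer G ↔ ∀ g ∈ G, ∑ i, g i * v i = 0 := Iff.rfl

/-- A right inverse turns full row rank into a nonvanishing determinant without the choice of a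
minor; the next lemma is the way back. -/
theorem Matrix.exists_right_inverse_of_linearIndependent {F σ m : Type*} [Field F] [Fintype σ]
    [Fintype m] [DecidableEq m] {b : Matrix m σ F} (hb : LinearIndependent F b.row) :
    ∃ B : Matrix σ m F, b * B = 1 := by
  classical
  rw [← Matrix.mulVec_surjective_iff_exists_right_inverse]
  have h1 : b.rank = Fintype.card m := hb.rank_matrix
  have h2 : LinearMap.range b.mulVecLin = ⊤ := by
    apply Submodule.eq_top_of_finrank_eq
    rw [← Matrix.rank, h1]; simp
  exact LinearMap.range_eq_top.1 h2

theorem Matrix.linearIndependent_row_of_isUnit_det_mul {F σ m : Type*} [Field F] [Fintype σ]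
    [Fintype m] [DecidableEq m] {b : Matrix m σ F} {B : Matrix σ m F} (h : (b * B).det ≠ 0) :
    LinearIndependent F b.row := by
  rw [← Matrix.vecMul_injective_iff]
  intro v w hvw
  have h1 : Matrix.vecMul v (b * B) = Matrix.vecMul w (b * B) := by
    rw [← Matrix.vecMul_vecMul, ← Matrix.vecMul_vecMul]
    exact congrArg (fun z => Matrix.vecMul z B) hvw
  exact Matrix.vecMul_injective_of_isUnit ((Matrix.isUnit_iff_isUnit_det _).2 h.isUnit) h1

/-- Rank–nullity for a family of functionals that may be infinite. The maximality of `r` allows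
ranks over the function field and at points to be compared. -/
theorem exists_linearIndependent_commonKer {F σ : Type*} [Field F] [Fintype σ] (G : Set (σ → F)) :
    ∃ r : ℕ, Module.finrank F (commonKer G) + r = Fintype.card σ ∧
      (∃ b : Matrix (Fin r) σ F, (∀ i, b i ∈ G) ∧ LinearIndependent F b.row) ∧
      ∀ (m : ℕ) (b : Matrix (Fin m) σ F), (∀ i, b i ∈ G) → LinearIndependent F b.row → m ≤ r := by
  classical
  obtain ⟨B, hBG, hspan, hli⟩ := exists_linearIndependent F G
  have : Finite B := hli.finite
  have := Fintype.ofFinite B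
  let e := (Fintype.equivFin B).symm
  have hli' : LinearIndependent F (Matrix.row (fun i => (e i : σ → F))) :=
    hli.comp e e.injective
  refine ⟨Fintype.card B, ?_, ⟨fun i => (e i : σ → F), fun i => hBG (e i).2, hli'⟩, ?_⟩
  · let M : Matrix (Fin (Fintype.card B)) σ F := fun i => (e i : σ → F)
    have hk : commonKer G = LinearMap.ker M.mulVecLin := by
      ext v
      rw [mem_commonKer, LinearMap.mem_ker, Matrix.mulVecLin_apply]
      constructor
      · intro h
        ext i
        exact h _ (hBG (e i).2)
      · intro h g hg
        have hg' : g ∈ Submodule.span F B := hspan ▸ Submodule.subset_span hg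
        refine Submodule.span_induction (p := fun g _ => ∑ i, g i * v i = 0) ?_ ?_ ?_ ?_ hg'
        · intro x hx
          have := congrFun h (e.symm ⟨x, hx⟩)
          simpa [M, Matrix.mulVec, dotProduct] using this
        · simp
        · intro x y _ _ hx hy
          simp [add_mul, Finset.sum_add_distrib, hx, hy]
        · intro c x _ hx
          simp [mul_assoc, ← Finset.mul_sum, hx]
    have h1 : M.rank = Fintype.card (Fin (Fintype.card B)) := LinearIndependent.rank_matrix hli'
    have h2 := LinearMap.finrank_range_add_finrank_ker M.mulVecLin
    rw [← hk, ← Matrix.rank, h1] at h2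
    rw [Fintype.card_fin, Module.finrank_fintype_fun_eq_card] at h2
    omega
  · intro m b hb hbl
    have hle : Submodule.span F (Set.range b.row) ≤ Submodule.span F B := by
      rw [hspan]
      apply Submodule.span_mono
      rintro _ ⟨i, rfl⟩
      exact hb i
    have h1 := Submodule.finrank_mono hle
    rw [finrank_span_eq_card hbl, finrank_span_set_eq_card hli] at h1
    simpa using h1

/-! ### Zariski tangent spaces -/

theorem mem_zariskiTangentSpace {σ : Type} [Fintype σ] {S : Set (σ → ℂ)} {x v : σ → ℂ} :
    v ∈ zariskiTangentSpace S x ↔ ∀ f ∈ MvPolynomial.vanishingIdeal ℂ S,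
      ∑ i, MvPolynomial.eval x (MvPolynomial.pderiv i f) * v i = 0 := by
  simp [zariskiTangentSpace, Submodule.mem_iInf]

theorem zariskiTangentSpace_eq_commonKer {σ : Type} [Fintype σ] (S : Set (σ → ℂ)) (x : σ → ℂ) :
    zariskiTangentSpace S x = commonKer ((fun f i => MvPolynomial.eval x (MvPolynomial.pderiv i f)) ''
      (MvPolynomial.vanishingIdeal ℂ S : Set (MvPolynomial σ ℂ))) := by
  ext v
  rw [mem_zariskiTangentSpace, mem_commonKer]
  simp

theorem mem_vanishingIdeal_iff_eval {σ : Type} {S : Set (σ → ℂ)} {f : MvPolynomial σ ℂ} :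
    f ∈ MvPolynomial.vanishingIdeal ℂ S ↔ ∀ x ∈ S, MvPolynomial.eval x f = 0 := by
  rw [MvPolynomial.mem_vanishingIdeal_iff]
  rfl

theorem isOpen_zariski_ne {σ : Type} (f : MvPolynomial σ ℂ) :
    @IsOpen _ (zariskiTopology σ) {x | MvPolynomial.eval x f ≠ 0} := by
  let _ := zariskiTopology σ
  rw [← isClosed_compl_iff, isClosed_zariskiTopology_iff]
  exact ⟨{f}, by ext; simp⟩

/-- The complements of hypersurfaces form a basis of the Zariski topology, so irreducibility only
has to be tested on them. -/
theorem isIrreducibleVariety_iff {σ : Type} {S : Set (σ → ℂ)} :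
    IsIrreducibleVariety S ↔ S.Nonempty ∧ ∀ f g : MvPolynomial σ ℂ,
      (∃ x ∈ S, MvPolynomial.eval x f ≠ 0) → (∃ x ∈ S, MvPolynomial.eval x g ≠ 0) →
        ∃ x ∈ S, MvPolynomial.eval x f ≠ 0 ∧ MvPolynomial.eval x g ≠ 0 := by
  let _ := zariskiTopology σ
  have basic : ∀ {U : Set (σ → ℂ)} {x : σ → ℂ}, IsOpen U → x ∈ U →
      ∃ f : MvPolynomial σ ℂ, MvPolynomial.eval x f ≠ 0 ∧ {y | MvPolynomial.eval y f ≠ 0} ⊆ U := by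
    intro U x hU hx
    obtain ⟨F, hF⟩ := (isClosed_zariskiTopology_iff Uᶜ).1 hU.isClosed_compl
    have hx' : x ∉ Uᶜ := fun h => h hx
    rw [hF] at hx'
    simp only [Set.mem_ofPred_eq, not_forall] at hx'
    obtain ⟨f, hf, hfx⟩ := hx'
    refine ⟨f, hfx, fun y hy => ?_⟩
    by_contra hyU
    have : y ∈ Uᶜ := hyU
    rw [hF] at this
    exact hy (this f hf)
  constructor
  · rintro ⟨hne, hS⟩
    refine ⟨hne, fun f g ⟨x, hx, hfx⟩ ⟨y, hy, hgy⟩ => ?_⟩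
    obtain ⟨z, hz, hz'⟩ := hS _ _ (isOpen_zariski_ne f) (isOpen_zariski_ne g) ⟨x, hx, hfx⟩ ⟨y, hy, hgy⟩
    exact ⟨z, hz, hz'⟩
  · rintro ⟨hne, h⟩
    refine ⟨hne, fun U V hU hV ⟨x, hx, hxU⟩ ⟨y, hy, hyV⟩ => ?_⟩
    obtain ⟨f, hf, hfU⟩ := basic hU hxU
    obtain ⟨g, hg, hgV⟩ := basic hV hyV
    obtain ⟨z, hz, hz1, hz2⟩ := h f g ⟨x, hx, hf⟩ ⟨y, hy, hg⟩
    exact ⟨z, hz, hfU hz1, hgV hz2⟩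

theorem IsIrreducibleVariety.isPrime {σ : Type} {S : Set (σ → ℂ)} (hS : IsIrreducibleVariety S) :
    (MvPolynomial.vanishingIdeal ℂ S).IsPrime := by
  obtain ⟨⟨x, hx⟩, h⟩ := isIrreducibleVariety_iff.1 hS
  refine ⟨?_, fun {f g} hfg => ?_⟩
  · intro h1
    have : (1 : MvPolynomial σ ℂ) ∈ MvPolynomial.vanishingIdeal ℂ S := h1 ▸ Submodule.mem_top
    simpa using mem_vanishingIdeal_iff_eval.1 this x hx
  · by_contra! hc
    simp only [mem_vanishingIdeal_iff_eval, not_forall] at hc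
    obtain ⟨⟨y, hy, hy'⟩, ⟨z, hz, hz'⟩⟩ := hc
    obtain ⟨w, hw, hw1, hw2⟩ := h f g ⟨y, hy, hy'⟩ ⟨z, hz, hz'⟩
    have := mem_vanishingIdeal_iff_eval.1 hfg w hw
    simp [hw1, hw2] at this

/-- The derivations of a quotient of a polynomial ring into an extension field. -/
def derivationQuotientEquiv {σ : Type} [Fintype σ] (I : Ideal (MvPolynomial σ ℂ)) (K : Type)
    [Field K] [Algebra (MvPolynomial σ ℂ ⧸ I) K] [Algebra ℂ K]
    [IsScalarTower ℂ (MvPolynomial σ ℂ ⧸ I) K] :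
    Derivation ℂ (MvPolynomial σ ℂ ⧸ I) K ≃ₗ[K]
      commonKer ((fun f i => algebraMap (MvPolynomial σ ℂ ⧸ I) K
        (Ideal.Quotient.mk I (MvPolynomial.pderiv i f))) '' (I : Set (MvPolynomial σ ℂ))) := by
  letI : Algebra (MvPolynomial σ ℂ) K :=
    ((algebraMap (MvPolynomial σ ℂ ⧸ I) K).comp (Ideal.Quotient.mk I)).toAlgebra
  haveI t1 : IsScalarTower (MvPolynomial σ ℂ) (MvPolynomial σ ℂ ⧸ I) K :=
    ⟨fun x y z => by
      obtain ⟨y, rfl⟩ := Ideal.Quotient.mk_surjective y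
      rw [Algebra.smul_def, Algebra.smul_def]
      show algebraMap _ K (Ideal.Quotient.mk I (x * y)) * z = algebraMap _ K (Ideal.Quotient.mk I x) * _
      rw [Algebra.smul_def, map_mul, map_mul, mul_assoc]⟩
  haveI t2 : IsScalarTower ℂ (MvPolynomial σ ℂ) K := by
    refine IsScalarTower.of_algebraMap_eq fun x => ?_
    rw [IsScalarTower.algebraMap_apply ℂ (MvPolynomial σ ℂ ⧸ I) K]
    rfl
  have hsum : ∀ (d : Derivation ℂ (MvPolynomial σ ℂ) K) (f : MvPolynomial σ ℂ),
      d f = ∑ i, algebraMap (MvPolynomial σ ℂ ⧸ I) K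
        (Ideal.Quotient.mk I (MvPolynomial.pderiv i f)) * d (MvPolynomial.X i) := by
    intro d f
    classical
    have hsmul : ∀ (p : MvPolynomial σ ℂ) (z : K),
      p • z = algebraMap (MvPolynomial σ ℂ ⧸ I) K (Ideal.Quotient.mk I p) * z := fun _ _ => rfl
    induction f using MvPolynomial.induction_on with
    | C c => simp
    | add p q hp hq => simp only [map_add, hp, hq, add_mul, Finset.sum_add_distrib]
    | mul_X p j hp =>
      simp only [Derivation.leibniz, hsmul, hp, map_add, smul_eq_mul, add_mul, map_mul,
        Finset.sum_add_distrib, Finset.mul_sum, MvPolynomial.pderiv_X]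
      congr 1
      · rw [Finset.sum_eq_single j]
        · simp
        · intro i _ hij
          simp [hij.symm]
        · simp
      · exact Finset.sum_congr rfl fun i _ => by ring
  exact
  { toFun := fun d => ⟨fun i => d (Ideal.Quotient.mk I (MvPolynomial.X i)), by
      rintro _ ⟨f, hf, rfl⟩
      have h1 := hsum (d.compAlgebraMap (MvPolynomial σ ℂ)) f
      have h2 : (d.compAlgebraMap (MvPolynomial σ ℂ)) f = 0 := by
        show d (Ideal.Quotient.mk I f) = 0
        rw [Ideal.Quotient.eq_zero_iff_mem.2 hf, map_zero]
      rw [h2] at h1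
      exact h1.symm⟩
    map_add' := fun _ _ => rfl
    map_smul' := fun _ _ => rfl
    -- The derivation with prescribed values on the variables descends to the quotient because these
    -- values annihilate the gradients of the elements of `I`.
    invFun := fun v => Derivation.mk' ((I.restrictScalars ℂ).liftQ
        (MvPolynomial.mkDerivation ℂ (v : σ → K)).toLinearMap (by
          intro f hf
          have h1 := v.2 _ ⟨f, hf, rfl⟩
          have h2 := hsum (MvPolynomial.mkDerivation ℂ (v : σ → K)) f
          simp only [MvPolynomial.mkDerivation_X] at h2
          rw [LinearMap.mem_ker]
          exact h2.trans h1)) (by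
        intro f g
        obtain ⟨f, rfl⟩ := Ideal.Quotient.mk_surjective f
        obtain ⟨g, rfl⟩ := Ideal.Quotient.mk_surjective g
        rw [Algebra.smul_def, Algebra.smul_def]
        exact (MvPolynomial.mkDerivation ℂ (v : σ → K)).leibniz f g)
    left_inv := fun d => by
      have h1 : MvPolynomial.mkDerivation ℂ
          (fun i => d (Ideal.Quotient.mk I (MvPolynomial.X i))) =
          d.compAlgebraMap (MvPolynomial σ ℂ) := by
        apply MvPolynomial.derivation_ext
        intro i
        rw [MvPolynomial.mkDerivation_X]
        rfl
      ext f
      obtain ⟨f, rfl⟩ := Ideal.Quotient.mk_surjective f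
      exact DFunLike.congr_fun h1 f
    right_inv := fun v => by
      ext i
      exact MvPolynomial.mkDerivation_X _ _ _ }

end

/-! ### Dimension and tangent spaces of an irreducible variety -/

noncomputable section

theorem map_det_mul {σ m R S : Type} [Fintype σ] [CommRing R] [CommRing S] (φ : R →+* S)
    [Fintype m] [DecidableEq m] (J : Matrix m σ R) (B : Matrix σ m R) :
    φ (J * B).det = (J.map φ * B.map φ).det := by
  rw [RingHom.map_det]
  congr 1
  exact Matrix.map_mul

/-- The Zariski tangent spaces of an irreducible variety have at least the dimension of the variety,
with equality on a dense open subset. -/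
theorem exists_varietyDim_eq {σ : Type} [Fintype σ] {S : Set (σ → ℂ)}
    (hS : IsIrreducibleVariety S) :
    ∃ s : ℕ, varietyDim S = s ∧ (∀ x ∈ S, s ≤ Module.finrank ℂ (zariskiTangentSpace S x)) ∧
      ∀ h : MvPolynomial σ ℂ, (∃ x ∈ S, MvPolynomial.eval x h ≠ 0) →
        ∃ x ∈ S, MvPolynomial.eval x h ≠ 0 ∧ Module.finrank ℂ (zariskiTangentSpace S x) ≤ s := by
  classical
  set I := MvPolynomial.vanishingIdeal ℂ S with hI
  have hprime : I.IsPrime := hS.isPrime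
  let A := MvPolynomial σ ℂ ⧸ I
  let K := FractionRing A
  have : IsDomain A := Ideal.Quotient.isDomain I
  obtain ⟨s, hs, hs'⟩ := exists_ringKrullDim_eq_finrank_derivation ℂ A K
  refine ⟨s, hs, ?_⟩
  let φ : MvPolynomial σ ℂ →+* K := (algebraMap A K).comp (Ideal.Quotient.mk I)
  have hφ : ∀ f, φ f = 0 ↔ f ∈ I := fun f => by
    rw [← Ideal.Quotient.eq_zero_iff_mem]
    exact (map_eq_zero_iff _ (IsFractionRing.injective A K))
  rw [(derivationQuotientEquiv I K).finrank_eq] at hs'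
  obtain ⟨r, hr, ⟨b, hbG, hbl⟩, hmax⟩ := exists_linearIndependent_commonKer
    ((fun (f : MvPolynomial σ ℂ) (i : σ) => φ (MvPolynomial.pderiv i f)) '' (I : Set (MvPolynomial σ ℂ)))
  have hs'' : s + r = Fintype.card σ := by rw [← hr, ← hs']; rfl
  have hx : ∀ x : σ → ℂ, ∃ rx : ℕ, Module.finrank ℂ (zariskiTangentSpace S x) + rx = Fintype.card σ ∧
      (∃ b : Matrix (Fin rx) σ ℂ, (∀ i, b i ∈ (fun (f : MvPolynomial σ ℂ) i =>
        MvPolynomial.eval x (MvPolynomial.pderiv i f)) '' (I : Set (MvPolynomial σ ℂ))) ∧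
        LinearIndependent ℂ b.row) ∧
      ∀ (m : ℕ) (b : Matrix (Fin m) σ ℂ), (∀ i, b i ∈ (fun (f : MvPolynomial σ ℂ) i =>
        MvPolynomial.eval x (MvPolynomial.pderiv i f)) '' (I : Set (MvPolynomial σ ℂ))) →
        LinearIndependent ℂ b.row → m ≤ rx := by
    intro x
    rw [zariskiTangentSpace_eq_commonKer]
    exact exists_linearIndependent_commonKer _
  constructor
  · intro x hxS
    obtain ⟨rx, h1, ⟨bx, hbx, hbxl⟩, -⟩ := hx x
    suffices rx ≤ r by omega
    choose f hf hfb using hbx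
    let J : Matrix (Fin rx) σ (MvPolynomial σ ℂ) := fun i j => MvPolynomial.pderiv j (f i)
    -- With the constant matrix `B`, the polynomial `det (J * B')` has value 1 at `x`. It is
    -- therefore nonzero in the function field, so the Jacobian rank at `x` is at most the generic
    -- rank `r`.
    obtain ⟨B, hB⟩ := Matrix.exists_right_inverse_of_linearIndependent hbxl
    let B' : Matrix σ (Fin rx) (MvPolynomial σ ℂ) := B.map MvPolynomial.C
    have hJx : J.map (MvPolynomial.eval x) = bx := by
      ext i j
      exact congrFun (hfb i) j
    have hBx : B'.map (MvPolynomial.eval x) = B := by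
      ext i j
      simp [B']
    have hne : MvPolynomial.eval x (J * B').det ≠ 0 := by
      rw [map_det_mul, hJx, hBx, hB]; simp
    have hne' : φ (J * B').det ≠ 0 := fun h =>
      hne (mem_vanishingIdeal_iff_eval.1 ((hφ _).1 h) x hxS)
    rw [map_det_mul] at hne'
    refine hmax rx (J.map φ) ?_ (Matrix.linearIndependent_row_of_isUnit_det_mul hne')
    exact fun i => ⟨f i, hf i, rfl⟩
  · rintro h ⟨y, hyS, hy⟩
    choose f hf hfb using hbG
    let J : Matrix (Fin r) σ (MvPolynomial σ ℂ) := fun i j => MvPolynomial.pderiv j (f i)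
    obtain ⟨B, hB⟩ := Matrix.exists_right_inverse_of_linearIndependent hbl
    -- Clearing the denominators of the right inverse multiplies the determinant by a power of `d`
    -- only. This yields a polynomial whose nonvanishing at a point of `S` forces the Jacobian rank
    -- there to be at least `r`.
    obtain ⟨d, hd⟩ := IsLocalization.exist_integer_multiples_of_finset (nonZeroDivisors A)
      (Finset.univ.image fun p : σ × Fin r => B p.1 p.2)
    have hd' : ∀ i j, ∃ p : MvPolynomial σ ℂ, φ p = algebraMap A K d * B i j := by
      intro i j
      obtain ⟨q, hq⟩ := hd (B i j) (Finset.mem_image.2 ⟨(i, j), Finset.mem_univ _, rfl⟩)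
      obtain ⟨p, rfl⟩ := Ideal.Quotient.mk_surjective q
      exact ⟨p, by rw [← Algebra.smul_def]; exact hq⟩
    choose B' hB' using hd'
    have hJ : J.map φ = b := by
      ext i j
      exact congrFun (hfb i) j
    have hBφ : (Matrix.of B').map φ = algebraMap A K d • B := by
      ext i j
      exact hB' i j
    have hdne : algebraMap A K d ≠ 0 := by
      rw [Ne, map_eq_zero_iff _ (IsFractionRing.injective A K)]
      exact nonZeroDivisors.coe_ne_zero d
    have hne : φ (J * Matrix.of B').det ≠ 0 := by
      rw [map_det_mul, hJ, hBφ, Matrix.mul_smul, hB, Matrix.det_smul, Matrix.det_one, mul_one]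
      exact pow_ne_zero _ hdne
    have hmem : (J * Matrix.of B').det ∉ I := fun h => hne ((hφ _).2 h)
    rw [hI, mem_vanishingIdeal_iff_eval] at hmem
    push Not at hmem
    obtain ⟨x, hxS, hx1, hx2⟩ := (isIrreducibleVariety_iff.1 hS).2 h _ ⟨y, hyS, hy⟩ hmem
    refine ⟨x, hxS, hx1, ?_⟩
    obtain ⟨rx, h1, -, hmx⟩ := hx x
    suffices r ≤ rx by omega
    rw [map_det_mul] at hx2
    refine hmx r (J.map (MvPolynomial.eval x)) ?_ (Matrix.linearIndependent_row_of_isUnit_det_mul hx2)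
    exact fun i => ⟨f i, hf i, rfl⟩

/-! ### Differentials of polynomial functions -/

/-- This links formal partial derivatives to analysis: tangent vectors can be produced from curves,
and equations on them from derivatives of identities. -/
theorem hasFDerivAt_eval {σ : Type} [Fintype σ] (f : MvPolynomial σ ℂ) (x : σ → ℂ) :
    HasFDerivAt (fun y : σ → ℂ => MvPolynomial.eval y f)
      (∑ i, MvPolynomial.eval x (MvPolynomial.pderiv i f) •
        (ContinuousLinearMap.proj i : (σ → ℂ) →L[ℂ] ℂ)) x := by
  classical
  induction f using MvPolynomial.induction_on with
  | C c =>
    have h1 : (∑ i, MvPolynomial.eval x (MvPolynomial.pderiv i (MvPolynomial.C c)) •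
        (ContinuousLinearMap.proj i : (σ → ℂ) →L[ℂ] ℂ)) = 0 := by ext v; simp
    rw [h1]
    simpa only [MvPolynomial.eval_C] using hasFDerivAt_const c x
  | add p q hp hq =>
    have h1 : (∑ i, MvPolynomial.eval x (MvPolynomial.pderiv i (p + q)) •
        (ContinuousLinearMap.proj i : (σ → ℂ) →L[ℂ] ℂ)) =
        (∑ i, MvPolynomial.eval x (MvPolynomial.pderiv i p) • ContinuousLinearMap.proj i) +
        ∑ i, MvPolynomial.eval x (MvPolynomial.pderiv i q) • ContinuousLinearMap.proj i := by
      ext v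
      simp [add_mul, Finset.sum_add_distrib]
    rw [h1]
    exact (hp.add hq).congr_of_eventuallyEq (Filter.Eventually.of_forall fun y => by simp)
  | mul_X p j hp =>
    have h1 := hp.mul (ContinuousLinearMap.proj (R := ℂ) (φ := fun _ : σ => ℂ) j).hasFDerivAt (x := x)
    simp only [map_mul, MvPolynomial.eval_X]
    refine h1.congr_fderiv ?_
    ext v
    simp only [Derivation.leibniz, MvPolynomial.pderiv_X, smul_eq_mul, map_add, map_mul,
      MvPolynomial.eval_X, _root_.add_apply, _root_.smul_apply,
      _root_.sum_apply, ContinuousLinearMap.proj_apply, add_mul,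
      Finset.sum_add_distrib, Finset.mul_sum]
    congr 1
    · rw [Finset.sum_eq_single j]
      · simp
      · intro i _ hij
        simp [hij.symm]
      · simp
    · exact Finset.sum_congr rfl fun i _ => by ring

/-- The functions on affine space given by polynomials. -/
def IsPolynomialFun {σ : Type} (F : (σ → ℂ) → ℂ) : Prop :=
  ∃ f : MvPolynomial σ ℂ, ∀ x, F x = MvPolynomial.eval x f

namespace IsPolynomialFun

variable {σ : Type} {F G : (σ → ℂ) → ℂ}

theorem const (c : ℂ) : IsPolynomialFun (fun _ : σ → ℂ => c) := ⟨MvPolynomial.C c, fun _ => by simp⟩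

theorem coord (i : σ) : IsPolynomialFun (fun x : σ → ℂ => x i) := ⟨MvPolynomial.X i, fun _ => by simp⟩

theorem add (hF : IsPolynomialFun F) (hG : IsPolynomialFun G) :
    IsPolynomialFun (fun x => F x + G x) := by
  obtain ⟨f, hf⟩ := hF
  obtain ⟨g, hg⟩ := hG
  exact ⟨f + g, fun x => by simp [hf, hg]⟩

theorem mul (hF : IsPolynomialFun F) (hG : IsPolynomialFun G) :
    IsPolynomialFun (fun x => F x * G x) := by
  obtain ⟨f, hf⟩ := hF
  obtain ⟨g, hg⟩ := hG
  exact ⟨f * g, fun x => by simp [hf, hg]⟩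

theorem sub (hF : IsPolynomialFun F) (hG : IsPolynomialFun G) :
    IsPolynomialFun (fun x => F x - G x) := by
  obtain ⟨f, hf⟩ := hF
  obtain ⟨g, hg⟩ := hG
  exact ⟨f - g, fun x => by simp [hf, hg]⟩

theorem sum {ι : Type*} {s : Finset ι} {F : ι → (σ → ℂ) → ℂ} (hF : ∀ i, IsPolynomialFun (F i)) :
    IsPolynomialFun (fun x => ∑ i ∈ s, F i x) := by
  choose f hf using hF
  exact ⟨∑ i ∈ s, f i, fun x => by simp [hf]⟩

end IsPolynomialFun

/-- The differential of a polynomial function that vanishes on `S` vanishes on tangent vectors. -/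
theorem fderiv_eq_zero_of_mem_zariskiTangentSpace {σ : Type} [Fintype σ] {S : Set (σ → ℂ)}
    {x v : σ → ℂ} (hv : v ∈ zariskiTangentSpace S x) {F : (σ → ℂ) → ℂ} (hF : IsPolynomialFun F)
    (h0 : ∀ y ∈ S, F y = 0) {F' : (σ → ℂ) →L[ℂ] ℂ} (hF' : HasFDerivAt F F' x) : F' v = 0 := by
  obtain ⟨f, hf⟩ := hF
  obtain rfl : F = fun y => MvPolynomial.eval y f := funext hf
  rw [hF'.unique (hasFDerivAt_eval f x)]
  have := mem_zariskiTangentSpace.1 hv f (mem_vanishingIdeal_iff_eval.2 h0)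
  simpa using this

/-- The velocity vector of a curve in `S` is tangent to `S`. -/
theorem mem_zariskiTangentSpace_of_hasDerivAt {σ : Type} [Fintype σ] {S : Set (σ → ℂ)}
    {γ : ℂ → σ → ℂ} {v : σ → ℂ} (hγ : HasDerivAt γ v 0) (hS : ∀ᶠ t in nhds 0, γ t ∈ S) :
    v ∈ zariskiTangentSpace S (γ 0) := by
  rw [mem_zariskiTangentSpace]
  intro f hf
  have h1 := (hasFDerivAt_eval f (γ 0)).comp_hasDerivAt 0 hγ
  have h2 : HasDerivAt (fun _ : ℂ => (0 : ℂ)) 0 0 := hasDerivAt_const _ _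
  have h3 : ((fun y : σ → ℂ => MvPolynomial.eval y f) ∘ γ) =ᶠ[nhds 0] fun _ => (0 : ℂ) := by
    filter_upwards [hS] with t ht
    exact mem_vanishingIdeal_iff_eval.1 hf _ ht
  have := h1.unique (h2.congr_of_eventuallyEq h3)
  simpa using this

end

noncomputable section

open scoped Matrix.Norms.Operator

/-! ### Irreducibility of parametrized varieties -/

/-- The zeros of a nonzero entire function are discrete, hence countable, and the complement of a
countable set in a real plane is path-connected. -/
theorem isPreconnected_setOf_ne_zero {δ : ℂ → ℂ} (hδ : Differentiable ℂ δ) {t₀ : ℂ} (h : δ t₀ ≠ 0) :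
    IsPreconnected {t | δ t ≠ 0} := by
  have han : AnalyticOnNhd ℂ δ Set.univ := fun t _ => hδ.analyticAt t
  have hcod : δ ⁻¹' {0}ᶜ ∈ Filter.codiscrete ℂ := han.preimage_zero_mem_codiscrete h
  have hdisc : IsDiscrete (δ ⁻¹' {0}) := by
    have := isDiscrete_of_codiscreteWithin (s := δ ⁻¹' {0}) (U := Set.univ) hcod
    rwa [Set.inter_univ] at this
  have hcount : (δ ⁻¹' {0}).Countable :=
    (HereditarilyLindelofSpace.isLindelof _).countable_of_isDiscrete hdisc
  have hc := hcount.isPathConnected_compl_of_one_lt_rank (E := ℂ) (by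
    rw [Complex.rank_real_complex]; exact Cardinal.one_lt_two)
  exact hc.isConnected.isPreconnected

/-- A set between the image of a complex analytic parametrization and its closure is irreducible. -/
theorem isIrreducibleVariety_of_parametrization {σ : Type} [Fintype σ] {E : Type*}
    [NormedAddCommGroup E] [NormedSpace ℂ E] {S : Set (σ → ℂ)} {δ : E → ℂ}
    (hδ : Differentiable ℂ δ) {φ : E → σ → ℂ} (hφ : ∀ e, δ e ≠ 0 → DifferentiableAt ℂ φ e)
    (hne : ∃ e, δ e ≠ 0) (hsub : ∀ e, δ e ≠ 0 → φ e ∈ S) (hcl : S ⊆ closure (φ '' {e | δ e ≠ 0})) :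
    IsIrreducibleVariety S := by
  rw [isIrreducibleVariety_iff]
  refine ⟨hne.elim fun e he => ⟨φ e, hsub e he⟩, fun f g hf hg => ?_⟩
  have hcont : ∀ f : MvPolynomial σ ℂ, Differentiable ℂ (fun x : σ → ℂ => MvPolynomial.eval x f) :=
    fun f x => (hasFDerivAt_eval f x).differentiableAt
  have key : ∀ f : MvPolynomial σ ℂ, (∃ x ∈ S, MvPolynomial.eval x f ≠ 0) →
      ∃ e, δ e ≠ 0 ∧ MvPolynomial.eval (φ e) f ≠ 0 := by
    rintro f ⟨x, hx, hfx⟩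
    -- The closure is the classical one; a polynomial that is nonzero at a point stays nonzero
    -- nearby, hence somewhere on the image.
    obtain ⟨_, hy, e, he, rfl⟩ := mem_closure_iff.1 (hcl hx) {y | MvPolynomial.eval y f ≠ 0}
      (isOpen_ne.preimage (hcont f).continuous) hfx
    exact ⟨e, he, hy⟩
  obtain ⟨e₀, he₀, hf₀⟩ := key f hf
  obtain ⟨e₁, he₁, hg₁⟩ := key g hg
  by_contra! hcon
  -- On the complex line through the two parameters the admissible set is connected, so two analytic
  -- functions with product zero cannot be nonzero at `t = 0` and `t = 1` respectively.
  let ℓ : ℂ → E := fun t => e₀ + t • (e₁ - e₀)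
  have hℓ : Differentiable ℂ ℓ :=
    (differentiable_const _).add (differentiable_id.smul (differentiable_const _))
  have h0 : ℓ 0 = e₀ := by simp [ℓ]
  have h1 : ℓ 1 = e₁ := by simp [ℓ]
  have hopen : IsOpen {t | δ (ℓ t) ≠ 0} := isOpen_ne.preimage (hδ.comp hℓ).continuous
  have han : ∀ f : MvPolynomial σ ℂ,
      AnalyticOnNhd ℂ (fun t => MvPolynomial.eval (φ (ℓ t)) f) {t | δ (ℓ t) ≠ 0} := by
    intro f
    refine DifferentiableOn.analyticOnNhd (fun t ht => ?_) hopen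
    have := (hcont f (φ (ℓ t))).comp t ((hφ (ℓ t) ht).comp t (hℓ t))
    exact this.differentiableWithinAt
  have hprod : ∀ t ∈ {t | δ (ℓ t) ≠ 0},
      MvPolynomial.eval (φ (ℓ t)) f * MvPolynomial.eval (φ (ℓ t)) g = 0 := by
    intro t ht
    by_cases hft : MvPolynomial.eval (φ (ℓ t)) f = 0
    · rw [hft, zero_mul]
    · rw [hcon _ (hsub _ ht) hft, mul_zero]
  have hpre : IsPreconnected {t | δ (ℓ t) ≠ 0} :=
    isPreconnected_setOf_ne_zero (hδ.comp hℓ) (t₀ := 0) (by simpa [h0] using he₀)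
  rcases (han f).eq_zero_or_eq_zero_of_mul_eq_zero (han g) hprod hpre with h | h
  · exact hf₀ (by have := h 0 (by simpa [h0] using he₀); rwa [h0] at this)
  · exact hg₁ (by have := h 1 (by simpa [h1] using he₁); rwa [h1] at this)

/-! ### Calculus of tuples of matrices -/

/-- `tuplePoint` as a linear equivalence. -/
def tupleEquiv (n k : ℕ) :
    (Fin k → Matrix (Fin n) (Fin n) ℂ) ≃ₗ[ℂ] (Fin k × Fin n × Fin n → ℂ) where
  toFun := tuplePoint
  map_add' _ _ := rfl
  map_smul' _ _ := rfl
  invFun v j := Matrix.of fun i l => v (j, i, l)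
  left_inv _ := rfl
  right_inv _ := rfl

/-- `matrixPoint` as a linear equivalence. -/
def matrixEquiv (n : ℕ) : Matrix (Fin n) (Fin n) ℂ ≃ₗ[ℂ] (Fin n × Fin n → ℂ) where
  toFun := matrixPoint
  map_add' _ _ := rfl
  map_smul' _ _ := rfl
  invFun v := Matrix.of fun i l => v (i, l)
  left_inv _ := rfl
  right_inv _ := rfl

theorem hasFDerivAt_tuplePoint {n k : ℕ} (M : Fin k → Matrix (Fin n) (Fin n) ℂ) :
    HasFDerivAt (tuplePoint (n := n) (k := k))
      (LinearMap.toContinuousLinearMap (tupleEquiv n k).toLinearMap) M :=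
  (LinearMap.toContinuousLinearMap (tupleEquiv n k).toLinearMap).hasFDerivAt

theorem hasFDerivAt_matrixPoint {n : ℕ} (A : Matrix (Fin n) (Fin n) ℂ) :
    HasFDerivAt (matrixPoint (n := n))
      (LinearMap.toContinuousLinearMap (matrixEquiv n).toLinearMap) A :=
  (LinearMap.toContinuousLinearMap (matrixEquiv n).toLinearMap).hasFDerivAt

theorem differentiable_matrix_det {n : ℕ} :
    Differentiable ℂ (fun A : Matrix (Fin n) (Fin n) ℂ => A.det) := by
  have hentry : ∀ i j, Differentiable ℂ (fun A : Matrix (Fin n) (Fin n) ℂ => A i j) := fun i j =>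
    (LinearMap.toContinuousLinearMap (Matrix.entryLinearMap ℂ ℂ i j)).differentiable
  simp only [Matrix.det_apply]
  fun_prop

/-- Commutators are the velocities of conjugation orbits; `1 + t Y` serves as the curve of
invertible matrices, in place of the exponential. -/
theorem hasDerivAt_conj {n : ℕ} (Y A : Matrix (Fin n) (Fin n) ℂ) :
    HasDerivAt (fun t : ℂ => (1 + t • Y) * A * (1 + t • Y)⁻¹) (Y * A - A * Y) 0 := by
  have h1 : HasDerivAt (fun t : ℂ => 1 + t • Y) Y 0 := by
    exact (((hasDerivAt_id (0 : ℂ)).smul_const Y).const_add 1).congr_deriv (one_smul ℂ Y)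
  have h2 : HasDerivAt (fun t : ℂ => (1 + t • Y)⁻¹) (-Y) 0 := by
    simp only [Matrix.nonsing_inv_eq_ringInverse]
    have h3 := hasFDerivAt_ringInverse (𝕜 := ℂ) (1 : (Matrix (Fin n) (Fin n) ℂ)ˣ)
    have h4 : ((1 : (Matrix (Fin n) (Fin n) ℂ)ˣ) : Matrix (Fin n) (Fin n) ℂ) = 1 + (0 : ℂ) • Y := by
      simp
    rw [h4] at h3
    have h5 := h3.comp_hasDerivAt (0 : ℂ) h1
    have h6 : (-((ContinuousLinearMap.mulLeftRight ℂ (Matrix (Fin n) (Fin n) ℂ))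
        ↑(1 : (Matrix (Fin n) (Fin n) ℂ)ˣ)⁻¹) ↑(1 : (Matrix (Fin n) (Fin n) ℂ)ˣ)⁻¹) Y = -Y := by
      simp
    exact h5.congr_deriv h6
  have h5 := (h1.mul_const A).mul h2
  refine h5.congr_deriv ?_
  simp [sub_eq_add_neg]

theorem differentiableAt_matrix_inv {n : ℕ} {g : Matrix (Fin n) (Fin n) ℂ} (hg : g.det ≠ 0) :
    DifferentiableAt ℂ (fun g : Matrix (Fin n) (Fin n) ℂ => g⁻¹) g := by
  simp only [Matrix.nonsing_inv_eq_ringInverse]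
  exact differentiableAt_inverse ((Matrix.isUnit_iff_isUnit_det g).2 hg.isUnit)

theorem eventually_det_ne_zero {n : ℕ} (Y : Matrix (Fin n) (Fin n) ℂ) :
    ∀ᶠ t : ℂ in nhds 0, (1 + t • Y).det ≠ 0 := by
  have h : Continuous fun t : ℂ => (1 + t • Y).det :=
    differentiable_matrix_det.continuous.comp (by fun_prop)
  exact h.continuousAt.eventually_ne (by simp)

end

noncomputable section

/-! ### Conjugacy classes -/

theorem mem_conjClass_iff {n : ℕ} {A X : Matrix (Fin n) (Fin n) ℂ} :
    X ∈ conjClass A ↔ ∃ g h : Matrix (Fin n) (Fin n) ℂ, g * h = 1 ∧ h * g = 1 ∧ X = g * A * h := by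
  constructor
  · rintro ⟨g, rfl⟩
    exact ⟨g, ↑g⁻¹, by simp, by simp, rfl⟩
  · rintro ⟨g, h, h1, h2, rfl⟩
    exact ⟨⟨g, h, h1, h2⟩, rfl⟩

theorem conj_mul_conj {n : ℕ} {g h : Matrix (Fin n) (Fin n) ℂ} (hg : h * g = 1)
    (A B : Matrix (Fin n) (Fin n) ℂ) : (g * A * h) * (g * B * h) = g * (A * B) * h := by
  calc (g * A * h) * (g * B * h) = g * A * (h * g) * B * h := by simp only [mul_assoc]
    _ = g * (A * B) * h := by rw [hg]; simp only [mul_assoc, one_mul]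

theorem mem_conjClass_of_mul_eq {n : ℕ} {A X g : Matrix (Fin n) (Fin n) ℂ} (hg : g.det ≠ 0)
    (h : X * g = g * A) : X ∈ conjClass A := by
  have hu : IsUnit g.det := hg.isUnit
  refine mem_conjClass_iff.2 ⟨g, g⁻¹, Matrix.mul_nonsing_inv g hu, Matrix.nonsing_inv_mul g hu, ?_⟩
  rw [← h, mul_assoc, Matrix.mul_nonsing_inv g hu, mul_one]

theorem mem_conjClass_self {n : ℕ} (A : Matrix (Fin n) (Fin n) ℂ) : A ∈ conjClass A :=
  mem_conjClass_iff.2 ⟨1, 1, by simp, by simp, by simp⟩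

theorem conj_mem_conjClass {n : ℕ} {A X g h : Matrix (Fin n) (Fin n) ℂ} (h1 : g * h = 1)
    (h2 : h * g = 1) (hX : X ∈ conjClass A) : g * X * h ∈ conjClass A := by
  obtain ⟨u, v, huv, hvu, rfl⟩ := mem_conjClass_iff.1 hX
  refine mem_conjClass_iff.2 ⟨g * u, v * h, ?_, ?_, by simp only [mul_assoc]⟩
  · rw [mul_assoc, ← mul_assoc u, huv, one_mul, h1]
  · rw [mul_assoc, ← mul_assoc h, h2, one_mul, hvu]

theorem trace_conj_eq {n : ℕ} {g h : Matrix (Fin n) (Fin n) ℂ} (h2 : h * g = 1)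
    (A : Matrix (Fin n) (Fin n) ℂ) : (g * A * h).trace = A.trace := by
  rw [Matrix.trace_mul_cycle, h2, one_mul]

theorem trace_of_mem_conjClass {n : ℕ} {A X : Matrix (Fin n) (Fin n) ℂ} (hX : X ∈ conjClass A) :
    X.trace = A.trace := by
  obtain ⟨g, h, h1, h2, rfl⟩ := mem_conjClass_iff.1 hX
  exact trace_conj_eq h2 A

theorem det_of_mem_conjClass {n : ℕ} {A X : Matrix (Fin n) (Fin n) ℂ} (hX : X ∈ conjClass A) :
    X.det = A.det := by
  obtain ⟨g, h, h1, h2, rfl⟩ := mem_conjClass_iff.1 hX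
  rw [Matrix.det_mul, Matrix.det_mul, mul_comm, ← mul_assoc, ← Matrix.det_mul, h2, Matrix.det_one,
    one_mul]

theorem conj_sub_smul_one {n : ℕ} {g h : Matrix (Fin n) (Fin n) ℂ} (h1 : g * h = 1)
    (A : Matrix (Fin n) (Fin n) ℂ) (c : ℂ) : g * A * h - c • 1 = g * (A - c • 1) * h := by
  rw [mul_sub, sub_mul]
  simp [h1]

theorem quadratic_of_mem_conjClass {n : ℕ} {A X : Matrix (Fin n) (Fin n) ℂ} {a b : ℂ}
    (hX : X ∈ conjClass A) (hA : (A - a • 1) * (A - b • 1) = 0) : (X - a • 1) * (X - b • 1) = 0 := by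
  obtain ⟨g, h, h1, h2, rfl⟩ := mem_conjClass_iff.1 hX
  rw [conj_sub_smul_one h1, conj_sub_smul_one h1, conj_mul_conj h2, hA]
  simp

/-! ### Matrices of size two -/

theorem sub_mul_sub_fin_two (X : Matrix (Fin 2) (Fin 2) ℂ) (a b : ℂ) (ht : X.trace = a + b)
    (hd : X.det = a * b) : (X - a • 1) * (X - b • 1) = 0 := by
  rw [Matrix.trace_fin_two] at ht
  rw [Matrix.det_fin_two] at hd
  ext i j
  fin_cases i <;> fin_cases j <;>
    simp [Matrix.mul_apply, Fin.sum_univ_two, Matrix.one_apply] <;> grind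

/-- Eigenvectors for the two distinct eigenvalues are the columns of a conjugating matrix, so the
class is cut out by two polynomial equations. -/
theorem mem_conjClass_diagonal_iff {a b : ℂ} (hab : a ≠ b) {X : Matrix (Fin 2) (Fin 2) ℂ} :
    X ∈ conjClass (Matrix.diagonal ![a, b]) ↔ X.trace = a + b ∧ X.det = a * b := by
  constructor
  · intro hX
    rw [trace_of_mem_conjClass hX, det_of_mem_conjClass hX]
    simp
  · rintro ⟨ht, hd⟩
    have hq := sub_mul_sub_fin_two X a b ht hd
    have hda : (X - a • 1).det = 0 := by
      rw [Matrix.trace_fin_two] at ht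
      rw [Matrix.det_fin_two] at hd ⊢
      simp
      linear_combination hd - a * ht
    have hdb : (X - b • 1).det = 0 := by
      rw [Matrix.trace_fin_two] at ht
      rw [Matrix.det_fin_two] at hd ⊢
      simp
      linear_combination hd - b * ht
    obtain ⟨v, hv0, hv⟩ := Matrix.exists_mulVec_eq_zero_iff.2 hda
    obtain ⟨w, hw0, hw⟩ := Matrix.exists_mulVec_eq_zero_iff.2 hdb
    have e1 := congrFun hv 0
    have e2 := congrFun hv 1
    have e3 := congrFun hw 0
    have e4 := congrFun hw 1
    simp [Matrix.mulVec, dotProduct, Fin.sum_univ_two, Matrix.one_apply] at e1 e2 e3 e4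
    have hdet : (!![v 0, w 0; v 1, w 1]).det ≠ 0 := by
      rw [Matrix.det_fin_two_of]
      intro h0
      -- Proportional eigenvectors for `a` and `b` would make all products `v i * w j` vanish.
      have k1 : (a - b) * (v 0 * w 0) = 0 ∧ (a - b) * (v 0 * w 1) = 0 ∧ (a - b) * (v 1 * w 0) = 0 ∧
          (a - b) * (v 1 * w 1) = 0 := by
        refine ⟨?_, ?_, ?_, ?_⟩ <;> grind
      have hab' := sub_ne_zero.2 hab
      simp only [mul_eq_zero, hab', false_or] at k1
      have hv' : v 0 ≠ 0 ∨ v 1 ≠ 0 := by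
        by_contra! hc
        exact hv0 (by ext i; fin_cases i <;> simp [hc])
      have hw' : w 0 ≠ 0 ∨ w 1 ≠ 0 := by
        by_contra! hc
        exact hw0 (by ext i; fin_cases i <;> simp [hc])
      grind
    refine mem_conjClass_of_mul_eq hdet ?_
    ext i j
    fin_cases i <;> fin_cases j <;>
      simp [Matrix.mul_apply, Fin.sum_univ_two, Matrix.diagonal_apply] <;> grind

/-- A Jordan chain `(X - c) u, u` forms the columns of the conjugating matrix, where `u` is the
first basis vector if `X 1 0 ≠ 0` and the second one otherwise. -/
theorem mem_conjClass_jordan_iff {c : ℂ} {X : Matrix (Fin 2) (Fin 2) ℂ} :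
    X ∈ conjClass !![c, 1; 0, c] ↔ X.trace = 2 * c ∧ X.det = c ^ 2 ∧ X ≠ c • 1 := by
  constructor
  · intro hX
    refine ⟨?_, ?_, ?_⟩
    · rw [trace_of_mem_conjClass hX]; simp [Matrix.trace_fin_two, two_mul]
    · rw [det_of_mem_conjClass hX]; simp [Matrix.det_fin_two, sq]
    · rintro rfl
      obtain ⟨g, h, h1, h2, hgh⟩ := mem_conjClass_iff.1 hX
      have : h * (c • 1) * g = !![c, 1; 0, c] := by
        rw [hgh]
        calc h * (g * !![c, 1; 0, c] * h) * g = (h * g) * !![c, 1; 0, c] * (h * g) := by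
              simp only [mul_assoc]
          _ = _ := by rw [h2]; simp
      have h3 := congrFun (congrFun this 0) 1
      simp [h2] at h3
  · rintro ⟨ht, hd, hne⟩
    have hq := sub_mul_sub_fin_two X c c (by rw [ht]; ring) (by rw [hd]; ring)
    rw [Matrix.trace_fin_two] at ht
    rw [Matrix.det_fin_two] at hd
    by_cases h10 : X 1 0 = 0
    · have h00 : X 0 0 = c := by
        have : (X 0 0 - c) ^ 2 = 0 := by grind
        simpa [sub_eq_zero] using this
      have h01 : X 0 1 ≠ 0 := by
        intro h01
        apply hne
        ext i j
        fin_cases i <;> fin_cases j <;> simp [h10, h00, h01]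
        linear_combination ht - h00
      refine mem_conjClass_of_mul_eq (g := !![X 0 1, 0; 0, 1]) (by simpa using h01) ?_
      ext i j
      fin_cases i <;> fin_cases j <;>
        simp [Matrix.mul_apply, Fin.sum_univ_two] <;> grind
    · refine mem_conjClass_of_mul_eq (g := !![X 0 0 - c, 1; X 1 0, 0]) (by simpa using h10) ?_
      ext i j
      fin_cases i <;> fin_cases j <;>
        simp [Matrix.mul_apply, Fin.sum_univ_two] <;> grind

/-! ### Block-diagonal matrices -/

/-- The `4 × 4` matrix with given `2 × 2` blocks. -/
def blockMatrix (A B C D : Matrix (Fin 2) (Fin 2) ℂ) : Matrix (Fin 4) (Fin 4) ℂ :=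
  Matrix.reindex (finSumFinEquiv (m := 2) (n := 2)) (finSumFinEquiv (m := 2) (n := 2))
    (Matrix.fromBlocks A B C D)

theorem blockMatrix_zero_zero (N P : Matrix (Fin 2) (Fin 2) ℂ) :
    blockMatrix N 0 0 P = blockDiag N P := rfl

theorem exists_eq_blockMatrix (Y : Matrix (Fin 4) (Fin 4) ℂ) :
    ∃ A B C D, Y = blockMatrix A B C D := by
  let Z := (Matrix.reindex (finSumFinEquiv (m := 2) (n := 2)) (finSumFinEquiv (m := 2) (n := 2))).symm Y
  refine ⟨Z.toBlocks₁₁, Z.toBlocks₁₂, Z.toBlocks₂₁, Z.toBlocks₂₂, ?_⟩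
  rw [blockMatrix, Matrix.fromBlocks_toBlocks, Equiv.apply_symm_apply]

theorem blockMatrix_inj {A B C D A' B' C' D' : Matrix (Fin 2) (Fin 2) ℂ} :
    blockMatrix A B C D = blockMatrix A' B' C' D' ↔ A = A' ∧ B = B' ∧ C = C' ∧ D = D' := by
  rw [blockMatrix, blockMatrix, EmbeddingLike.apply_eq_iff_eq, Matrix.fromBlocks_inj]

theorem blockMatrix_mul (A B C D A' B' C' D' : Matrix (Fin 2) (Fin 2) ℂ) :
    blockMatrix A B C D * blockMatrix A' B' C' D' =
      blockMatrix (A * A' + B * C') (A * B' + B * D') (C * A' + D * C') (C * B' + D * D') := by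
  simp only [blockMatrix, Matrix.reindex_apply, Matrix.submatrix_mul_equiv, Matrix.fromBlocks_multiply]

theorem blockMatrix_add (A B C D A' B' C' D' : Matrix (Fin 2) (Fin 2) ℂ) :
    blockMatrix A B C D + blockMatrix A' B' C' D' =
      blockMatrix (A + A') (B + B') (C + C') (D + D') := by
  have := Matrix.fromBlocks_add A B C D A' B' C' D'
  exact congrArg (Matrix.reindex (finSumFinEquiv (m := 2) (n := 2)) (finSumFinEquiv (m := 2) (n := 2))) this

theorem blockMatrix_sub (A B C D A' B' C' D' : Matrix (Fin 2) (Fin 2) ℂ) :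
    blockMatrix A B C D - blockMatrix A' B' C' D' =
      blockMatrix (A - A') (B - B') (C - C') (D - D') := by
  rw [sub_eq_iff_eq_add, blockMatrix_add]
  simp only [sub_add_cancel]

theorem blockMatrix_smul (c : ℂ) (A B C D : Matrix (Fin 2) (Fin 2) ℂ) :
    c • blockMatrix A B C D = blockMatrix (c • A) (c • B) (c • C) (c • D) := by
  have := Matrix.fromBlocks_smul c A B C D 
  exact congrArg (Matrix.reindex (finSumFinEquiv (m := 2) (n := 2)) (finSumFinEquiv (m := 2) (n := 2))) this

theorem blockMatrix_one : blockMatrix 1 0 0 1 = 1 := by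
  rw [blockMatrix, Matrix.fromBlocks_one]
  simp

theorem trace_blockMatrix (A B C D : Matrix (Fin 2) (Fin 2) ℂ) :
    (blockMatrix A B C D).trace = A.trace + D.trace := by
  have h : (blockMatrix A B C D).trace = (Matrix.fromBlocks A B C D).trace :=
    Equiv.sum_comp (finSumFinEquiv (m := 2) (n := 2)).symm (fun i => Matrix.fromBlocks A B C D i i)
  rw [h, Matrix.trace, Fintype.sum_sum_type]
  rfl

theorem blockDiag_mul (N P N' P' : Matrix (Fin 2) (Fin 2) ℂ) :
    blockDiag N P * blockDiag N' P' = blockDiag (N * N') (P * P') := by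
  simp only [← blockMatrix_zero_zero, blockMatrix_mul]
  simp

theorem blockDiag_add (N P N' P' : Matrix (Fin 2) (Fin 2) ℂ) :
    blockDiag N P + blockDiag N' P' = blockDiag (N + N') (P + P') := by
  simp only [← blockMatrix_zero_zero, blockMatrix_add]
  simp

theorem blockDiag_sub (N P N' P' : Matrix (Fin 2) (Fin 2) ℂ) :
    blockDiag N P - blockDiag N' P' = blockDiag (N - N') (P - P') := by
  simp only [← blockMatrix_zero_zero, blockMatrix_sub]
  simp

theorem blockDiag_smul (c : ℂ) (N P : Matrix (Fin 2) (Fin 2) ℂ) :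
    c • blockDiag N P = blockDiag (c • N) (c • P) := by
  simp only [← blockMatrix_zero_zero, blockMatrix_smul]
  simp

theorem blockDiag_one : blockDiag 1 1 = 1 := blockMatrix_one

theorem blockDiag_inj {N P N' P' : Matrix (Fin 2) (Fin 2) ℂ} :
    blockDiag N P = blockDiag N' P' ↔ N = N' ∧ P = P' := by
  simp only [← blockMatrix_zero_zero, blockMatrix_inj, true_and]

theorem trace_blockDiag (N P : Matrix (Fin 2) (Fin 2) ℂ) :
    (blockDiag N P).trace = N.trace + P.trace := trace_blockMatrix _ _ _ _

theorem blockDiag_mem_conjClass {N P A B : Matrix (Fin 2) (Fin 2) ℂ} (hN : N ∈ conjClass A)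
    (hP : P ∈ conjClass B) : blockDiag N P ∈ conjClass (blockDiag A B) := by
  obtain ⟨g, h, h1, h2, rfl⟩ := mem_conjClass_iff.1 hN
  obtain ⟨u, v, h3, h4, rfl⟩ := mem_conjClass_iff.1 hP
  exact mem_conjClass_iff.2 ⟨blockDiag g u, blockDiag h v, by rw [blockDiag_mul, h1, h3, blockDiag_one],
    by rw [blockDiag_mul, h2, h4, blockDiag_one], by simp only [blockDiag_mul]⟩

end

noncomputable section

/-! ### The genericity conditions -/

/-- The conditions on the eigenvalues in explicit form. -/
structure StratumCondition (a b : Fin 3 → ℂ) (c : ℂ) : Prop where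
  ne : ∀ j, a j ≠ b j
  prod_eq : a 0 * b 0 * (a 1 * b 1) * (a 2 * b 2) * c ^ 2 = 1
  prod_ne : ∀ x : Fin 3 → ℂ, (∀ j, x j = a j ∨ x j = b j) → x 0 * x 1 * x 2 * c ≠ 1

/-- Halved multiplicities mean that `Φ` takes one index from each of the pairs `{0, 1}` and `{2,
3}`. -/
theorem prod_eq_of_halved_multiplicities {a b : ℂ} (hab : a ≠ b) {Φ : Finset (Fin 4)}
    (h : ∀ z, 2 * {i | i ∈ Φ ∧ ![a, a, b, b] i = z}.ncard = {i | ![a, a, b, b] i = z}.ncard) :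
    ∏ i ∈ Φ, ![a, a, b, b] i = a * b := by
  have ha : ∀ i : Fin 4, ![a, a, b, b] i = a ↔ i ∈ ({0, 1} : Finset (Fin 4)) := by
    intro i; fin_cases i <;> simp [hab.symm]
  have hb : ∀ i : Fin 4, ![a, a, b, b] i = b ↔ i ∈ ({2, 3} : Finset (Fin 4)) := by
    intro i; fin_cases i <;> simp [hab]
  have h1 := h a
  have h2 := h b
  simp only [ha, hb] at h1 h2
  have e1 : {i | i ∈ Φ ∧ i ∈ ({0, 1} : Finset (Fin 4))} = ((Φ ∩ {0, 1} : Finset (Fin 4)) : Set (Fin 4)) := by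
    ext; simp
  have e2 : {i | i ∈ Φ ∧ i ∈ ({2, 3} : Finset (Fin 4))} = ((Φ ∩ {2, 3} : Finset (Fin 4)) : Set (Fin 4)) := by
    ext; simp
  have e3 : {i | i ∈ ({0, 1} : Finset (Fin 4))} = (({0, 1} : Finset (Fin 4)) : Set (Fin 4)) := rfl
  have e4 : {i | i ∈ ({2, 3} : Finset (Fin 4))} = (({2, 3} : Finset (Fin 4)) : Set (Fin 4)) := rfl
  rw [e1, e3, Set.ncard_coe_finset, Set.ncard_coe_finset] at h1
  rw [e2, e4, Set.ncard_coe_finset, Set.ncard_coe_finset] at h2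
  have h1' : (Φ ∩ {0, 1}).card = 1 := by
    have : ({0, 1} : Finset (Fin 4)).card = 2 := rfl
    omega
  have h2' : (Φ ∩ {2, 3}).card = 1 := by
    have : ({2, 3} : Finset (Fin 4)).card = 2 := rfl
    omega
  have key : ∀ Ψ : Finset (Fin 4), (Ψ ∩ {0, 1}).card = 1 → (Ψ ∩ {2, 3}).card = 1 →
      Ψ = {0, 2} ∨ Ψ = {0, 3} ∨ Ψ = {1, 2} ∨ Ψ = {1, 3} := by decide
  rcases key Φ h1' h2' with rfl | rfl | rfl | rfl <;> simp

/-- Some relation holds and it has to be the balanced one. A product of one eigenvalue per matrix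
equal to 1 would be a relation with `s = 1`, which is never balanced: the fourth index set would
need half of the four copies of `c`. -/
theorem stratumCondition_of_relativelyGeneric {a b : Fin 3 → ℂ} {c : ℂ} (hab : ∀ j, a j ≠ b j)
    (hrel : IsRelativelyGenericEigenvalues (quadEigenvalues a b c))
    (hnot : ¬ IsGenericEigenvalues (quadEigenvalues a b c)) : StratumCondition a b c := by
  refine ⟨hab, ?_, ?_⟩
  · rw [IsGenericEigenvalues] at hnot
    push Not at hnot
    obtain ⟨Φ, hΦ⟩ := hnot
    have hh := hrel Φ hΦ
    have h0 := prod_eq_of_halved_multiplicities (hab 0) (hh 0)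
    have h1 := prod_eq_of_halved_multiplicities (hab 1) (hh 1)
    have h2 := prod_eq_of_halved_multiplicities (hab 2) (hh 2)
    have h3 : (Φ 3).card = 2 := by
      have h := hh 3 c
      have hc : ∀ i, quadEigenvalues a b c 3 i = c := by
        intro i; fin_cases i <;> rfl
      simp only [hc, and_true] at h
      have e : ({i | i ∈ Φ 3} : Set (Fin 4)).ncard = (Φ 3).card := Set.ncard_coe_finset _
      have : ({i | True} : Set (Fin 4)).ncard = 4 := by simp
      omega
    have h3' : ∏ i ∈ Φ 3, quadEigenvalues a b c 3 i = c ^ 2 := by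
      rw [← h3]
      apply Finset.prod_eq_pow_card
      intro i _
      fin_cases i <;> rfl
    have h := hΦ.2
    rw [Fin.prod_univ_four, h3'] at h
    rw [← h0, ← h1, ← h2]
    exact h
  · intro x hx hprod
    have hx' : ∀ j, ∃ i : Fin 4, quadEigenvalues a b c j.castSucc i = x j := by
      intro j
      rcases hx j with h | h
      · exact ⟨0, by rw [h]; fin_cases j <;> rfl⟩
      · exact ⟨2, by rw [h]; fin_cases j <;> rfl⟩
    choose i hi using hx'
    have hh := hrel ![{i 0}, {i 1}, {i 2}, {0}] ⟨⟨1, by norm_num, by norm_num, by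
      intro j; fin_cases j <;> simp⟩, by
      have e0 := hi 0
      have e1 := hi 1
      have e2 := hi 2
      simp only [Fin.castSucc_zero] at e0
      rw [Fin.prod_univ_four]
      simp only [Matrix.cons_val, Finset.prod_singleton]
      rw [← hprod, ← e0, ← e1, ← e2]
      rfl⟩ 3 c
    have hc : ∀ i, quadEigenvalues a b c 3 i = c := by
      intro i; fin_cases i <;> rfl
    simp [hc] at hh

namespace StratumCondition

variable {a b : Fin 3 → ℂ} {c : ℂ}

theorem c_ne (h : StratumCondition a b c) : c ≠ 0 := by
  rintro rfl
  simpa using h.prod_eq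

theorem a_ne (h : StratumCondition a b c) (j : Fin 3) : a j ≠ 0 := by
  intro h0
  have := h.prod_eq
  fin_cases j <;> simp at h0 <;> simp [h0] at this

theorem b_ne (h : StratumCondition a b c) (j : Fin 3) : b j ≠ 0 := by
  intro h0
  have := h.prod_eq
  fin_cases j <;> simp at h0 <;> simp [h0] at this

end StratumCondition

/-! ### Tuples of `2 × 2` matrices -/

/-- Quadruples of `2 × 2` matrices with product `1`, the first three in the classes of
`diag(aⱼ, bⱼ)`. -/
structure IsBlockTuple (a b : Fin 3 → ℂ) (Q : Fin 4 → Matrix (Fin 2) (Fin 2) ℂ) : Prop where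
  mem_class : ∀ j : Fin 3, Q j.castSucc ∈ conjClass (Matrix.diagonal ![a j, b j])
  prod_eq : Q 0 * Q 1 * Q 2 * Q 3 = 1

/-- The third matrix is the inverse of `Q 3 * Q 0 * Q 1`, so its class condition turns into a trace
condition on this product; its determinant is already forced by `StratumCondition.prod_eq`. What
remains are equations that can be solved explicitly. -/
theorem isBlockTuple_iff {a b : Fin 3 → ℂ} {c : ℂ} (h : StratumCondition a b c)
    {Q : Fin 4 → Matrix (Fin 2) (Fin 2) ℂ} (h3 : (Q 3).det = c ^ 2) :
    IsBlockTuple a b Q ↔ (Q 0).trace = a 0 + b 0 ∧ (Q 0).det = a 0 * b 0 ∧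
      (Q 1).trace = a 1 + b 1 ∧ (Q 1).det = a 1 * b 1 ∧
      (Q 3 * Q 0 * Q 1).trace = (a 2)⁻¹ + (b 2)⁻¹ ∧ Q 2 = (Q 3 * Q 0 * Q 1)⁻¹ := by
  have ha := h.a_ne
  have hb := h.b_ne
  have hc := h.c_ne
  have hinv : ∀ X : Matrix (Fin 2) (Fin 2) ℂ, (X⁻¹).trace = X.det⁻¹ * X.trace := by
    intro X
    rw [Matrix.inv_def, Matrix.adjugate_fin_two, Matrix.trace_smul, Matrix.trace_fin_two_of,
      Matrix.trace_fin_two, Ring.inverse_eq_inv', smul_eq_mul, add_comm (X 1 1)]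
  constructor
  · rintro ⟨hcl, hp⟩
    have h0 := (mem_conjClass_diagonal_iff (h.ne 0)).1 (hcl 0)
    have h1 := (mem_conjClass_diagonal_iff (h.ne 1)).1 (hcl 1)
    have h2 := (mem_conjClass_diagonal_iff (h.ne 2)).1 (hcl 2)
    have hp' : Q 3 * Q 0 * Q 1 * Q 2 = 1 := by
      have : Q 3 * (Q 0 * Q 1 * Q 2) = 1 := mul_eq_one_comm.1 hp
      simpa only [mul_assoc] using this
    have hQ2 : Q 3 * Q 0 * Q 1 = (Q 2)⁻¹ := (Matrix.inv_eq_left_inv hp').symm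
    refine ⟨h0.1, h0.2, h1.1, h1.2, ?_, (Matrix.inv_eq_right_inv hp').symm⟩
    rw [hQ2, hinv]
    have e1 : (Q 2).trace = a 2 + b 2 := h2.1
    have e2 : (Q 2).det = a 2 * b 2 := h2.2
    rw [e1, e2]
    field_simp [ha 2, hb 2]
    ring
  · rintro ⟨t0, d0, t1, d1, ht, hQ2⟩
    have hdet : (Q 3 * Q 0 * Q 1).det = (a 2 * b 2)⁻¹ := by
      rw [Matrix.det_mul, Matrix.det_mul, h3, d0, d1]
      have := h.prod_eq
      field_simp [ha 2, hb 2]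
      linear_combination this
    have hne : (Q 3 * Q 0 * Q 1).det ≠ 0 := by
      rw [hdet]
      exact inv_ne_zero (mul_ne_zero (ha 2) (hb 2))
    have hp' : Q 3 * Q 0 * Q 1 * Q 2 = 1 := by
      rw [hQ2]; exact Matrix.mul_nonsing_inv _ hne.isUnit
    refine ⟨fun j => ?_, ?_⟩
    · rw [mem_conjClass_diagonal_iff (h.ne j)]
      fin_cases j
      · exact ⟨t0, d0⟩
      · exact ⟨t1, d1⟩
      · show (Q 2).trace = a 2 + b 2 ∧ (Q 2).det = a 2 * b 2
        rw [hQ2, hinv, Matrix.det_nonsing_inv, hdet, ht]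
        constructor
        · field_simp [ha 2, hb 2]
          ring
        · simp
    · apply mul_eq_one_comm.1
      simpa only [mul_assoc] using hp'

theorem IsBlockTuple.conj {a b : Fin 3 → ℂ} {Q : Fin 4 → Matrix (Fin 2) (Fin 2) ℂ}
    (hQ : IsBlockTuple a b Q) {g h : Matrix (Fin 2) (Fin 2) ℂ} (h1 : g * h = 1) (h2 : h * g = 1) :
    IsBlockTuple a b (fun j => g * Q j * h) := by
  refine ⟨fun j => conj_mem_conjClass h1 h2 (hQ.mem_class j), ?_⟩
  rw [conj_mul_conj h2, conj_mul_conj h2, conj_mul_conj h2, hQ.prod_eq]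
  simp [h1]

/-- Simultaneous upper triangular form is excluded by genericity. -/
theorem IsBlockTuple.not_triangular {a b : Fin 3 → ℂ} {c : ℂ} (h : StratumCondition a b c)
    {Q : Fin 4 → Matrix (Fin 2) (Fin 2) ℂ} (hQ : IsBlockTuple a b Q) (h0 : Q 0 1 0 = 0)
    (h1 : Q 1 1 0 = 0) (h3 : Q 3 1 0 = 0) (hc : Q 3 0 0 = c) (hc' : Q 3 1 1 = c) : False := by
  have ha := h.a_ne 2
  have hb := h.b_ne 2
  have h3d : (Q 3).det = c ^ 2 := by rw [Matrix.det_fin_two, h3, hc, hc']; ring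
  obtain ⟨t0, d0, t1, d1, ht, -⟩ := (isBlockTuple_iff h h3d).1 hQ
  rw [Matrix.trace_fin_two] at t0 t1 ht
  rw [Matrix.det_fin_two, h0] at d0
  rw [Matrix.det_fin_two, h1] at d1
  simp only [Matrix.mul_apply, Fin.sum_univ_two, h0, h1, h3, hc, hc'] at ht
  have e0 : Q 0 0 0 = a 0 ∨ Q 0 0 0 = b 0 := by
    have : (Q 0 0 0 - a 0) * (Q 0 0 0 - b 0) = 0 := by linear_combination Q 0 0 0 * t0 - d0
    rcases mul_eq_zero.1 this with h | h
    · exact Or.inl (sub_eq_zero.1 h)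
    · exact Or.inr (sub_eq_zero.1 h)
  have e1 : Q 1 0 0 = a 1 ∨ Q 1 0 0 = b 1 := by
    have : (Q 1 0 0 - a 1) * (Q 1 0 0 - b 1) = 0 := by linear_combination Q 1 0 0 * t1 - d1
    rcases mul_eq_zero.1 this with h | h
    · exact Or.inl (sub_eq_zero.1 h)
    · exact Or.inr (sub_eq_zero.1 h)
  have hm : (c * Q 0 0 0 * Q 1 0 0) * (c * Q 0 1 1 * Q 1 1 1) = (a 2)⁻¹ * (b 2)⁻¹ := by
    have := h.prod_eq
    field_simp
    linear_combination (c ^ 2 * Q 1 0 0 * Q 1 1 1 * a 2 * b 2) * d0 +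
      (c ^ 2 * a 2 * b 2 * a 0 * b 0) * d1 + this
  -- The upper left entry of the triangular product `Q 3 * Q 0 * Q 1` is an eigenvalue of the
  -- inverse of `Q 2`, which yields a forbidden relation with `s = 1`.
  have e2 : (c * Q 0 0 0 * Q 1 0 0 - (a 2)⁻¹) * (c * Q 0 0 0 * Q 1 0 0 - (b 2)⁻¹) = 0 := by
    linear_combination (c * Q 0 0 0 * Q 1 0 0) * ht - hm
  rcases mul_eq_zero.1 e2 with h2 | h2
  · refine h.prod_ne ![Q 0 0 0, Q 1 0 0, a 2] ?_ ?_
    · intro j; fin_cases j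
      · exact e0
      · exact e1
      · exact Or.inl rfl
    · simp only [Matrix.cons_val]
      have : c * Q 0 0 0 * Q 1 0 0 = (a 2)⁻¹ := sub_eq_zero.1 h2
      field_simp at this
      linear_combination this
  · refine h.prod_ne ![Q 0 0 0, Q 1 0 0, b 2] ?_ ?_
    · intro j; fin_cases j
      · exact e0
      · exact e1
      · exact Or.inr rfl
    · simp only [Matrix.cons_val]
      have : c * Q 0 0 0 * Q 1 0 0 = (b 2)⁻¹ := sub_eq_zero.1 h2
      field_simp at this
      linear_combination this

end

noncomputable section

/-! ### Irreducible tuples -/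

/-- A matrix that commutes with an irreducible tuple is scalar. -/
theorem IsIrreducibleTuple.eq_smul_one {n k : ℕ} {Q : Fin k → Matrix (Fin n) (Fin n) ℂ}
    (hQ : IsIrreducibleTuple Q) {Y : Matrix (Fin n) (Fin n) ℂ} (hY : ∀ j, Q j * Y = Y * Q j) :
    ∃ z : ℂ, Y = z • 1 := by
  have hn : Nonempty (Fin n) := ⟨⟨0, hQ.1⟩⟩
  obtain ⟨z, hz⟩ := Module.End.exists_eigenvalue (Matrix.toLin' Y)
  refine ⟨z, ?_⟩
  have h := hQ.2 (Module.End.eigenspace (Matrix.toLin' Y) z) (by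
    intro j w hw
    rw [Module.End.mem_eigenspace_iff, Matrix.toLin'_apply] at hw ⊢
    rw [Matrix.mulVec_mulVec, ← hY j, ← Matrix.mulVec_mulVec, hw, Matrix.mulVec_smul])
  rcases h with h | h
  · exact absurd h hz
  · apply Matrix.toLin'.injective
    ext1 i
    ext1
    have : (LinearMap.single ℂ (fun _ : Fin n => ℂ) i) 1 ∈ Module.End.eigenspace (Matrix.toLin' Y) z :=
      h ▸ Submodule.mem_top
    rw [Module.End.mem_eigenspace_iff] at this
    simp only [LinearMap.comp_apply, this, map_smul, Matrix.toLin'_one, LinearMap.smul_apply,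
      LinearMap.id_apply]

/-- An intertwiner out of an irreducible tuple is zero or injective. -/
theorem IsIrreducibleTuple.eq_zero_or_det_ne_zero {n k : ℕ}
    {Q Q' : Fin k → Matrix (Fin n) (Fin n) ℂ}
    (hQ : IsIrreducibleTuple Q) {Y : Matrix (Fin n) (Fin n) ℂ} (hY : ∀ j, Q' j * Y = Y * Q j) :
    Y = 0 ∨ Y.det ≠ 0 := by
  have h := hQ.2 (LinearMap.ker (Matrix.toLin' Y)) (by
    intro j w hw
    rw [LinearMap.mem_ker, Matrix.toLin'_apply] at hw ⊢
    rw [Matrix.mulVec_mulVec, ← hY j, ← Matrix.mulVec_mulVec, hw, Matrix.mulVec_zero])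
  rcases h with h | h
  · right
    intro h0
    obtain ⟨v, hv, hv'⟩ := Matrix.exists_mulVec_eq_zero_iff.2 h0
    have : v ∈ LinearMap.ker (Matrix.toLin' Y) := by
      rw [LinearMap.mem_ker, Matrix.toLin'_apply, hv']
    rw [h, Submodule.mem_bot] at this
    exact hv this
  · left
    exact Matrix.toLin'.injective (by rw [LinearMap.ker_eq_top.1 h, map_zero])

theorem eigenvalue_of_mem_conjClass_diagonal {a b z : ℂ} {X : Matrix (Fin 2) (Fin 2) ℂ}
    (hab : a ≠ b) (hX : X ∈ conjClass (Matrix.diagonal ![a, b])) {v : Fin 2 → ℂ} (hv : v ≠ 0)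
    (h : X.mulVec v = z • v) : z = a ∨ z = b := by
  obtain ⟨ht, hd⟩ := (mem_conjClass_diagonal_iff hab).1 hX
  have hq := sub_mul_sub_fin_two X a b ht hd
  have h1 := congrArg (fun Y => Y.mulVec v) hq
  simp only [← Matrix.mulVec_mulVec, Matrix.sub_mulVec, Matrix.smul_mulVec, Matrix.one_mulVec, h,
    Matrix.zero_mulVec, Matrix.mulVec_sub, Matrix.mulVec_smul] at h1
  have h2 : ((z - a) * (z - b)) • v = 0 := by
    rw [← h1]
    simp only [sub_mul, mul_sub, sub_smul, smul_smul, smul_sub]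
    simp only [mul_comm]
  rcases mul_eq_zero.1 ((smul_eq_zero.1 h2).resolve_right hv) with h | h
  · exact Or.inl (sub_eq_zero.1 h)
  · exact Or.inr (sub_eq_zero.1 h)

/-- A common invariant line picks one eigenvalue of each matrix, with product 1, which
`StratumCondition.prod_ne` forbids. The condition `h3` only says that the eigenvalue of `Q 3` is
`c`, so it covers both the scalar and the Jordan case. -/
theorem IsBlockTuple.isIrreducibleTuple {a b : Fin 3 → ℂ} {c : ℂ} (h : StratumCondition a b c)
    {Q : Fin 4 → Matrix (Fin 2) (Fin 2) ℂ} (hQ : IsBlockTuple a b Q)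
    (h3 : (Q 3 - c • 1) * (Q 3 - c • 1) = 0) : IsIrreducibleTuple Q := by
  refine ⟨by norm_num, fun W hW => ?_⟩
  by_contra! hc
  obtain ⟨hbot, htop⟩ := hc
  obtain ⟨v, hvW, hv⟩ := Submodule.exists_mem_ne_zero_of_ne_bot hbot
  have hfin : Module.finrank ℂ W ≤ 1 := by
    have h1 := Submodule.finrank_lt htop
    rw [Module.finrank_fintype_fun_eq_card, Fintype.card_fin] at h1
    omega
  have heig : ∀ j, ∃ z : ℂ, (Q j).mulVec v = z • v := by
    intro j
    obtain ⟨u, hu⟩ := finrank_le_one_iff.1 hfin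
    obtain ⟨x, hx⟩ := hu ⟨v, hvW⟩
    obtain ⟨y, hy⟩ := hu ⟨_, hW j v hvW⟩
    have hx' : x • (u : Fin 2 → ℂ) = v := congrArg Subtype.val hx
    have hy' : y • (u : Fin 2 → ℂ) = (Q j).mulVec v := congrArg Subtype.val hy
    have hx0 : x ≠ 0 := by
      rintro rfl
      exact hv (by rw [← hx', zero_smul])
    refine ⟨y / x, ?_⟩
    rw [← hy', ← hx', smul_smul, div_mul_cancel₀ _ hx0]
  choose z hz using heig
  have hz' : ∀ j : Fin 3, z j.castSucc = a j ∨ z j.castSucc = b j := fun j =>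
    eigenvalue_of_mem_conjClass_diagonal (h.ne j) (hQ.mem_class j) hv (hz j.castSucc)
  have hz3 : z 3 = c := by
    have h1 := congrArg (fun Y => Y.mulVec v) h3
    simp only [← Matrix.mulVec_mulVec, Matrix.sub_mulVec, Matrix.smul_mulVec, Matrix.one_mulVec, hz,
      Matrix.zero_mulVec, Matrix.mulVec_sub, Matrix.mulVec_smul] at h1
    have h2 : ((z 3 - c) * (z 3 - c)) • v = 0 := by
      rw [← h1]
      simp only [sub_mul, mul_sub, sub_smul, smul_smul, smul_sub]
      abel
    have := (smul_eq_zero.1 h2).resolve_right hv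
    exact sub_eq_zero.1 (mul_self_eq_zero.1 this)
  have hp := congrArg (fun Y => Y.mulVec v) hQ.prod_eq
  simp only [← Matrix.mulVec_mulVec, hz, Matrix.mulVec_smul, smul_smul, Matrix.one_mulVec] at hp
  have hp' : (z 0 * z 1 * z 2 * c - 1) • v = 0 := by
    rw [sub_smul, one_smul, sub_eq_zero, ← hz3]
    rw [← hp]
    congr 1
    ring
  refine h.prod_ne (fun j => z j.castSucc) hz' ?_
  exact sub_eq_zero.1 ((smul_eq_zero.1 hp').resolve_right hv)

/-! ### Description of the stratum -/

/-- The quadruples `N` in the definition of the stratum. -/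
structure IsScalarBlock (a b : Fin 3 → ℂ) (c : ℂ) (N : Fin 4 → Matrix (Fin 2) (Fin 2) ℂ) : Prop
    extends IsBlockTuple a b N where
  eq_scalar : N 3 = c • 1

/-- The quadruples `P` in the definition of the stratum. -/
structure IsJordanBlock (a b : Fin 3 → ℂ) (c : ℂ) (P : Fin 4 → Matrix (Fin 2) (Fin 2) ℂ) : Prop
    extends IsBlockTuple a b P where
  mem_jordan : P 3 ∈ conjClass !![c, 1; 0, c]

variable {a b : Fin 3 → ℂ} {c : ℂ} {N P : Fin 4 → Matrix (Fin 2) (Fin 2) ℂ}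

theorem IsScalarBlock.isIrreducibleTuple (h : StratumCondition a b c) (hN : IsScalarBlock a b c N) :
    IsIrreducibleTuple N :=
  hN.toIsBlockTuple.isIrreducibleTuple h (by rw [hN.eq_scalar]; simp)

theorem IsJordanBlock.sub_mul_sub (hP : IsJordanBlock a b c P) :
    (P 3 - c • 1) * (P 3 - c • 1) = 0 := by
  obtain ⟨ht, hd, -⟩ := mem_conjClass_jordan_iff.1 hP.mem_jordan
  exact sub_mul_sub_fin_two _ _ _ (by rw [ht]; ring) (by rw [hd]; ring)

theorem IsJordanBlock.isIrreducibleTuple (h : StratumCondition a b c) (hP : IsJordanBlock a b c P) :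
    IsIrreducibleTuple P :=
  hP.toIsBlockTuple.isIrreducibleTuple h hP.sub_mul_sub

theorem IsJordanBlock.conj (hP : IsJordanBlock a b c P) {g h : Matrix (Fin 2) (Fin 2) ℂ}
    (h1 : g * h = 1) (h2 : h * g = 1) : IsJordanBlock a b c (fun j => g * P j * h) :=
  ⟨hP.toIsBlockTuple.conj h1 h2, conj_mem_conjClass h1 h2 hP.mem_jordan⟩

theorem IsScalarBlock.conj (hN : IsScalarBlock a b c N) {g h : Matrix (Fin 2) (Fin 2) ℂ}
    (h1 : g * h = 1) (h2 : h * g = 1) : IsScalarBlock a b c (fun j => g * N j * h) :=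
  ⟨hN.toIsBlockTuple.conj h1 h2, by rw [hN.eq_scalar]; simp [h1]⟩

theorem blockDiag_eq (N P : Matrix (Fin 2) (Fin 2) ℂ) :
    blockDiag N P = !![N 0 0, N 0 1, 0, 0; N 1 0, N 1 1, 0, 0; 0, 0, P 0 0, P 0 1;
      0, 0, P 1 0, P 1 1] := by
  ext i j
  fin_cases i <;> fin_cases j <;> rfl

theorem blockDiag_diagonal_mem (x y : ℂ) :
    blockDiag (Matrix.diagonal ![x, y]) (Matrix.diagonal ![x, y]) ∈
      conjClass (Matrix.diagonal ![x, x, y, y]) := by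
  refine mem_conjClass_of_mul_eq (g := !![1, 0, 0, 0; 0, 0, 1, 0; 0, 1, 0, 0; 0, 0, 0, 1]) ?_ ?_
  · rw [Matrix.det_succ_row_zero]
    simp [Fin.sum_univ_succ, Matrix.det_fin_three, Fin.succAbove]
  · rw [blockDiag_eq]
    ext i j
    fin_cases i <;> fin_cases j <;> simp [Matrix.mul_apply, Fin.sum_univ_four]

theorem blockDiag_jordan_mem (c : ℂ) :
    blockDiag (c • 1) !![c, 1; 0, c] ∈
      conjClass !![c, 1, 0, 0; 0, c, 0, 0; 0, 0, c, 0; 0, 0, 0, c] := by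
  refine mem_conjClass_of_mul_eq (g := !![0, 0, 1, 0; 0, 0, 0, 1; 1, 0, 0, 0; 0, 1, 0, 0]) ?_ ?_
  · rw [Matrix.det_succ_row_zero]
    simp [Fin.sum_univ_succ, Matrix.det_fin_three, Fin.succAbove]
  · rw [blockDiag_eq]
    ext i j
    fin_cases i <;> fin_cases j <;> simp [Matrix.mul_apply, Fin.sum_univ_four]

theorem eq_one_of_conj_eq_one {n : ℕ} {g k X : Matrix (Fin n) (Fin n) ℂ} (hk : k * g = 1)
    (h : g * X * k = 1) : X = 1 := by
  calc X = (k * g) * X * (k * g) := by rw [hk, one_mul, mul_one]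
    _ = k * (g * X * k) * g := by simp only [mul_assoc]
    _ = 1 := by rw [h, mul_one, hk]

/-- Irreducibility of the blocks is automatic by genericity, the product relation holds if and only
if it holds in both blocks, and the classes of the blocks determine those of the sum. Only
conditions on the blocks survive. -/
theorem mem_stratumU_iff (h : StratumCondition a b c) {M : Fin 4 → Matrix (Fin 4) (Fin 4) ℂ} :
    M ∈ stratumU a b c ↔ ∃ (g k : Matrix (Fin 4) (Fin 4) ℂ) (N P : Fin 4 → Matrix (Fin 2) (Fin 2) ℂ),
      g * k = 1 ∧ k * g = 1 ∧ IsScalarBlock a b c N ∧ IsJordanBlock a b c P ∧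
        ∀ j, M j = g * blockDiag (N j) (P j) * k := by
  have hdiag : Matrix.diagonal ![c, c] = (c • 1 : Matrix (Fin 2) (Fin 2) ℂ) := by
    ext i j; fin_cases i <;> fin_cases j <;> simp
  constructor
  · rintro ⟨⟨-, hprod⟩, g, N, P, hM, -, -, hcl, hN3, hP3⟩
    have hM' : (List.ofFn M).prod = (g : Matrix (Fin 4) (Fin 4) ℂ) *
        blockDiag (N 0 * N 1 * N 2 * N 3) (P 0 * P 1 * P 2 * P 3) *
        ((g⁻¹ : GL (Fin 4) ℂ) : Matrix (Fin 4) (Fin 4) ℂ) := by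
      have hg : ((g⁻¹ : GL (Fin 4) ℂ) : Matrix (Fin 4) (Fin 4) ℂ) * (g : Matrix (Fin 4) (Fin 4) ℂ) = 1 := by
        simp
      rw [← blockDiag_mul, ← blockDiag_mul, ← blockDiag_mul, ← conj_mul_conj hg, ← conj_mul_conj hg,
        ← conj_mul_conj hg, ← hM, ← hM, ← hM, ← hM]
      simp [List.ofFn_succ, mul_assoc, Fin.succ]
    have hB : blockDiag (N 0 * N 1 * N 2 * N 3) (P 0 * P 1 * P 2 * P 3) = 1 := by
      have h1 : (g : Matrix (Fin 4) (Fin 4) ℂ) *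
        blockDiag (N 0 * N 1 * N 2 * N 3) (P 0 * P 1 * P 2 * P 3) *
        ((g⁻¹ : GL (Fin 4) ℂ) : Matrix (Fin 4) (Fin 4) ℂ) = 1 := by rw [← hM', hprod]
      exact eq_one_of_conj_eq_one (by simp) h1
    rw [← blockDiag_one, blockDiag_inj] at hB
    exact ⟨g, ↑g⁻¹, N, P, by simp, by simp, ⟨⟨fun j => (hcl j).1, hB.1⟩, by rw [hN3, hdiag]⟩,
      ⟨⟨fun j => (hcl j).2, hB.2⟩, hP3⟩, hM⟩
  · rintro ⟨g, k, N, P, hgk, hkg, hN, hP, hM⟩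
    refine ⟨⟨?_, ?_⟩, ⟨g, k, hgk, hkg⟩, N, P, hM, hN.isIrreducibleTuple h, hP.isIrreducibleTuple h,
      fun j => ⟨hN.mem_class j, hP.mem_class j⟩, by rw [hN.eq_scalar, hdiag], hP.mem_jordan⟩
    · have hconj : ∀ {A B X : Matrix (Fin 4) (Fin 4) ℂ}, X ∈ conjClass B → B ∈ conjClass A →
          X ∈ conjClass A := by
        intro A B X hX hB
        obtain ⟨u, v, huv, hvu, rfl⟩ := mem_conjClass_iff.1 hX
        exact conj_mem_conjClass huv hvu hB
      have hj : ∀ j : Fin 3, M j.castSucc ∈ conjClass (Matrix.diagonal ![a j, a j, b j, b j]) := by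
        intro j
        rw [hM]
        exact conj_mem_conjClass hgk hkg (hconj (blockDiag_mem_conjClass (hN.mem_class j)
          (hP.mem_class j)) (blockDiag_diagonal_mem _ _))
      intro j
      fin_cases j
      · exact hj 0
      · exact hj 1
      · exact hj 2
      · show M 3 ∈ conjClass !![c, 1, 0, 0; 0, c, 0, 0; 0, 0, c, 0; 0, 0, 0, c]
        rw [hM, hN.eq_scalar]
        exact conj_mem_conjClass hgk hkg (hconj (blockDiag_mem_conjClass (mem_conjClass_self _)
          hP.mem_jordan) (blockDiag_jordan_mem c))
    · have hM' : (List.ofFn M).prod =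
          g * blockDiag (N 0 * N 1 * N 2 * N 3) (P 0 * P 1 * P 2 * P 3) * k := by
        rw [← blockDiag_mul, ← blockDiag_mul, ← blockDiag_mul, ← conj_mul_conj hkg,
          ← conj_mul_conj hkg, ← conj_mul_conj hkg, ← hM, ← hM, ← hM, ← hM]
        simp [List.ofFn_succ, mul_assoc, Fin.succ]
      rw [hM', hN.prod_eq, hP.prod_eq, blockDiag_one, mul_one, hgk]

end

noncomputable section

/-! ### Normal forms -/

variable {a b : Fin 3 → ℂ} {c : ℂ} {N P Q : Fin 4 → Matrix (Fin 2) (Fin 2) ℂ}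

/-- The normalized trace of the inverse of the third matrix. -/
def invTrace (a b : Fin 3 → ℂ) (c : ℂ) : ℂ := ((a 2)⁻¹ + (b 2)⁻¹) / c

/-- The polynomial `p` in the equation `ρ l w = c p(l, w)` of the surface of normal forms. -/
def chartPoly (a b : Fin 3 → ℂ) (c l w : ℂ) : ℂ :=
  a 0 * b 0 * w ^ 2 + invTrace a b c * w + a 1 * b 1 - l * (a 1 + b 1 - l + (a 0 + b 0) * w)

/-- The first matrix of the normal form. -/
def chartFst (a b : Fin 3 → ℂ) : Matrix (Fin 2) (Fin 2) ℂ := !![0, -(a 0 * b 0); 1, a 0 + b 0]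

/-- The second matrix of the normal form. -/
def chartSnd (a b : Fin 3 → ℂ) (c ρ l w : ℂ) : Matrix (Fin 2) (Fin 2) ℂ :=
  !![l - (a 0 + b 0) * w, invTrace a b c + a 0 * b 0 * w -
      (a 0 + b 0) * (a 1 + b 1 - l + (a 0 + b 0) * w) - ρ * l / c;
    w, a 1 + b 1 - l + (a 0 + b 0) * w]

/-- The normal form of a quadruple, in the basis given by an eigenvector of the fourth matrix and its
image under the first one. -/
def chart (a b : Fin 3 → ℂ) (c ρ l w : ℂ) : Fin 4 → Matrix (Fin 2) (Fin 2) ℂ :=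
  ![chartFst a b, chartSnd a b c ρ l w, (!![c, ρ; 0, c] * chartFst a b * chartSnd a b c ρ l w)⁻¹,
    !![c, ρ; 0, c]]

/-- The upper right entry of `chartSnd` is chosen to give the product of the fourth, first and
second matrices its required trace. The one condition left is the determinant of the second matrix,
and this is the equation of the surface. -/
theorem det_chartSnd (h : StratumCondition a b c) {ρ l w : ℂ} (hρ : ρ * l * w = c * chartPoly a b c l w) :
    (chartSnd a b c ρ l w).det = a 1 * b 1 := by
  have hc := h.c_ne
  have h1 : chartPoly a b c l w = ρ * l / c * w := by
    field_simp
    linear_combination -hρ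
  rw [chartPoly] at h1
  rw [chartSnd, Matrix.det_fin_two_of]
  linear_combination -h1

theorem chart_isBlockTuple (h : StratumCondition a b c) {ρ l w : ℂ}
    (hρ : ρ * l * w = c * chartPoly a b c l w) : IsBlockTuple a b (chart a b c ρ l w) := by
  have hc := h.c_ne
  have h3 : (chart a b c ρ l w 3).det = c ^ 2 := by
    simp [chart, sq]
  rw [isBlockTuple_iff h h3]
  refine ⟨?_, ?_, ?_, det_chartSnd h hρ, ?_, rfl⟩
  · simp [chart, chartFst]
  · simp [chart, chartFst]
  · simp [chart, chartSnd, Matrix.trace_fin_two]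
  · simp only [chart, chartSnd, chartFst, invTrace, Matrix.trace_fin_two, Matrix.mul_apply,
      Fin.sum_univ_two, Matrix.cons_val, Matrix.of_apply, Matrix.cons_val', Matrix.cons_val_zero,
      Matrix.cons_val_one]
    field_simp
    ring

/-- At `ρ = w = 0` the surface equation reads `(l - a 1) * (l - b 1) = 0`; the root `a 1` is taken.
-/
theorem chart_isScalarBlock (h : StratumCondition a b c) :
    IsScalarBlock a b c (chart a b c 0 (a 1) 0) := by
  refine ⟨chart_isBlockTuple h (by simp [chartPoly]), ?_⟩
  ext i j
  fin_cases i <;> fin_cases j <;> simp [chart]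

theorem chart_isJordanBlock (h : StratumCondition a b c) {ρ l w : ℂ} (h0 : ρ ≠ 0)
    (hρ : ρ * l * w = c * chartPoly a b c l w) : IsJordanBlock a b c (chart a b c ρ l w) := by
  refine ⟨chart_isBlockTuple h hρ, ?_⟩
  rw [mem_conjClass_jordan_iff]
  refine ⟨by simp [chart, two_mul], by simp [chart, sq], fun h1 => h0 ?_⟩
  have := congrFun (congrFun h1 0) 1
  simpa [chart] using this

theorem conj_nonsing_inv {n : ℕ} {g k : Matrix (Fin n) (Fin n) ℂ} (h1 : g * k = 1) (h2 : k * g = 1)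
    (X : Matrix (Fin n) (Fin n) ℂ) : (g * X * k)⁻¹ = g * X⁻¹ * k := by
  rw [Matrix.mul_inv_rev, Matrix.mul_inv_rev, Matrix.inv_eq_right_inv h1, Matrix.inv_eq_right_inv h2,
    mul_assoc]

/-- A triangular fourth matrix and a nonzero lower left entry of the first one lead to the normal
form. -/
theorem IsBlockTuple.exists_chart (h : StratumCondition a b c) (hQ : IsBlockTuple a b Q) {e : ℂ}
    (h3 : Q 3 = !![c, e; 0, c]) (hr : Q 0 1 0 ≠ 0) :
    ∃ ρ l w : ℂ, ρ = e * Q 0 1 0 ∧ w = Q 1 1 0 / Q 0 1 0 ∧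
      l = Q 1 0 0 - Q 0 0 0 * w + (a 0 + b 0) * w ∧ ρ * l * w = c * chartPoly a b c l w ∧
      ∃ g k : Matrix (Fin 2) (Fin 2) ℂ, g * k = 1 ∧ k * g = 1 ∧
        ∀ j, Q j = g * chart a b c ρ l w j * k := by
  have hc := h.c_ne
  refine ⟨e * Q 0 1 0, Q 1 0 0 - Q 0 0 0 * (Q 1 1 0 / Q 0 1 0) +
    (a 0 + b 0) * (Q 1 1 0 / Q 0 1 0), Q 1 1 0 / Q 0 1 0, rfl, rfl, rfl, ?_⟩
  have h3d : (Q 3).det = c ^ 2 := by rw [h3]; simp [sq]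
  obtain ⟨t0, d0, t1, d1, ht, h2⟩ := (isBlockTuple_iff h h3d).1 hQ
  rw [h3] at ht
  rw [Matrix.trace_fin_two] at t0 t1 ht
  rw [Matrix.det_fin_two] at d0 d1
  simp only [Matrix.mul_apply, Fin.sum_univ_two, Matrix.of_apply, Matrix.cons_val',
    Matrix.cons_val_zero, Matrix.cons_val_one] at ht
  set p := Q 0 0 0 with hp
  set r := Q 0 1 0 with hr'
  obtain ⟨w, hw⟩ : ∃ w, w = Q 1 1 0 / r := ⟨_, rfl⟩
  have hw' : Q 1 1 0 = r * w := by rw [hw]; field_simp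
  rw [← hw]
  obtain ⟨l, hl⟩ : ∃ l, l = Q 1 0 0 - p * w + (a 0 + b 0) * w := ⟨_, rfl⟩
  rw [← hl]
  have hl' : Q 1 0 0 = l + p * w - (a 0 + b 0) * w := by rw [hl]; ring
  have hδ : Q 1 1 1 = a 1 + b 1 - Q 1 0 0 := by linear_combination t1
  have hs : Q 0 1 1 = a 0 + b 0 - p := by linear_combination t0
  have hτ : invTrace a b c * c = (a 2)⁻¹ + (b 2)⁻¹ := by rw [invTrace]; field_simp
  rw [← hτ, hs, hδ, hw', hl'] at ht
  rw [hδ, hw', hl'] at d1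
  rw [hs] at d0
  obtain ⟨E, rfl⟩ : ∃ E, e = c * E := ⟨e / c, by field_simp⟩
  have ht' : p * (l + p * w - (a 0 + b 0) * w) + Q 0 0 1 * (r * w) +
      E * (r * (l + p * w - (a 0 + b 0) * w) + (a 0 + b 0 - p) * (r * w)) + r * Q 1 0 1 +
      (a 0 + b 0 - p) * (a 1 + b 1 - (l + p * w - (a 0 + b 0) * w)) = invTrace a b c := by
    apply mul_left_cancel₀ hc
    linear_combination ht
  -- In the new basis, the trace condition determines the upper right entry of the second matrix.
  have hy : r * Q 1 0 1 + p * (l + p * w - (a 0 + b 0) * w) =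
      (invTrace a b c + a 0 * b 0 * w -
      (a 0 + b 0) * (a 1 + b 1 - l + (a 0 + b 0) * w) - E * r * l) +
      p * (a 1 + b 1 - l + (a 0 + b 0) * w) := by
    linear_combination ht' + w * d0
  have hrel : c * E * r * l * w = c * chartPoly a b c l w := by
    have h1 : E * r * l * w = chartPoly a b c l w := by
      rw [chartPoly]
      linear_combination w * hy + d1
    linear_combination c * h1
  have hdiv : c * E * r * l / c = E * r * l := by field_simp
  -- The columns of the conjugating matrix are the eigenvector of `Q 3` and its image under `Q 0`;
  -- they are independent because `r ≠ 0`.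
  have hGK : (!![1, p; 0, r] : Matrix (Fin 2) (Fin 2) ℂ) * !![1, -p / r; 0, 1 / r] = 1 := by
    ext i j
    fin_cases i <;> fin_cases j <;> simp [Matrix.mul_apply, Fin.sum_univ_two, hr]
    field_simp; ring
  have hKG : !![1, -p / r; 0, 1 / r] * (!![1, p; 0, r] : Matrix (Fin 2) (Fin 2) ℂ) = 1 :=
    mul_eq_one_comm.1 hGK
  have e0 : Q 0 = !![1, p; 0, r] * chartFst a b * !![1, -p / r; 0, 1 / r] := by
    ext i j
    fin_cases i <;> fin_cases j <;>
      simp [Matrix.mul_apply, Fin.sum_univ_two, chartFst, ← hp, ← hr', hs]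
    · field_simp; linear_combination -d0
    · field_simp; ring
  have e1 : Q 1 = !![1, p; 0, r] * chartSnd a b c (c * E * r) l w * !![1, -p / r; 0, 1 / r] := by
    ext i j
    fin_cases i <;> fin_cases j <;>
      simp [Matrix.mul_apply, Fin.sum_univ_two, chartSnd, hδ, hw', hl', hdiv]
    · ring
    · field_simp; linear_combination hy
    · field_simp; ring
  have e3 : Q 3 = !![1, p; 0, r] * !![c, c * E * r; 0, c] * !![1, -p / r; 0, 1 / r] := by
    rw [h3]
    ext i j
    fin_cases i <;> fin_cases j <;> simp [Matrix.mul_apply, Fin.sum_univ_two]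
    · field_simp; ring
    · field_simp
  refine ⟨hrel, !![1, p; 0, r], !![1, -p / r; 0, 1 / r], hGK, hKG, fun j => ?_⟩
  fin_cases j
  · exact e0
  · exact e1
  · show Q 2 = !![1, p; 0, r] * (!![c, c * E * r; 0, c] * chartFst a b *
      chartSnd a b c (c * E * r) l w)⁻¹ * !![1, -p / r; 0, 1 / r]
    rw [h2, ← conj_nonsing_inv hGK hKG, e0, e1, e3, conj_mul_conj hKG, conj_mul_conj hKG]
  · exact e3

/-- The quadruples `N` in the stratum are all conjugate. -/
theorem IsScalarBlock.exists_chart (h : StratumCondition a b c) (hN : IsScalarBlock a b c N) :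
    ∃ g k : Matrix (Fin 2) (Fin 2) ℂ, g * k = 1 ∧ k * g = 1 ∧
      ∀ j, N j = g * chart a b c 0 (a 1) 0 j * k := by
  -- Every vector is an eigenvector of the scalar `N 3`. A basis that diagonalizes `N 1` gives `w =
  -- 0` and `l = a 1`, which leaves no parameters.
  obtain ⟨u, v, huv, hvu, hN1⟩ := mem_conjClass_iff.1 (hN.mem_class 1)
  have hN' := hN.conj hvu huv
  have hd : v * N 1 * u = Matrix.diagonal ![a 1, b 1] := by
    have : N 1 = u * Matrix.diagonal ![a 1, b 1] * v := hN1
    rw [this]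
    calc v * (u * Matrix.diagonal ![a 1, b 1] * v) * u
        = (v * u) * Matrix.diagonal ![a 1, b 1] * (v * u) := by simp only [mul_assoc]
      _ = _ := by rw [hvu, one_mul, mul_one]
  have h3 : v * N 3 * u = !![c, 0; 0, c] := by
    have : v * N 3 * u = c • 1 := hN'.eq_scalar
    rw [this]
    ext i j; fin_cases i <;> fin_cases j <;> simp
  have hr : (v * N 0 * u) 1 0 ≠ 0 := by
    intro hr
    exact hN'.toIsBlockTuple.not_triangular h hr (by simp [hd]) (by simp [h3]) (by simp [h3])
      (by simp [h3])
  obtain ⟨ρ, l, w, hρ, hw, hl, -, g, k, hgk, hkg, hg⟩ :=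
    hN'.toIsBlockTuple.exists_chart h (e := 0) h3 hr
  have hw0 : w = 0 := by rw [hw, hd]; simp
  have hl0 : l = a 1 := by rw [hl, hw0, hd]; simp
  rw [zero_mul] at hρ
  rw [hρ, hl0, hw0] at hg
  refine ⟨u * g, k * v, ?_, ?_, fun j => ?_⟩
  · rw [mul_assoc, ← mul_assoc g, hgk, one_mul, huv]
  · rw [mul_assoc, ← mul_assoc v, hvu, one_mul, hkg]
  · calc N j = (u * v) * N j * (u * v) := by rw [huv, one_mul, mul_one]
      _ = u * (v * N j * u) * v := by simp only [mul_assoc]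
      _ = _ := by rw [hg j]; simp only [mul_assoc]

/-- The quadruples in the stratum with normalized blocks. -/
theorem mem_stratumU_iff_normal (h : StratumCondition a b c)
    {M : Fin 4 → Matrix (Fin 4) (Fin 4) ℂ} :
    M ∈ stratumU a b c ↔ ∃ (g k : Matrix (Fin 4) (Fin 4) ℂ) (P : Fin 4 → Matrix (Fin 2) (Fin 2) ℂ),
      g * k = 1 ∧ k * g = 1 ∧ IsJordanBlock a b c P ∧ P 3 = !![c, 1; 0, c] ∧
        ∀ j, M j = g * blockDiag (chart a b c 0 (a 1) 0 j) (P j) * k := by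
  rw [mem_stratumU_iff h]
  constructor
  · rintro ⟨g, k, N, P, hgk, hkg, hN, hP, hM⟩
    obtain ⟨u, v, huv, hvu, hu⟩ := hN.exists_chart h
    obtain ⟨x, y, hxy, hyx, hP3⟩ := mem_conjClass_iff.1 hP.mem_jordan
    have h1 : blockDiag u x * blockDiag v y = 1 := by rw [blockDiag_mul, huv, hxy, blockDiag_one]
    have h2 : blockDiag v y * blockDiag u x = 1 := by rw [blockDiag_mul, hvu, hyx, blockDiag_one]
    refine ⟨g * blockDiag u x, blockDiag v y * k, fun j => y * P j * x, ?_, ?_, hP.conj hyx hxy, ?_,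
      fun j => ?_⟩
    · rw [mul_assoc, ← mul_assoc (blockDiag u x), h1, one_mul, hgk]
    · rw [mul_assoc, ← mul_assoc k, hkg, one_mul, h2]
    · show y * P 3 * x = _
      rw [hP3]
      calc y * (x * !![c, 1; 0, c] * y) * x = (y * x) * !![c, 1; 0, c] * (y * x) := by
            simp only [mul_assoc]
        _ = _ := by rw [hyx, one_mul, mul_one]
    · have h3 : P j = x * (y * P j * x) * y := by
        calc P j = (x * y) * P j * (x * y) := by rw [hxy, one_mul, mul_one]
          _ = _ := by simp only [mul_assoc]
      rw [hM, hu j]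
      conv_lhs => rw [h3]
      rw [← blockDiag_mul, ← blockDiag_mul]
      simp only [mul_assoc]
  · rintro ⟨g, k, P, hgk, hkg, hP, -, hM⟩
    exact ⟨g, k, _, P, hgk, hkg, chart_isScalarBlock h, hP, hM⟩

end

noncomputable section

open scoped Matrix.Norms.Operator

/-! ### Irreducibility of the stratum -/

/-- Simple roots of quadratic polynomials depend continuously on the coefficients. -/
theorem exists_continuousAt_root {B C : ℂ → ℂ} {t₀ x₀ : ℂ} (hB : ContinuousAt B t₀)
    (hC : ContinuousAt C t₀) (hx : x₀ ^ 2 - B t₀ * x₀ + C t₀ = 0) (hne : 2 * x₀ - B t₀ ≠ 0) :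
    ∃ x : ℂ → ℂ, ContinuousAt x t₀ ∧ x t₀ = x₀ ∧ ∀ t, x t ^ 2 - B t * x t + C t = 0 := by
  obtain ⟨d, hd⟩ : ∃ d, d = 2 * x₀ - B t₀ := ⟨_, rfl⟩
  have hd0 : d ≠ 0 := hd ▸ hne
  have hD : (B t₀ ^ 2 - 4 * C t₀) / d ^ 2 = 1 := by
    rw [div_eq_one_iff_eq (pow_ne_zero 2 hd0), hd]
    linear_combination -4 * hx
  have hsq : ∀ z : ℂ, (z ^ (((2 : ℕ) : ℂ)⁻¹)) ^ 2 = z := fun z =>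
    Complex.cpow_nat_inv_pow z two_ne_zero
  -- The quadratic formula, with the discriminant divided by `d ^ 2` so that its value at `t₀` is 1:
  -- there the principal square root is continuous and selects the root `x₀`.
  refine ⟨fun t => (B t + d * ((B t ^ 2 - 4 * C t) / d ^ 2) ^ (((2 : ℕ) : ℂ)⁻¹)) / 2, ?_, ?_, ?_⟩
  · have h1 : ContinuousAt (fun t => (B t ^ 2 - 4 * C t) / d ^ 2) t₀ := by fun_prop
    have h2 : ContinuousAt (fun t => ((B t ^ 2 - 4 * C t) / d ^ 2) ^ (((2 : ℕ) : ℂ)⁻¹)) t₀ :=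
      h1.cpow continuousAt_const (by rw [hD]; exact Complex.one_mem_slitPlane)
    fun_prop
  · show (B t₀ + d * ((B t₀ ^ 2 - 4 * C t₀) / d ^ 2) ^ (((2 : ℕ) : ℂ)⁻¹)) / 2 = x₀
    rw [hD, Complex.one_cpow, hd]
    ring
  · intro t
    have h1 := hsq ((B t ^ 2 - 4 * C t) / d ^ 2)
    set y := ((B t ^ 2 - 4 * C t) / d ^ 2) ^ (((2 : ℕ) : ℂ)⁻¹)
    rw [eq_div_iff (pow_ne_zero 2 hd0)] at h1
    linear_combination h1 / 4

variable {a b : Fin 3 → ℂ} {c : ℂ}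

/-- The quadruples conjugate to a normal form with nonzero parameters. -/
def genericBlocks (a b : Fin 3 → ℂ) (c : ℂ) : Set (Fin 4 → Matrix (Fin 2) (Fin 2) ℂ) :=
  {P | ∃ ρ l w : ℂ, ρ ≠ 0 ∧ l ≠ 0 ∧ w ≠ 0 ∧ ρ * l * w = c * chartPoly a b c l w ∧
    ∃ g k : Matrix (Fin 2) (Fin 2) ℂ, g * k = 1 ∧ k * g = 1 ∧ ∀ j, P j = g * chart a b c ρ l w j * k}

theorem conj_mem_closure_genericBlocks {P : Fin 4 → Matrix (Fin 2) (Fin 2) ℂ}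
    {g k : Matrix (Fin 2) (Fin 2) ℂ} (hgk : g * k = 1) (hkg : k * g = 1)
    (hP : P ∈ closure (genericBlocks a b c)) :
    (fun j => g * P j * k) ∈ closure (genericBlocks a b c) := by
  refine map_mem_closure (f := fun (P : Fin 4 → Matrix (Fin 2) (Fin 2) ℂ) j => g * P j * k)
    (by fun_prop) hP ?_
  rintro P ⟨ρ, l, w, hρ, hl, hw, h, u, v, huv, hvu, hP⟩
  refine ⟨ρ, l, w, hρ, hl, hw, h, g * u, v * k, ?_, ?_, fun j => ?_⟩
  · rw [mul_assoc, ← mul_assoc u, huv, one_mul, hgk]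
  · rw [mul_assoc, ← mul_assoc k, hkg, one_mul, hvu]
  · simp only [hP, mul_assoc]

theorem ContinuousAt.matrix_fin_two {p q r s : ℂ → ℂ} {t₀ : ℂ} (hp : ContinuousAt p t₀)
    (hq : ContinuousAt q t₀) (hr : ContinuousAt r t₀) (hs : ContinuousAt s t₀) :
    ContinuousAt (fun t => (!![p t, q t; r t, s t] : Matrix (Fin 2) (Fin 2) ℂ)) t₀ := by
  refine continuousAt_pi.2 fun i => continuousAt_pi.2 fun j => ?_
  fin_cases i <;> fin_cases j
  · exact hp
  · exact hq
  · exact hr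
  · exact hs

theorem ContinuousAt.matrix_inv {n : ℕ} {A : ℂ → Matrix (Fin n) (Fin n) ℂ} {t₀ : ℂ}
    (hA : ContinuousAt A t₀) (hdet : (A t₀).det ≠ 0) : ContinuousAt (fun t => (A t)⁻¹) t₀ :=
  ContinuousAt.comp (g := fun g : Matrix (Fin n) (Fin n) ℂ => g⁻¹)
    (differentiableAt_matrix_inv hdet).continuousAt hA

theorem det_chartFst (a b : Fin 3 → ℂ) : (chartFst a b).det = a 0 * b 0 := by
  simp [chartFst]

theorem continuousAt_chart (h : StratumCondition a b c) {ρ l w : ℂ → ℂ} {t₀ : ℂ}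
    (hρ : ContinuousAt ρ t₀) (hl : ContinuousAt l t₀) (hw : ContinuousAt w t₀)
    (hrel : ρ t₀ * l t₀ * w t₀ = c * chartPoly a b c (l t₀) (w t₀)) :
    ContinuousAt (fun t => chart a b c (ρ t) (l t) (w t)) t₀ := by
  have h1 : ContinuousAt (fun t => chartSnd a b c (ρ t) (l t) (w t)) t₀ := by
    unfold chartSnd
    exact ContinuousAt.matrix_fin_two (by fun_prop) (by fun_prop) (by fun_prop) (by fun_prop)
  have h3 : ContinuousAt (fun t => (!![c, ρ t; 0, c] : Matrix (Fin 2) (Fin 2) ℂ)) t₀ :=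
    continuousAt_const.matrix_fin_two hρ continuousAt_const continuousAt_const
  refine continuousAt_pi.2 fun j => ?_
  fin_cases j
  · exact continuousAt_const
  · exact h1
  · have hdet : (!![c, ρ t₀; 0, c] * chartFst a b * chartSnd a b c (ρ t₀) (l t₀) (w t₀)).det ≠ 0 := by
      rw [Matrix.det_mul, Matrix.det_mul, det_chartSnd h hrel, det_chartFst]
      simp [h.c_ne, h.a_ne, h.b_ne]
    have h2 : ContinuousAt (fun t => !![c, ρ t; 0, c] * chartFst a b *
        chartSnd a b c (ρ t) (l t) (w t)) t₀ := by fun_prop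
    exact h2.matrix_inv hdet
  · exact h3

theorem chart_mem_genericBlocks {ρ l w : ℂ} (hρ : ρ ≠ 0) (hl : l ≠ 0) (hw : w ≠ 0)
    (hrel : ρ * l * w = c * chartPoly a b c l w) :
    chart a b c ρ l w ∈ genericBlocks a b c :=
  ⟨ρ, l, w, hρ, hl, hw, hrel, 1, 1, by simp, by simp, by simp⟩

theorem eventually_self_ne (t₀ : ℂ) : ∀ᶠ t in nhdsWithin t₀ {t₀}ᶜ, t ≠ t₀ :=
  eventually_mem_nhdsWithin

/-- For fixed `ρ` the surface equation is quadratic in `l` and in `w`. At a point with `w = 0` or `l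
= 0` the other coordinate is a nonzero simple root, so it follows continuously when the vanishing
coordinate is moved away from zero. Simplicity comes from `a 1 ≠ b 1` in the first case and from `a
2 ≠ b 2` in the second. -/
theorem chart_mem_closure_genericBlocks (h : StratumCondition a b c) {ρ l w : ℂ} (hρ : ρ ≠ 0)
    (hrel : ρ * l * w = c * chartPoly a b c l w) :
    chart a b c ρ l w ∈ closure (genericBlocks a b c) := by
  have hc := h.c_ne
  have hrel' : ∀ l w, ρ * l * w = c * chartPoly a b c l w ↔ ρ / c * l * w = chartPoly a b c l w := by
    intro l w
    constructor
    · intro h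
      field_simp
      linear_combination h
    · intro h
      rw [← h]
      field_simp
  by_cases hw : w = 0
  · have h1 : (l - a 1) * (l - b 1) = 0 := by
      have := (hrel' l w).1 hrel
      rw [hw, chartPoly] at this
      linear_combination -this
    have hl : l ≠ 0 ∧ 2 * l - (a 1 + b 1) ≠ 0 := by
      rcases mul_eq_zero.1 h1 with h1 | h1 <;> rw [sub_eq_zero.1 h1]
      · refine ⟨h.a_ne 1, fun h2 => h.ne 1 (by linear_combination h2)⟩
      · refine ⟨h.b_ne 1, fun h2 => h.ne 1 (by linear_combination -h2)⟩
    obtain ⟨x, hx, hx0, hxr⟩ := exists_continuousAt_root (t₀ := 0) (x₀ := l)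
      (B := fun w => a 1 + b 1 + (a 0 + b 0) * w + ρ / c * w)
      (C := fun w => a 0 * b 0 * w ^ 2 + invTrace a b c * w + a 1 * b 1) (by fun_prop) (by fun_prop)
      (by linear_combination h1) (by simpa using hl.2)
    have hr : ∀ t, ρ * x t * t = c * chartPoly a b c (x t) t := by
      intro t
      rw [hrel', chartPoly]
      linear_combination -hxr t
    have hlim := continuousAt_chart h (ρ := fun _ => ρ) (w := fun t => t) continuousAt_const hx
      continuousAt_id (hr 0)
    rw [ContinuousAt, hx0, ← hw] at hlim
    rw [hw] at hlim ⊢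
    refine mem_closure_of_tendsto (hlim.mono_left (nhdsWithin_le_nhds (s := {0}ᶜ))) ?_
    have h2 : ∀ᶠ t in nhds (0 : ℂ), x t ≠ 0 := hx.eventually_ne (by rw [hx0]; exact hl.1)
    filter_upwards [eventually_self_ne 0, h2.filter_mono nhdsWithin_le_nhds] with t ht ht'
    exact chart_mem_genericBlocks hρ ht' ht (hr t)
  by_cases hl : l = 0
  · have hd : a 0 * b 0 ≠ 0 := mul_ne_zero (h.a_ne 0) (h.b_ne 0)
    have h1 : a 0 * b 0 * w ^ 2 + invTrace a b c * w + a 1 * b 1 = 0 := by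
      have := (hrel' l w).1 hrel
      rw [hl, chartPoly] at this
      linear_combination -this
    -- By `StratumCondition.prod_eq` the discriminant of the quadratic in `w` is a nonzero multiple
    -- of `(a 2 - b 2) ^ 2`.
    have hdisc : 2 * w - -invTrace a b c / (a 0 * b 0) ≠ 0 := by
      intro h2
      have h3 : 2 * w * (a 0 * b 0) + invTrace a b c = 0 := by
        rw [neg_div, sub_neg_eq_add] at h2
        have h3 : invTrace a b c / (a 0 * b 0) * (a 0 * b 0) = invTrace a b c := div_mul_cancel₀ _ hd
        linear_combination (a 0 * b 0) * h2 - h3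
      have h4 : invTrace a b c ^ 2 = 4 * (a 0 * b 0 * (a 1 * b 1)) := by
        linear_combination (2 * w * (a 0 * b 0) + invTrace a b c) * h3 - 4 * (a 0 * b 0) * h1
      have ha := h.a_ne 2
      have hb := h.b_ne 2
      rw [invTrace] at h4
      field_simp at h4
      have h5 : (a 2 - b 2) ^ 2 = 0 := by
        linear_combination h4 + 4 * a 2 * b 2 * h.prod_eq
      exact h.ne 2 (sub_eq_zero.1 (pow_eq_zero_iff two_ne_zero |>.1 h5))
    obtain ⟨x, hx, hx0, hxr⟩ := exists_continuousAt_root (t₀ := 0) (x₀ := w)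
      (B := fun l => (ρ / c * l + (a 0 + b 0) * l - invTrace a b c) / (a 0 * b 0))
      (C := fun l => (l ^ 2 - l * (a 1 + b 1) + a 1 * b 1) / (a 0 * b 0)) (by fun_prop)
      (by fun_prop) (by
        have := h.a_ne 0
        have := h.b_ne 0
        field_simp
        linear_combination c * h1) (by simpa using hdisc)
    have hr : ∀ t, ρ * t * x t = c * chartPoly a b c t (x t) := by
      intro t
      rw [hrel', chartPoly]
      have := hxr t
      have h5 : a 0 * b 0 * (x t ^ 2 - (ρ / c * t + (a 0 + b 0) * t - invTrace a b c) / (a 0 * b 0) * x t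
        + (t ^ 2 - t * (a 1 + b 1) + a 1 * b 1) / (a 0 * b 0)) = a 0 * b 0 * x t ^ 2 -
          (ρ / c * t + (a 0 + b 0) * t - invTrace a b c) * x t +
          (t ^ 2 - t * (a 1 + b 1) + a 1 * b 1) := by
        have := h.a_ne 0
        have := h.b_ne 0
        field_simp
      rw [this, mul_zero] at h5
      linear_combination h5
    have hlim := continuousAt_chart h (ρ := fun _ => ρ) (l := fun t => t) continuousAt_const
      continuousAt_id hx (hr 0)
    rw [ContinuousAt, hx0] at hlim
    rw [hl]
    refine mem_closure_of_tendsto (hlim.mono_left (nhdsWithin_le_nhds (s := {0}ᶜ))) ?_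
    have h2 : ∀ᶠ t in nhds (0 : ℂ), x t ≠ 0 := hx.eventually_ne (by rw [hx0]; exact hw)
    filter_upwards [eventually_self_ne 0, h2.filter_mono nhdsWithin_le_nhds] with t ht ht'
    exact chart_mem_genericBlocks hρ ht ht' (hr t)
  · exact subset_closure (chart_mem_genericBlocks hρ hl hw hrel)

theorem mem_closure_genericBlocks_of_ne_zero (h : StratumCondition a b c)
    {P : Fin 4 → Matrix (Fin 2) (Fin 2) ℂ} (hP : IsBlockTuple a b P) (h3 : P 3 = !![c, 1; 0, c])
    (hr : P 0 1 0 ≠ 0) : P ∈ closure (genericBlocks a b c) := by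
  obtain ⟨ρ, l, w, hρ, -, -, hrel, g, k, hgk, hkg, hg⟩ := hP.exists_chart h h3 hr
  obtain rfl : P = fun j => g * chart a b c ρ l w j * k := funext hg
  exact conj_mem_closure_genericBlocks hgk hkg
    (chart_mem_closure_genericBlocks h (by rw [hρ, one_mul]; exact hr) hrel)

/-- The normal form fails where the eigenvector of `P 3` is also one of `P 0`. Such a tuple is a
limit of tuples with the same `P 1` and `P 3`, in which `P 0` gets the lower left entry `r`: its
upper right entry is solved from the trace condition, as `P 1 1 0 ≠ 0` by non-triangularity, and its
diagonal from the determinant, a quadratic with a simple root as `a 0 ≠ b 0`. -/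
theorem mem_closure_genericBlocks (h : StratumCondition a b c)
    {P : Fin 4 → Matrix (Fin 2) (Fin 2) ℂ} (hP : IsBlockTuple a b P) (h3 : P 3 = !![c, 1; 0, c]) :
    P ∈ closure (genericBlocks a b c) := by
  have hc := h.c_ne
  by_cases hr : P 0 1 0 = 0
  swap
  · exact mem_closure_genericBlocks_of_ne_zero h hP h3 hr
  have hγ : P 1 1 0 ≠ 0 := fun h1 =>
    hP.not_triangular h hr h1 (by simp [h3]) (by simp [h3]) (by simp [h3])
  have h3d : (P 3).det = c ^ 2 := by rw [h3]; simp [sq]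
  obtain ⟨t0, d0, t1, d1, ht, h2⟩ := (isBlockTuple_iff h h3d).1 hP
  rw [h3] at ht
  have t0' := t0
  have d0' := d0
  rw [Matrix.trace_fin_two] at t0' ht
  rw [Matrix.det_fin_two, hr] at d0'
  obtain ⟨α, hα⟩ : ∃ x, P 1 0 0 = x := ⟨_, rfl⟩
  obtain ⟨β, hβ⟩ : ∃ x, P 1 0 1 = x := ⟨_, rfl⟩
  obtain ⟨γ, hγ'⟩ : ∃ x, P 1 1 0 = x := ⟨_, rfl⟩
  obtain ⟨d, hd⟩ : ∃ x, P 1 1 1 = x := ⟨_, rfl⟩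
  obtain ⟨p₀, hp⟩ : ∃ x, P 0 0 0 = x := ⟨_, rfl⟩
  obtain ⟨q₀, hq⟩ : ∃ x, P 0 0 1 = x := ⟨_, rfl⟩
  obtain ⟨s₀, hs⟩ : ∃ x, P 0 1 1 = x := ⟨_, rfl⟩
  rw [hp, hs] at t0' d0'
  obtain rfl : s₀ = a 0 + b 0 - p₀ := by linear_combination t0'
  rw [hγ'] at hγ
  have hP1 : P 1 = !![α, β; γ, d] := by
    ext i j; fin_cases i <;> fin_cases j <;> simp [hα, hβ, hγ', hd]
  have hP0 : P 0 = !![p₀, q₀; 0, a 0 + b 0 - p₀] := by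
    ext i j; fin_cases i <;> fin_cases j <;> simp [hp, hr, hq, hs]
  obtain ⟨T, hT⟩ : ∃ T, T = (a 2)⁻¹ + (b 2)⁻¹ := ⟨_, rfl⟩
  -- The solution of the trace condition, which is linear in the upper right entry with coefficient
  -- `c * γ`.
  let q : ℂ → ℂ → ℂ := fun p r => (T - (c * p + r) * α - (a 0 + b 0 - p) * γ - c * r * β -
    c * (a 0 + b 0 - p) * d) / (c * γ)
  have hq' : ∀ p r, c * γ * q p r = T - (c * p + r) * α - (a 0 + b 0 - p) * γ - c * r * β -
    c * (a 0 + b 0 - p) * d := fun p r => mul_div_cancel₀ _ (mul_ne_zero hc hγ)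
  have htr : ∀ p r, (!![c, 1; 0, c] * !![p, q p r; r, a 0 + b 0 - p] * P 1).trace = T := by
    intro p r
    rw [hP1, Matrix.trace_fin_two]
    simp [Matrix.mul_apply, Fin.sum_univ_two]
    linear_combination hq' p r
  have hq0 : q p₀ 0 = q₀ := by
    apply mul_left_cancel₀ (mul_ne_zero hc hγ)
    rw [hq']
    rw [hP0, hP1] at ht
    simp [Matrix.mul_apply, Fin.sum_univ_two] at ht
    linear_combination hT - ht
  have hq1 : ∀ p r, q p r = q 0 r + p * ((γ + c * d - c * α) / (c * γ)) := by
    intro p r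
    simp only [q]
    field_simp
    ring
  have hs0 : 2 * p₀ - (a 0 + b 0) ≠ 0 := by
    intro h1
    have h2 : (a 0 - b 0) ^ 2 = 0 := by
      linear_combination (2 * p₀ - (a 0 + b 0)) * h1 + 4 * d0'
    exact h.ne 0 (sub_eq_zero.1 (pow_eq_zero_iff two_ne_zero |>.1 h2))
  have hqc : ∀ {x : ℂ → ℂ} {y : ℂ → ℂ}, ContinuousAt x 0 → ContinuousAt y 0 →
      ContinuousAt (fun r => q (x r) (y r)) 0 := by
    intro x y hx hy
    simp only [q]
    fun_prop
  obtain ⟨x, hx, hx0, hxr⟩ := exists_continuousAt_root (t₀ := 0) (x₀ := p₀)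
    (B := fun r => a 0 + b 0 - r * ((γ + c * d - c * α) / (c * γ)))
    (C := fun r => a 0 * b 0 + r * q 0 r) (by fun_prop)
    ((continuousAt_const).add (continuousAt_id.mul (hqc continuousAt_const continuousAt_id)))
    (by linear_combination -d0') (by simpa using hs0)
  have hdet : ∀ r, (!![x r, q (x r) r; r, a 0 + b 0 - x r] : Matrix (Fin 2) (Fin 2) ℂ).det =
      a 0 * b 0 := by
    intro r
    rw [Matrix.det_fin_two_of, hq1]
    linear_combination -hxr r
  let A : ℂ → Matrix (Fin 2) (Fin 2) ℂ := fun r => !![x r, q (x r) r; r, a 0 + b 0 - x r]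
  have hA0 : A 0 = P 0 := by simp only [A, hx0, hq0, hP0]
  have hA : ContinuousAt A 0 := by
    exact hx.matrix_fin_two (hqc hx continuousAt_id) continuousAt_id (continuousAt_const.sub hx)
  let F : ℂ → Fin 4 → Matrix (Fin 2) (Fin 2) ℂ := fun r =>
    ![A r, P 1, (P 3 * A r * P 1)⁻¹, P 3]
  have hF0 : F 0 = P := by
    funext j
    fin_cases j
    · exact hA0
    · rfl
    · show (P 3 * A 0 * P 1)⁻¹ = P 2
      rw [hA0, h2]
    · rfl
  have hF : ContinuousAt F 0 := by
    refine continuousAt_pi.2 fun j => ?_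
    fin_cases j
    · exact hA
    · exact continuousAt_const
    · have hdet : (P 3 * A 0 * P 1).det ≠ 0 := by
        rw [Matrix.det_mul, Matrix.det_mul, h3d, hA0, d0, d1]
        simp [h.c_ne, h.a_ne, h.b_ne]
      have h2 : ContinuousAt (fun r => P 3 * A r * P 1) 0 := by fun_prop
      exact h2.matrix_inv hdet
    · exact continuousAt_const
  rw [ContinuousAt, hF0] at hF
  -- The perturbed tuples have a normal form, but possibly with `l` or `w` zero, so they too are
  -- only known to lie in the closure.
  rw [← closure_closure]
  refine mem_closure_of_tendsto (hF.mono_left (nhdsWithin_le_nhds (s := {0}ᶜ))) ?_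
  filter_upwards [eventually_self_ne 0] with r hr
  refine mem_closure_genericBlocks_of_ne_zero h ?_ h3 hr
  rw [isBlockTuple_iff (Q := F r) h h3d]
  refine ⟨?_, hdet r, t1, d1, ?_, rfl⟩
  · show (A r).trace = _
    simp [A, Matrix.trace_fin_two]
  · show (P 3 * A r * P 1).trace = _
    rw [h3, ← hT]
    exact htr _ _

/-- The rational parametrization of the stratum. -/
def stratumParam (a b : Fin 3 → ℂ) (c : ℂ) (e : Matrix (Fin 4) (Fin 4) ℂ × ℂ × ℂ) :
    Fin 4 → Matrix (Fin 4) (Fin 4) ℂ := fun j =>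
  e.1 * blockDiag (chart a b c 0 (a 1) 0 j)
    (chart a b c (c * chartPoly a b c e.2.1 e.2.2 / (e.2.1 * e.2.2)) e.2.1 e.2.2 j) * e.1⁻¹

/-- The complement of the domain of the parametrization is the zero set of this function. -/
def stratumDenom (a b : Fin 3 → ℂ) (c : ℂ) (e : Matrix (Fin 4) (Fin 4) ℂ × ℂ × ℂ) : ℂ :=
  e.1.det * (e.2.1 * e.2.2 * chartPoly a b c e.2.1 e.2.2)

theorem differentiable_stratumDenom : Differentiable ℂ (stratumDenom a b c) := by
  have h1 : Differentiable ℂ (fun e : Matrix (Fin 4) (Fin 4) ℂ × ℂ × ℂ => e.1.det) :=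
    differentiable_matrix_det.comp differentiable_fst
  unfold stratumDenom chartPoly
  fun_prop

theorem param_rel {l w : ℂ} (hl : l ≠ 0) (hw : w ≠ 0) :
    c * chartPoly a b c l w / (l * w) * l * w = c * chartPoly a b c l w := by
  field_simp


/-- The factor `chartPoly` in `stratumDenom` keeps `ρ` nonzero, so that the fourth matrix of the
second block is not scalar. -/
theorem stratumParam_mem (h : StratumCondition a b c) {e : Matrix (Fin 4) (Fin 4) ℂ × ℂ × ℂ}
    (he : stratumDenom a b c e ≠ 0) : stratumParam a b c e ∈ stratumU a b c := by
  obtain ⟨hg, hlw⟩ := mul_ne_zero_iff.1 he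
  obtain ⟨hlw', hp⟩ := mul_ne_zero_iff.1 hlw
  obtain ⟨hl, hw⟩ := mul_ne_zero_iff.1 hlw'
  rw [mem_stratumU_iff h]
  exact ⟨e.1, e.1⁻¹, _, _, Matrix.mul_nonsing_inv _ hg.isUnit, Matrix.nonsing_inv_mul _ hg.isUnit,
    chart_isScalarBlock h, chart_isJordanBlock h
      (div_ne_zero (mul_ne_zero h.c_ne hp) (mul_ne_zero hl hw)) (param_rel hl hw), fun j => rfl⟩

/-- The conjugation that brings the second block to normal form is absorbed into the `4 × 4`
conjugating matrix, which is arbitrary. -/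
theorem exists_stratumParam_eq {g k : Matrix (Fin 4) (Fin 4) ℂ} (hgk : g * k = 1)
    {Q : Fin 4 → Matrix (Fin 2) (Fin 2) ℂ} (hQ : Q ∈ genericBlocks a b c) :
    ∃ e, stratumDenom a b c e ≠ 0 ∧
      stratumParam a b c e = fun j => g * blockDiag (chart a b c 0 (a 1) 0 j) (Q j) * k := by
  obtain ⟨ρ, l, w, hρ, hl, hw, hrel, u, v, huv, hvu, hQ⟩ := hQ
  have hu : blockDiag 1 u * blockDiag 1 v = 1 := by rw [blockDiag_mul, huv, one_mul, blockDiag_one]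
  have hinv : g * blockDiag 1 u * (blockDiag 1 v * k) = 1 := by
    rw [mul_assoc, ← mul_assoc (blockDiag 1 u), hu, one_mul, hgk]
  have hdet : (g * blockDiag 1 u).det ≠ 0 := by
    intro h0
    have := congrArg Matrix.det hinv
    rw [Matrix.det_mul, h0, zero_mul, Matrix.det_one] at this
    exact zero_ne_one this
  have hp : chartPoly a b c l w ≠ 0 := by
    intro h0
    rw [h0, mul_zero] at hrel
    exact mul_ne_zero (mul_ne_zero hρ hl) hw hrel
  refine ⟨(g * blockDiag 1 u, l, w), mul_ne_zero hdet (mul_ne_zero (mul_ne_zero hl hw) hp), ?_⟩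
  have hρ' : c * chartPoly a b c l w / (l * w) = ρ := by
    rw [← hrel]
    field_simp
  funext j
  simp only [stratumParam, hρ']
  rw [Matrix.inv_eq_right_inv hinv, hQ]
  have : blockDiag (chart a b c 0 (a 1) 0 j) (u * chart a b c ρ l w j * v) =
      blockDiag 1 u * blockDiag (chart a b c 0 (a 1) 0 j) (chart a b c ρ l w j) * blockDiag 1 v := by
    rw [blockDiag_mul, blockDiag_mul, one_mul, mul_one]
  rw [this]
  simp only [mul_assoc]

/-- For a fixed conjugating matrix and a fixed first block, `M` depends continuously on the second
block, so the density of generic blocks carries over. -/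
theorem stratumU_subset_closure (h : StratumCondition a b c) :
    stratumU a b c ⊆ closure (stratumParam a b c '' {e | stratumDenom a b c e ≠ 0}) := by
  intro M hM
  obtain ⟨g, k, P, hgk, hkg, hP, h3, hg⟩ := (mem_stratumU_iff_normal h).1 hM
  obtain rfl : M = fun j => g * blockDiag (chart a b c 0 (a 1) 0 j) (P j) * k := funext hg
  have hcont : Continuous fun (P : Fin 4 → Matrix (Fin 2) (Fin 2) ℂ) (j : Fin 4) =>
      g * blockDiag (chart a b c 0 (a 1) 0 j) (P j) * k := by
    refine continuous_pi fun j => ?_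
    have h1 : Continuous fun P : Fin 4 → Matrix (Fin 2) (Fin 2) ℂ =>
        blockDiag (chart a b c 0 (a 1) 0 j) (P j) := by
      unfold blockDiag
      exact (Continuous.matrix_fromBlocks continuous_const continuous_const continuous_const
        (continuous_apply j)).matrix_reindex _ _
    fun_prop
  exact map_mem_closure hcont (mem_closure_genericBlocks h hP.toIsBlockTuple h3)
    fun Q hQ => exists_stratumParam_eq hgk hQ

theorem differentiable_blockDiag (N : Matrix (Fin 2) (Fin 2) ℂ) :
    Differentiable ℂ (fun P => blockDiag N P) := by
  let f : Matrix (Fin 2) (Fin 2) ℂ →ₗ[ℂ] Matrix (Fin 4) (Fin 4) ℂ :=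
    { toFun := fun P => blockDiag 0 P
      map_add' := fun P Q => by rw [blockDiag_add, add_zero]
      map_smul' := fun z P => by rw [RingHom.id_apply, blockDiag_smul, smul_zero] }
  have h1 : (fun P => blockDiag N P) = fun P => blockDiag N 0 + LinearMap.toContinuousLinearMap f P := by
    funext P
    show _ = blockDiag N 0 + blockDiag 0 P
    rw [blockDiag_add, add_zero, zero_add]
  rw [h1]
  exact (differentiable_const _).add (LinearMap.toContinuousLinearMap f).differentiable

theorem DifferentiableAt.matrix_fin_two {E : Type*} [NormedAddCommGroup E] [NormedSpace ℂ E]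
    {p q r s : E → ℂ} {e : E} (hp : DifferentiableAt ℂ p e)
    (hq : DifferentiableAt ℂ q e) (hr : DifferentiableAt ℂ r e) (hs : DifferentiableAt ℂ s e) :
    DifferentiableAt ℂ (fun t => (!![p t, q t; r t, s t] : Matrix (Fin 2) (Fin 2) ℂ)) e := by
  have h1 : (fun t => (!![p t, q t; r t, s t] : Matrix (Fin 2) (Fin 2) ℂ)) = fun t =>
      p t • !![1, 0; 0, 0] + q t • !![0, 1; 0, 0] + r t • !![0, 0; 1, 0] + s t • !![0, 0; 0, 1] := by
    funext t
    ext i j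
    fin_cases i <;> fin_cases j <;> simp
  rw [h1]
  fun_prop

theorem differentiableAt_chart (h : StratumCondition a b c) {E : Type*} [NormedAddCommGroup E]
    [NormedSpace ℂ E] {ρ l w : E → ℂ} {e : E} (hρ : DifferentiableAt ℂ ρ e)
    (hl : DifferentiableAt ℂ l e) (hw : DifferentiableAt ℂ w e)
    (hrel : ρ e * l e * w e = c * chartPoly a b c (l e) (w e)) (j : Fin 4) :
    DifferentiableAt ℂ (fun t => chart a b c (ρ t) (l t) (w t) j) e := by
  have h1 : DifferentiableAt ℂ (fun t => chartSnd a b c (ρ t) (l t) (w t)) e := by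
    unfold chartSnd
    have hc := h.c_ne
    exact DifferentiableAt.matrix_fin_two (by fun_prop) (by fun_prop (disch := exact hc))
      (by fun_prop) (by fun_prop)
  have h3 : DifferentiableAt ℂ (fun t => (!![c, ρ t; 0, c] : Matrix (Fin 2) (Fin 2) ℂ)) e :=
    (differentiableAt_const _).matrix_fin_two hρ (differentiableAt_const _) (differentiableAt_const _)
  fin_cases j
  · exact differentiableAt_const _
  · exact h1
  · have hdet : (!![c, ρ e; 0, c] * chartFst a b * chartSnd a b c (ρ e) (l e) (w e)).det ≠ 0 := by
      rw [Matrix.det_mul, Matrix.det_mul, det_chartSnd h hrel, det_chartFst]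
      simp [h.c_ne, h.a_ne, h.b_ne]
    have h2 : DifferentiableAt ℂ (fun t => !![c, ρ t; 0, c] * chartFst a b *
        chartSnd a b c (ρ t) (l t) (w t)) e := (h3.mul_const _).mul h1
    exact DifferentiableAt.comp (g := fun g : Matrix (Fin 2) (Fin 2) ℂ => g⁻¹) e
      (differentiableAt_matrix_inv hdet) h2
  · exact h3

theorem differentiableAt_stratumParam (h : StratumCondition a b c)
    {e : Matrix (Fin 4) (Fin 4) ℂ × ℂ × ℂ} (he : stratumDenom a b c e ≠ 0) :
    DifferentiableAt ℂ (stratumParam a b c) e := by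
  obtain ⟨hg, hlw⟩ := mul_ne_zero_iff.1 he
  obtain ⟨hlw', hp⟩ := mul_ne_zero_iff.1 hlw
  obtain ⟨hl, hw⟩ := mul_ne_zero_iff.1 hlw'
  have hρ : DifferentiableAt ℂ (fun e : Matrix (Fin 4) (Fin 4) ℂ × ℂ × ℂ =>
      c * chartPoly a b c e.2.1 e.2.2 / (e.2.1 * e.2.2)) e := by
    unfold chartPoly
    fun_prop (disch := exact hlw')
  refine differentiableAt_pi.2 fun j => ?_
  have h1 := differentiableAt_chart h hρ (l := fun e => e.2.1) (w := fun e => e.2.2) (by fun_prop)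
    (by fun_prop) (param_rel hl hw) j
  have h2 : DifferentiableAt ℂ (fun e : Matrix (Fin 4) (Fin 4) ℂ × ℂ × ℂ => e.1⁻¹) e :=
    DifferentiableAt.comp (g := fun g : Matrix (Fin 4) (Fin 4) ℂ => g⁻¹) e
      (differentiableAt_matrix_inv hg) differentiableAt_fst
  have h3 := DifferentiableAt.comp e (differentiable_blockDiag (chart a b c 0 (a 1) 0 j) _) h1
  exact (differentiableAt_fst.mul h3).mul h2

theorem exists_stratumDenom_ne_zero (a b : Fin 3 → ℂ) (c : ℂ) :
    ∃ e, stratumDenom a b c e ≠ 0 := by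
  have hc : ∃ l, l ≠ 0 ∧ chartPoly a b c l 1 ≠ 0 := by
    by_contra! hcon
    have h1 := hcon 1 one_ne_zero
    have h2 := hcon (-1) (by norm_num)
    have h3 := hcon 2 two_ne_zero
    have h4 := hcon (-2) (by norm_num)
    rw [chartPoly] at h1 h2 h3 h4
    -- At `w = 1` the polynomial is monic quadratic in `l`; in this combination of values only the
    -- term `l ^ 2` contributes, namely 4 + 4 - 1 - 1.
    have : (6 : ℂ) = 0 := by linear_combination h3 + h4 - h1 - h2
    norm_num at this
  obtain ⟨l, hl, hp⟩ := hc
  exact ⟨(1, l, 1), by simp [stratumDenom, hl, hp]⟩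

theorem isIrreducibleVariety_stratumU (h : StratumCondition a b c) :
    IsIrreducibleVariety (tuplePoint '' stratumU a b c) := by
  refine isIrreducibleVariety_of_parametrization (δ := stratumDenom a b c)
    (φ := fun e => tuplePoint (stratumParam a b c e)) differentiable_stratumDenom ?_
    (exists_stratumDenom_ne_zero a b c) (fun e he => ⟨_, stratumParam_mem h he, rfl⟩) ?_
  · intro e he
    exact (hasFDerivAt_tuplePoint _).differentiableAt.comp e (differentiableAt_stratumParam h he)
  · rintro _ ⟨M, hM, rfl⟩
    have hcont : Continuous (tuplePoint (n := 4) (k := 4)) :=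
      continuous_iff_continuousAt.2 fun M => (hasFDerivAt_tuplePoint M).continuousAt
    refine map_mem_closure hcont (stratumU_subset_closure h hM) ?_
    rintro _ ⟨e, he, rfl⟩
    exact ⟨e, he, rfl⟩

end

noncomputable section

/-! ### Polynomial functions with matrix values -/

/-- The matrix-valued functions on affine space given by polynomials. -/
def IsPolynomialMatrix {σ : Type} {n : ℕ} (F : (σ → ℂ) → Matrix (Fin n) (Fin n) ℂ) : Prop :=
  ∀ i j, IsPolynomialFun (fun x => F x i j)

namespace IsPolynomialMatrix

variable {σ : Type} {n : ℕ} {F G : (σ → ℂ) → Matrix (Fin n) (Fin n) ℂ}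

theorem const (A : Matrix (Fin n) (Fin n) ℂ) : IsPolynomialMatrix (fun _ : σ → ℂ => A) :=
  fun i j => IsPolynomialFun.const (A i j)

theorem add (hF : IsPolynomialMatrix F) (hG : IsPolynomialMatrix G) :
    IsPolynomialMatrix (fun x => F x + G x) := fun i j => (hF i j).add (hG i j)

theorem sub (hF : IsPolynomialMatrix F) (hG : IsPolynomialMatrix G) :
    IsPolynomialMatrix (fun x => F x - G x) := fun i j => (hF i j).sub (hG i j)

theorem mul (hF : IsPolynomialMatrix F) (hG : IsPolynomialMatrix G) :
    IsPolynomialMatrix (fun x => F x * G x) := fun i j => by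
  simp only [Matrix.mul_apply]
  exact IsPolynomialFun.sum fun l => (hF i l).mul (hG l j)

theorem smul {f : (σ → ℂ) → ℂ} (hf : IsPolynomialFun f) (hF : IsPolynomialMatrix F) :
    IsPolynomialMatrix (fun x => f x • F x) := fun i j => hf.mul (hF i j)

theorem trace (hF : IsPolynomialMatrix F) : IsPolynomialFun (fun x => (F x).trace) :=
  IsPolynomialFun.sum fun i => hF i i

theorem tuple {k : ℕ} (j : Fin k) :
    IsPolynomialMatrix (fun x : Fin k × Fin n × Fin n → ℂ => (tupleEquiv n k).symm x j) :=
  fun i l => IsPolynomialFun.coord (j, i, l)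

end IsPolynomialMatrix

theorem IsPolynomialFun.isClosed_setOf_eq {σ : Type} {F G : (σ → ℂ) → ℂ} (hF : IsPolynomialFun F)
    (hG : IsPolynomialFun G) : @IsClosed _ (zariskiTopology σ) {x | F x = G x} := by
  rw [isClosed_zariskiTopology_iff]
  obtain ⟨f, hf⟩ := hF.sub hG
  refine ⟨{f}, ?_⟩
  ext x
  simp [← hf, sub_eq_zero]

theorem IsPolynomialMatrix.isClosed_setOf_eq {σ : Type} {n : ℕ}
    {F G : (σ → ℂ) → Matrix (Fin n) (Fin n) ℂ} (hF : IsPolynomialMatrix F)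
    (hG : IsPolynomialMatrix G) : @IsClosed _ (zariskiTopology σ) {x | F x = G x} := by
  let _ := zariskiTopology σ
  have h1 : {x | F x = G x} = ⋂ i, ⋂ j, {x | F x i j = G x i j} := by
    ext x
    simp [← Matrix.ext_iff]
  rw [h1]
  exact isClosed_iInter fun i => isClosed_iInter fun j => (hF i j).isClosed_setOf_eq (hG i j)

/-! ### Idempotent matrices -/

/-- The trace of an idempotent is its rank; a basis of the kernel followed by one of the range gives
the conjugating matrix. -/
theorem exists_conj_blockDiag_of_idempotent {E : Matrix (Fin 4) (Fin 4) ℂ} (hE : E * E = E)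
    (ht : E.trace = 2) :
    ∃ g k : Matrix (Fin 4) (Fin 4) ℂ, g * k = 1 ∧ k * g = 1 ∧ E = g * blockDiag 0 1 * k := by
  have hid : IsIdempotentElem (Matrix.toLin' E) := by
    rw [IsIdempotentElem, Module.End.mul_eq_comp, ← Matrix.toLin'_mul, hE]
  have hr : Module.finrank ℂ (LinearMap.range (Matrix.toLin' E)) = 2 := by
    have h1 := (LinearMap.IsIdempotentElem.isProj_range _ hid).trace
    rw [Matrix.trace_toLin'_eq, ht] at h1
    exact_mod_cast h1.symm
  have hk : Module.finrank ℂ (LinearMap.ker (Matrix.toLin' E)) = 2 := by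
    have h1 := (Matrix.toLin' E).finrank_range_add_finrank_ker
    rw [hr, Module.finrank_fintype_fun_eq_card, Fintype.card_fin] at h1
    omega
  let b : Module.Basis (Fin 4) ℂ (Fin 4 → ℂ) :=
    (((Module.finBasisOfFinrankEq ℂ _ hk).prod (Module.finBasisOfFinrankEq ℂ _ hr)).map
      (Submodule.prodEquivOfIsCompl _ _ (LinearMap.IsIdempotentElem.isCompl hid).symm)).reindex finSumFinEquiv
  have hb : ∀ i, E.mulVec (b (finSumFinEquiv (Sum.inl i : Fin 2 ⊕ Fin 2))) = 0 := by
    intro i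
    have : b (finSumFinEquiv (Sum.inl i : Fin 2 ⊕ Fin 2)) =
        (Module.finBasisOfFinrankEq ℂ _ hk i : Fin 4 → ℂ) := by
      simp [b]
    rw [this]
    exact (Module.finBasisOfFinrankEq ℂ _ hk i).2
  have hb' : ∀ i, E.mulVec (b (finSumFinEquiv (Sum.inr i : Fin 2 ⊕ Fin 2))) =
      b (finSumFinEquiv (Sum.inr i : Fin 2 ⊕ Fin 2)) := by
    intro i
    have : b (finSumFinEquiv (Sum.inr i : Fin 2 ⊕ Fin 2)) =
        (Module.finBasisOfFinrankEq ℂ _ hr i : Fin 4 → ℂ) := by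
      simp [b]
    rw [this]
    exact (LinearMap.IsIdempotentElem.mem_range_iff hid).1 (Module.finBasisOfFinrankEq ℂ _ hr i).2
  let g := (Pi.basisFun ℂ (Fin 4)).toMatrix b
  let k := b.toMatrix (Pi.basisFun ℂ (Fin 4))
  have hgk : g * k = 1 := Module.Basis.toMatrix_mul_toMatrix_flip _ _
  have hEg : E * g = g * blockDiag 0 1 := by
    ext i j
    have h1 : (E * g) i j = E.mulVec (b j) i := rfl
    have hg : ∀ i j, g i j = b j i := fun i j => by simp [g, Module.Basis.toMatrix_apply]
    have h2 : E.mulVec (b j) = ![0, 0, b 2, b 3] j := by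
      fin_cases j
      · exact hb 0
      · exact hb 1
      · exact hb' 0
      · exact hb' 1
    rw [h1, h2]
    fin_cases j <;> simp [blockDiag_eq, Matrix.mul_apply, Fin.sum_univ_four, hg]
  refine ⟨g, k, hgk, mul_eq_one_comm.1 hgk, ?_⟩
  rw [← hEg, mul_assoc, hgk, mul_one]

theorem eq_blockDiag_of_commute {X : Matrix (Fin 4) (Fin 4) ℂ}
    (h : blockDiag 0 1 * X = X * blockDiag 0 1) : ∃ N P, X = blockDiag N P := by
  obtain ⟨A, B, C, D, rfl⟩ := exists_eq_blockMatrix X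
  rw [← blockMatrix_zero_zero, blockMatrix_mul, blockMatrix_mul, blockMatrix_inj] at h
  simp only [zero_mul, one_mul, mul_zero, mul_one, zero_add, add_zero] at h
  exact ⟨A, D, by rw [← blockMatrix_zero_zero, ← h.2.1, h.2.2.1]⟩

/-! ### Equations of the stratum -/

variable {a b : Fin 3 → ℂ} {c : ℂ} {M : Fin 4 → Matrix (Fin 4) (Fin 4) ℂ}

/-- The nilpotent part of the fourth matrix. -/
def nilPart (c : ℂ) (M : Fin 4 → Matrix (Fin 4) (Fin 4) ℂ) : Matrix (Fin 4) (Fin 4) ℂ := M 3 - c • 1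

/-- A multiple of the projection to the second summand of a quadruple in the stratum. -/
def splitting (a b : Fin 3 → ℂ) (c : ℂ) (M : Fin 4 → Matrix (Fin 4) (Fin 4) ℂ) (i : Fin 3) :
    Matrix (Fin 4) (Fin 4) ℂ :=
  nilPart c M * M i.castSucc + M i.castSucc * nilPart c M - (a i + b i) • nilPart c M

/-- The factor of the projection in `splitting`. -/
def splittingFactor (c : ℂ) (M : Fin 4 → Matrix (Fin 4) (Fin 4) ℂ) (i : Fin 3) : ℂ :=
  (nilPart c M * M i.castSucc).trace

/-- Polynomial equations satisfied by the stratum. -/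
structure StratumEquations (a b : Fin 3 → ℂ) (c : ℂ) (M : Fin 4 → Matrix (Fin 4) (Fin 4) ℂ) :
    Prop where
  prod_eq : M 0 * M 1 * M 2 * M 3 = 1
  quadratic : ∀ j : Fin 3, (M j.castSucc - a j • 1) * (M j.castSucc - b j • 1) = 0
  trace_eq : ∀ j : Fin 3, (M j.castSucc).trace = 2 * (a j + b j)
  nilpotent : nilPart c M * nilPart c M = 0
  commute : ∀ i j, splitting a b c M i * M j = M j * splitting a b c M i
  idempotent : ∀ i, splitting a b c M i * splitting a b c M i =
    splittingFactor c M i • splitting a b c M i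
  trace_splitting : ∀ i, (splitting a b c M i).trace = 2 * splittingFactor c M i
  splitting_mul : ∀ i, splitting a b c M i * nilPart c M = splittingFactor c M i • nilPart c M
  trace_mul : ∀ i j : Fin 3, (splitting a b c M i * M j.castSucc).trace =
    splittingFactor c M i * (a j + b j)

/-- Polarized Cayley–Hamilton identity. It produces a scalar matrix in a `2 × 2` block out of a
traceless matrix and any other one, hence the projection to that block. -/
theorem mul_add_mul_fin_two {X : Matrix (Fin 2) (Fin 2) ℂ} (hX : X.trace = 0)
    (Y : Matrix (Fin 2) (Fin 2) ℂ) : X * Y + Y * X - Y.trace • X = (X * Y).trace • 1 := by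
  rw [Matrix.trace_fin_two] at hX
  ext i j
  fin_cases i <;> fin_cases j <;> simp [Matrix.mul_apply, Fin.sum_univ_two, Matrix.trace_fin_two]
  · linear_combination -Y 1 1 * hX
  · linear_combination Y 0 1 * hX
  · linear_combination Y 1 0 * hX
  · linear_combination -Y 0 0 * hX

theorem nilPart_eq {g k : Matrix (Fin 4) (Fin 4) ℂ} (hgk : g * k = 1)
    {N P : Fin 4 → Matrix (Fin 2) (Fin 2) ℂ} (hN : N 3 = c • 1)
    (hM : ∀ j, M j = g * blockDiag (N j) (P j) * k) :
    nilPart c M = g * blockDiag 0 (P 3 - c • 1) * k := by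
  rw [nilPart, hM, conj_sub_smul_one hgk, ← blockDiag_one, blockDiag_smul, blockDiag_sub, hN,
    sub_self]

/-- The nilpotent part lives in the second block and is traceless, so the polarized Cayley–Hamilton
identity makes each `splitting` its `splittingFactor` times the projection to this block. The
equations then hold block by block. -/
theorem stratumEquations_of_mem (h : StratumCondition a b c) (hM : M ∈ stratumU a b c) :
    StratumEquations a b c M ∧ ∃ i, splittingFactor c M i ≠ 0 := by
  obtain ⟨g, k, P, hgk, hkg, hP, h3, hg⟩ := (mem_stratumU_iff_normal h).1 hM
  have hN := chart_isScalarBlock h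
  set N := chart a b c 0 (a 1) 0
  obtain ⟨X, hX⟩ : ∃ X, X = P 3 - c • 1 := ⟨_, rfl⟩
  have hX0 : X.trace = 0 := by
    rw [hX, h3, Matrix.trace_fin_two]; simp
  have hR : nilPart c M = g * blockDiag 0 X * k := by
    rw [nilPart_eq hgk hN.eq_scalar hg, hX]
  have htP : ∀ j : Fin 3, (P j.castSucc).trace = a j + b j := fun j =>
    ((mem_conjClass_diagonal_iff (h.ne j)).1 (hP.mem_class j)).1
  have htN : ∀ j : Fin 3, (N j.castSucc).trace = a j + b j := fun j =>
    ((mem_conjClass_diagonal_iff (h.ne j)).1 (hN.mem_class j)).1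
  have hr : ∀ i, splittingFactor c M i = (X * P i.castSucc).trace := by
    intro i
    rw [splittingFactor, hR, hg, conj_mul_conj hkg, trace_conj_eq hkg, blockDiag_mul,
      trace_blockDiag, zero_mul, Matrix.trace_zero, zero_add]
  have hT : ∀ i, splitting a b c M i = g * blockDiag 0 (splittingFactor c M i • 1) * k := by
    intro i
    have h1 : (a i + b i) • (g * blockDiag 0 X * k) = g * blockDiag 0 ((a i + b i) • X) * k := by
      rw [← smul_mul_assoc, ← mul_smul_comm, blockDiag_smul, smul_zero]
    rw [splitting, hR, hg, conj_mul_conj hkg, conj_mul_conj hkg, h1, ← add_mul, ← mul_add, ← sub_mul,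
      ← mul_sub, blockDiag_mul, blockDiag_mul, blockDiag_add, blockDiag_sub, hr,
      ← mul_add_mul_fin_two hX0, htP]
    simp
  have hquad : ∀ j : Fin 3, (M j.castSucc - a j • 1) * (M j.castSucc - b j • 1) = 0 := by
    intro j
    have h1 : ∀ Q : Matrix (Fin 2) (Fin 2) ℂ, Q ∈ conjClass (Matrix.diagonal ![a j, b j]) →
        (Q - a j • 1) * (Q - b j • 1) = 0 := fun Q hQ => by
      obtain ⟨ht, hd⟩ := (mem_conjClass_diagonal_iff (h.ne j)).1 hQ
      exact sub_mul_sub_fin_two _ _ _ ht hd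
    rw [hg, conj_sub_smul_one hgk, conj_sub_smul_one hgk, conj_mul_conj hkg, ← blockDiag_one,
      blockDiag_smul, blockDiag_smul, blockDiag_sub, blockDiag_sub, blockDiag_mul,
      h1 _ (hN.mem_class j), h1 _ (hP.mem_class j), ← blockMatrix_zero_zero]
    simp [blockMatrix]
  refine ⟨⟨?_, hquad, ?_, ?_, ?_, ?_, ?_, ?_, ?_⟩, ?_⟩
  · rw [hg, hg, hg, hg, conj_mul_conj hkg, conj_mul_conj hkg, conj_mul_conj hkg, blockDiag_mul,
      blockDiag_mul, blockDiag_mul, hN.prod_eq, hP.prod_eq, blockDiag_one, mul_one, hgk]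
  · intro j
    rw [hg, trace_conj_eq hkg, trace_blockDiag, htN, htP, two_mul]
  · rw [hR, conj_mul_conj hkg, blockDiag_mul, hX, hP.sub_mul_sub, mul_zero, ← blockMatrix_zero_zero]
    simp [blockMatrix]
  · intro i j
    rw [hT, hg, conj_mul_conj hkg, conj_mul_conj hkg, blockDiag_mul, blockDiag_mul]
    simp
  · intro i
    rw [hT, conj_mul_conj hkg, ← smul_mul_assoc, ← mul_smul_comm, blockDiag_smul, blockDiag_mul]
    simp
  · intro i
    rw [hT, trace_conj_eq hkg, trace_blockDiag]
    simp [mul_comm]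
  · intro i
    rw [hT, hR, conj_mul_conj hkg, ← smul_mul_assoc, ← mul_smul_comm, blockDiag_smul, blockDiag_mul]
    simp
  · intro i j
    rw [hT, hg, conj_mul_conj hkg, trace_conj_eq hkg, blockDiag_mul, trace_blockDiag]
    simp [htP]
  -- In the Jordan basis of `P 3` the factors are the lower left entries of the other matrices; if
  -- all vanished, the tuple would be triangular.
  · by_contra! hcon
    have h0 : ∀ i : Fin 3, P i.castSucc 1 0 = 0 := by
      intro i
      have := hcon i
      rw [hr, hX, h3, Matrix.trace_fin_two] at this
      simpa [Matrix.mul_apply, Fin.sum_univ_two] using this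
    exact hP.toIsBlockTuple.not_triangular h (h0 0) (h0 1) (by simp [h3]) (by simp [h3])
      (by simp [h3])

theorem mem_conjClass_diagonal_of_quadratic {x y : ℂ} (hxy : x ≠ y) {X : Matrix (Fin 2) (Fin 2) ℂ}
    (ht : X.trace = x + y) (hq : (X - x • 1) * (X - y • 1) = 0) :
    X ∈ conjClass (Matrix.diagonal ![x, y]) := by
  refine (mem_conjClass_diagonal_iff hxy).2 ⟨ht, ?_⟩
  have h1 := congrFun (congrFun hq 0) 0
  simp [Matrix.mul_apply, Fin.sum_univ_two] at h1
  rw [Matrix.trace_fin_two] at ht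
  rw [Matrix.det_fin_two]
  linear_combination X 0 0 * ht - h1

/-- Divided by its nonzero factor, `splitting` is an idempotent of rank two that commutes with the
whole tuple, so all matrices become block diagonal in a common basis. The other equations give back
the conditions on the blocks. -/
theorem mem_stratumU_of_equations (h : StratumCondition a b c) (hM : StratumEquations a b c M)
    {i : Fin 3} (hi : splittingFactor c M i ≠ 0) : M ∈ stratumU a b c := by
  set r := splittingFactor c M i with hr
  have hE : (r⁻¹ • splitting a b c M i) * (r⁻¹ • splitting a b c M i) =
      r⁻¹ • splitting a b c M i := by
    rw [smul_mul_smul_comm, hM.idempotent, ← hr, smul_smul, mul_assoc, inv_mul_cancel₀ hi, mul_one]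
  obtain ⟨g, k, hgk, hkg, hg⟩ := exists_conj_blockDiag_of_idempotent hE (by
    rw [Matrix.trace_smul, hM.trace_splitting, ← hr, smul_eq_mul]
    field_simp)
  have hT : splitting a b c M i = r • (g * blockDiag 0 1 * k) := by
    rw [← hg, smul_smul, mul_inv_cancel₀ hi, one_smul]
  have hback : ∀ X : Matrix (Fin 4) (Fin 4) ℂ, X = g * (k * X * g) * k := by
    intro X
    calc X = (g * k) * X * (g * k) := by rw [hgk, one_mul, mul_one]
      _ = _ := by simp only [mul_assoc]
  have hcomm : ∀ j, ∃ N P, k * M j * g = blockDiag N P := by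
    intro j
    apply eq_blockDiag_of_commute
    have h1 := hM.commute i j
    rw [hT, smul_mul_assoc, mul_smul_comm] at h1
    have h2 := smul_right_injective _ hi h1
    calc blockDiag 0 1 * (k * M j * g) = (k * g) * blockDiag 0 1 * k * M j * g := by
          rw [hkg, one_mul]; simp only [mul_assoc]
      _ = k * (g * blockDiag 0 1 * k * M j) * g := by simp only [mul_assoc]
      _ = k * (M j * (g * blockDiag 0 1 * k)) * g := by rw [h2]
      _ = k * M j * g * blockDiag 0 1 * (k * g) := by simp only [mul_assoc]
      _ = _ := by rw [hkg, mul_one]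
  choose N P hNP using hcomm
  have hMj : ∀ j, M j = g * blockDiag (N j) (P j) * k := fun j => by rw [← hNP, ← hback]
  have hR : nilPart c M = g * blockDiag (N 3 - c • 1) (P 3 - c • 1) * k := by
    rw [nilPart, hMj, conj_sub_smul_one hgk, ← blockDiag_one, blockDiag_smul, blockDiag_sub]
  have hinj : ∀ {X Y : Matrix (Fin 4) (Fin 4) ℂ}, g * X * k = g * Y * k → X = Y := by
    intro X Y hXY
    have h1 := congrArg (fun Z => k * Z * g) hXY
    calc X = (k * g) * X * (k * g) := by rw [hkg, one_mul, mul_one]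
      _ = k * (g * X * k) * g := by simp only [mul_assoc]
      _ = k * (g * Y * k) * g := h1
      _ = (k * g) * Y * (k * g) := by simp only [mul_assoc]
      _ = Y := by rw [hkg, one_mul, mul_one]
  have hzero : ∀ {X : Matrix (Fin 4) (Fin 4) ℂ}, g * X * k = 0 → X = blockDiag 0 0 := by
    intro X hX
    apply hinj
    rw [hX, ← blockMatrix_zero_zero]
    simp [blockMatrix]
  -- The projection to the second block fixes the nilpotent part, so its first block vanishes.
  have hN3 : N 3 = c • 1 := by
    have h1 := hM.splitting_mul i
    rw [hT, smul_mul_assoc] at h1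
    have h2 := smul_right_injective _ hi h1
    rw [hR, conj_mul_conj hkg] at h2
    have h3 := hinj h2
    rw [blockDiag_mul, blockDiag_inj, zero_mul] at h3
    exact (sub_eq_zero.1 h3.1.symm)
  have hPsq : (P 3 - c • 1) * (P 3 - c • 1) = 0 := by
    have h1 := hM.nilpotent
    rw [hR, conj_mul_conj hkg, blockDiag_mul] at h1
    exact (blockDiag_inj.1 (hzero h1)).2
  have htP : ∀ j : Fin 3, (P j.castSucc).trace = a j + b j := by
    intro j
    have h1 := hM.trace_mul i j
    rw [hT, smul_mul_assoc, Matrix.trace_smul, hMj, conj_mul_conj hkg, trace_conj_eq hkg,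
      blockDiag_mul, trace_blockDiag, zero_mul, one_mul, Matrix.trace_zero, zero_add] at h1
    exact mul_left_cancel₀ hi h1
  have htN : ∀ j : Fin 3, (N j.castSucc).trace = a j + b j := by
    intro j
    have h1 := hM.trace_eq j
    rw [hMj, trace_conj_eq hkg, trace_blockDiag, htP] at h1
    linear_combination h1
  have hquad : ∀ j : Fin 3, (N j.castSucc - a j • 1) * (N j.castSucc - b j • 1) = 0 ∧
      (P j.castSucc - a j • 1) * (P j.castSucc - b j • 1) = 0 := by
    intro j
    have h1 := hM.quadratic j
    rw [hMj, conj_sub_smul_one hgk, conj_sub_smul_one hgk, conj_mul_conj hkg, ← blockDiag_one,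
      blockDiag_smul, blockDiag_smul, blockDiag_sub, blockDiag_sub, blockDiag_mul] at h1
    exact blockDiag_inj.1 (hzero h1)
  have hprod : N 0 * N 1 * N 2 * N 3 = 1 ∧ P 0 * P 1 * P 2 * P 3 = 1 := by
    have h1 := hM.prod_eq
    rw [hMj, hMj, hMj, hMj, conj_mul_conj hkg, conj_mul_conj hkg, conj_mul_conj hkg, blockDiag_mul,
      blockDiag_mul, blockDiag_mul] at h1
    have h2 := eq_one_of_conj_eq_one hkg h1
    rwa [← blockDiag_one, blockDiag_inj] at h2
  have hP3 : P 3 - c • 1 ≠ 0 := by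
    intro h0
    apply hi
    rw [hr, splittingFactor, hR, hMj, conj_mul_conj hkg, trace_conj_eq hkg, h0, hN3, sub_self,
      blockDiag_mul, trace_blockDiag]
    simp
  rw [mem_stratumU_iff h]
  refine ⟨g, k, N, P, hgk, hkg, ⟨⟨fun j => ?_, hprod.1⟩, hN3⟩, ⟨⟨fun j => ?_, hprod.2⟩, ?_⟩, hMj⟩
  · exact mem_conjClass_diagonal_of_quadratic (h.ne j) (htN j) (hquad j).1
  · exact mem_conjClass_diagonal_of_quadratic (h.ne j) (htP j) (hquad j).2
  · have hnil : IsNilpotent (P 3 - c • 1) := ⟨2, by rw [sq, hPsq]⟩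
    have ht : (P 3 - c • 1).trace = 0 := (Matrix.isNilpotent_trace_of_isNilpotent hnil).eq_zero
    have hd : (P 3 - c • 1).det = 0 := by
      have := congrArg Matrix.det hPsq
      rw [Matrix.det_mul, Matrix.det_zero] at this
      exact mul_self_eq_zero.1 this
    rw [mem_conjClass_jordan_iff]
    rw [Matrix.trace_fin_two] at ht
    rw [Matrix.det_fin_two] at hd
    simp at ht hd
    refine ⟨?_, ?_, fun h0 => hP3 (sub_eq_zero.2 h0)⟩
    · rw [Matrix.trace_fin_two]
      linear_combination ht
    · rw [Matrix.det_fin_two]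
      linear_combination hd + c * ht

/-- The equations define a closed set, and the nonvanishing of one of the factors an open one. -/
theorem isAffineSubvariety_stratumU (h : StratumCondition a b c) :
    IsAffineSubvariety (tuplePoint '' stratumU a b c) := by
  let _ := zariskiTopology (Fin 4 × Fin 4 × Fin 4)
  have hset : tuplePoint '' stratumU a b c =
      {x | ∃ i, splittingFactor c ((tupleEquiv 4 4).symm x) i ≠ 0} ∩
      {x | StratumEquations a b c ((tupleEquiv 4 4).symm x)} := by
    ext x
    constructor
    · rintro ⟨M, hM, rfl⟩
      exact (stratumEquations_of_mem h hM).symm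
    · rintro ⟨⟨i, hi⟩, hx⟩
      exact ⟨_, mem_stratumU_of_equations h hx hi, (tupleEquiv 4 4).apply_symm_apply x⟩
  have hM : ∀ j : Fin 4, IsPolynomialMatrix
      (fun x : Fin 4 × Fin 4 × Fin 4 → ℂ => (tupleEquiv 4 4).symm x j) := IsPolynomialMatrix.tuple
  have hR : IsPolynomialMatrix (fun x => nilPart c ((tupleEquiv 4 4).symm x)) :=
    (hM 3).sub (.const _)
  have hr : ∀ i, IsPolynomialFun (fun x => splittingFactor c ((tupleEquiv 4 4).symm x) i) :=
    fun i => (hR.mul (hM _)).trace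
  have hT : ∀ i, IsPolynomialMatrix (fun x => splitting a b c ((tupleEquiv 4 4).symm x) i) :=
    fun i => ((hR.mul (hM _)).add ((hM _).mul hR)).sub (.smul (.const _) hR)
  rw [IsAffineSubvariety, hset]
  refine ⟨_, _, ?_, ?_, rfl⟩
  · have h1 : {x | ∃ i, splittingFactor c ((tupleEquiv 4 4).symm x) i ≠ 0} =
        ⋃ i, {x | splittingFactor c ((tupleEquiv 4 4).symm x) i = 0}ᶜ := by
      ext x; simp
    rw [h1]
    exact isOpen_iUnion fun i => ((hr i).isClosed_setOf_eq (.const 0)).isOpen_compl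
  · have h1 : {x | StratumEquations a b c ((tupleEquiv 4 4).symm x)} =
        {x | (tupleEquiv 4 4).symm x 0 * (tupleEquiv 4 4).symm x 1 * (tupleEquiv 4 4).symm x 2 *
          (tupleEquiv 4 4).symm x 3 = 1} ∩
        ((⋂ j : Fin 3, {x | ((tupleEquiv 4 4).symm x j.castSucc - a j • 1) *
          ((tupleEquiv 4 4).symm x j.castSucc - b j • 1) = 0}) ∩
        ((⋂ j : Fin 3, {x | ((tupleEquiv 4 4).symm x j.castSucc).trace = 2 * (a j + b j)}) ∩
        ({x | nilPart c ((tupleEquiv 4 4).symm x) * nilPart c ((tupleEquiv 4 4).symm x) = 0} ∩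
        ((⋂ i : Fin 3, ⋂ j : Fin 4, {x | splitting a b c ((tupleEquiv 4 4).symm x) i *
          (tupleEquiv 4 4).symm x j = (tupleEquiv 4 4).symm x j *
          splitting a b c ((tupleEquiv 4 4).symm x) i}) ∩
        ((⋂ i : Fin 3, {x | splitting a b c ((tupleEquiv 4 4).symm x) i *
          splitting a b c ((tupleEquiv 4 4).symm x) i =
          splittingFactor c ((tupleEquiv 4 4).symm x) i •
          splitting a b c ((tupleEquiv 4 4).symm x) i}) ∩
        ((⋂ i : Fin 3, {x | (splitting a b c ((tupleEquiv 4 4).symm x) i).trace =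
          2 * splittingFactor c ((tupleEquiv 4 4).symm x) i}) ∩
        ((⋂ i : Fin 3, {x | splitting a b c ((tupleEquiv 4 4).symm x) i *
          nilPart c ((tupleEquiv 4 4).symm x) =
          splittingFactor c ((tupleEquiv 4 4).symm x) i • nilPart c ((tupleEquiv 4 4).symm x)}) ∩
        ⋂ i : Fin 3, ⋂ j : Fin 3, {x | (splitting a b c ((tupleEquiv 4 4).symm x) i *
          (tupleEquiv 4 4).symm x j.castSucc).trace =
          splittingFactor c ((tupleEquiv 4 4).symm x) i * (a j + b j)}))))))) := by
      ext x
      simp only [Set.mem_inter_iff, Set.mem_iInter, Set.mem_ofPred_eq]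
      exact ⟨fun ⟨e1, e2, e3, e4, e5, e6, e7, e8, e9⟩ => ⟨e1, e2, e3, e4, e5, e6, e7, e8, e9⟩,
        fun ⟨e1, e2, e3, e4, e5, e6, e7, e8, e9⟩ => ⟨e1, e2, e3, e4, e5, e6, e7, e8, e9⟩⟩
    rw [h1]
    refine (((((hM 0).mul (hM 1)).mul (hM 2)).mul (hM 3)).isClosed_setOf_eq (.const 1)).inter ?_
    refine (isClosed_iInter fun j => (((hM _).sub (.const _)).mul
      ((hM _).sub (.const _))).isClosed_setOf_eq (.const 0)).inter ?_
    refine (isClosed_iInter fun j => (hM _).trace.isClosed_setOf_eq (.const _)).inter ?_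
    refine ((hR.mul hR).isClosed_setOf_eq (.const 0)).inter ?_
    refine (isClosed_iInter fun i => isClosed_iInter fun j =>
      ((hT i).mul (hM j)).isClosed_setOf_eq ((hM j).mul (hT i))).inter ?_
    refine (isClosed_iInter fun i =>
      ((hT i).mul (hT i)).isClosed_setOf_eq (.smul (hr i) (hT i))).inter ?_
    refine (isClosed_iInter fun i =>
      (hT i).trace.isClosed_setOf_eq ((IsPolynomialFun.const 2).mul (hr i))).inter ?_
    refine (isClosed_iInter fun i =>
      ((hT i).mul hR).isClosed_setOf_eq (.smul (hr i) hR)).inter ?_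
    exact isClosed_iInter fun i => isClosed_iInter fun j =>
      ((hT i).mul (hM _)).trace.isClosed_setOf_eq ((hr i).mul (.const _))

end

noncomputable section

/-! ### Conjugacy classes of `4 × 4` matrices -/

/-- The map `Y ↦ Y A - A Y`. -/
def adMap {n : ℕ} (A : Matrix (Fin n) (Fin n) ℂ) :
    Matrix (Fin n) (Fin n) ℂ →ₗ[ℂ] Matrix (Fin n) (Fin n) ℂ :=
  LinearMap.mulRight ℂ A - LinearMap.mulLeft ℂ A

theorem adMap_apply {n : ℕ} (A Y : Matrix (Fin n) (Fin n) ℂ) : adMap A Y = Y * A - A * Y := rfl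

theorem adMap_sub_smul_one {n : ℕ} (A : Matrix (Fin n) (Fin n) ℂ) (z : ℂ) :
    adMap (A - z • 1) = adMap A := by
  ext1 Y
  simp [adMap_apply, mul_sub, sub_mul]

theorem finrank_range_adMap {n : ℕ} {A X : Matrix (Fin n) (Fin n) ℂ} (hX : X ∈ conjClass A) :
    Module.finrank ℂ (LinearMap.range (adMap X)) = Module.finrank ℂ (LinearMap.range (adMap A)) := by
  obtain ⟨g, k, hgk, hkg, rfl⟩ := mem_conjClass_iff.1 hX
  let e : Matrix (Fin n) (Fin n) ℂ ≃ₗ[ℂ] Matrix (Fin n) (Fin n) ℂ :=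
    LinearEquiv.ofLinearMap (LinearMap.mulRight ℂ k ∘ₗ LinearMap.mulLeft ℂ g)
      (LinearMap.mulRight ℂ g ∘ₗ LinearMap.mulLeft ℂ k)
      (by ext1 Y; simp [← mul_assoc, hgk]; simp [mul_assoc, hgk])
      (by ext1 Y; simp [← mul_assoc, hkg]; simp [mul_assoc, hkg])
  have he : ∀ Y, e Y = g * Y * k := fun Y => rfl
  have h1 : LinearMap.range (adMap (g * A * k)) =
      (LinearMap.range (adMap A)).map (e : Matrix (Fin n) (Fin n) ℂ →ₗ[ℂ] Matrix (Fin n) (Fin n) ℂ) := by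
    rw [← LinearMap.range_comp, ← LinearMap.range_comp_of_range_eq_top (adMap (g * A * k)) e.range]
    congr 1
    ext1 Y
    simp only [LinearMap.comp_apply, LinearEquiv.coe_coe, he, adMap_apply]
    rw [conj_mul_conj hkg, conj_mul_conj hkg, mul_sub, sub_mul]
  rw [h1, LinearEquiv.finrank_map_eq]

theorem quadratic_of_mem_conjClass_diagonal {a b : ℂ} {X : Matrix (Fin 4) (Fin 4) ℂ}
    (hX : X ∈ conjClass (Matrix.diagonal ![a, a, b, b])) : (X - a • 1) * (X - b • 1) = 0 := by
  refine quadratic_of_mem_conjClass hX ?_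
  ext i j
  fin_cases i <;> fin_cases j <;> simp [Matrix.mul_apply, Fin.sum_univ_four]

/-- If `R` has rank one, written `u vᵀ`, then `R A R = (vᵀ A u) R`. In this form the rank condition
consists of polynomial identities, which can be differentiated along tangent vectors. -/
theorem rank_one_of_mem_conjClass_jordan {c : ℂ} {X : Matrix (Fin 4) (Fin 4) ℂ}
    (hX : X ∈ conjClass !![c, 1, 0, 0; 0, c, 0, 0; 0, 0, c, 0; 0, 0, 0, c]) :
    (∀ A, (X - c • 1) * A * (X - c • 1) = ((X - c • 1) * A).trace • (X - c • 1)) ∧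
      (X - c • 1) * (X - c • 1) = 0 ∧ X - c • 1 ≠ 0 := by
  obtain ⟨g, k, hgk, hkg, rfl⟩ := mem_conjClass_iff.1 hX
  have hJ : (!![c, 1, 0, 0; 0, c, 0, 0; 0, 0, c, 0; 0, 0, 0, c] : Matrix (Fin 4) (Fin 4) ℂ) - c • 1 =
      !![0, 1, 0, 0; 0, 0, 0, 0; 0, 0, 0, 0; 0, 0, 0, 0] := by
    ext i j
    fin_cases i <;> fin_cases j <;> simp
  rw [conj_sub_smul_one hgk, hJ]
  set R : Matrix (Fin 4) (Fin 4) ℂ := !![0, 1, 0, 0; 0, 0, 0, 0; 0, 0, 0, 0; 0, 0, 0, 0] with hR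
  have h1 : ∀ A : Matrix (Fin 4) (Fin 4) ℂ, R * A * R = (R * A).trace • R := by
    intro A
    ext i j
    simp only [Matrix.mul_apply, Fin.sum_univ_four, Matrix.trace, Matrix.diag_apply,
      Matrix.smul_apply, hR]
    fin_cases i <;> fin_cases j <;> simp
  refine ⟨fun A => ?_, ?_, ?_⟩
  · have h2 : (g * R * k * A).trace = (R * (k * A * g)).trace := by
      rw [mul_assoc, mul_assoc, Matrix.trace_mul_comm]; simp only [mul_assoc]
    rw [h2]
    calc g * R * k * A * (g * R * k) = g * (R * (k * A * g) * R) * k := by simp only [mul_assoc]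
      _ = _ := by rw [h1, mul_smul_comm, smul_mul_assoc]
  · have h2 : R * R = 0 := by
      ext i j
      fin_cases i <;> fin_cases j <;> simp [hR, Matrix.mul_apply, Fin.sum_univ_four]
    rw [conj_mul_conj hkg, h2, mul_zero, zero_mul]
  · intro h0
    have h2 : R = 0 := by
      calc R = (k * g) * R * (k * g) := by rw [hkg, one_mul, mul_one]
        _ = k * (g * R * k) * g := by simp only [mul_assoc]
        _ = 0 := by rw [h0, mul_zero, zero_mul]
    have := congrFun (congrFun h2 0) 1
    simp [hR] at this

/-- The range consists of the two off-diagonal `2 × 2` blocks. -/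
theorem finrank_range_adMap_diagonal {a b : ℂ} (hab : a ≠ b) :
    Module.finrank ℂ (LinearMap.range (adMap (Matrix.diagonal ![a, a, b, b]))) = 8 := by
  obtain ⟨ι, hιa⟩ : ∃ ι : (Fin 8 → ℂ) →ₗ[ℂ] Matrix (Fin 4) (Fin 4) ℂ,
      ∀ w, ι w = !![0, 0, w 0, w 1; 0, 0, w 2, w 3; w 4, w 5, 0, 0; w 6, w 7, 0, 0] :=
    ⟨{  toFun := fun w => !![0, 0, w 0, w 1; 0, 0, w 2, w 3; w 4, w 5, 0, 0; w 6, w 7, 0, 0]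
        map_add' := fun v w => by ext i j; fin_cases i <;> fin_cases j <;> simp
        map_smul' := fun z w => by ext i j; fin_cases i <;> fin_cases j <;> simp }, fun _ => rfl⟩
  have hι : Function.Injective ι :=
    Function.LeftInverse.injective (g := fun X => ![X 0 2, X 0 3, X 1 2, X 1 3, X 2 0, X 2 1, X 3 0, X 3 1]) fun w => by
      simp only [hιa]
      funext i
      fin_cases i <;> simp
  have hr : LinearMap.range (adMap (Matrix.diagonal ![a, a, b, b])) = LinearMap.range ι := by
    have hd : ∀ Y i j, adMap (Matrix.diagonal ![a, a, b, b]) Y i j =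
        Y i j * (![a, a, b, b] j - ![a, a, b, b] i) := by
      intro Y i j
      rw [adMap_apply, Matrix.sub_apply, Matrix.mul_diagonal, Matrix.diagonal_mul]
      ring
    have hab1 : b - a ≠ 0 := sub_ne_zero.2 hab.symm
    have hab2 : a - b ≠ 0 := sub_ne_zero.2 hab
    apply le_antisymm
    · rintro _ ⟨Y, rfl⟩
      refine ⟨![Y 0 2 * (b - a), Y 0 3 * (b - a), Y 1 2 * (b - a), Y 1 3 * (b - a),
        Y 2 0 * (a - b), Y 2 1 * (a - b), Y 3 0 * (a - b), Y 3 1 * (a - b)], ?_⟩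
      ext i j
      rw [hd, hιa]
      fin_cases i <;> fin_cases j <;> simp
    · rintro _ ⟨w, rfl⟩
      refine ⟨!![0, 0, w 0 / (b - a), w 1 / (b - a); 0, 0, w 2 / (b - a), w 3 / (b - a);
        w 4 / (a - b), w 5 / (a - b), 0, 0; w 6 / (a - b), w 7 / (a - b), 0, 0], ?_⟩
      ext i j
      rw [hd, hιa]
      fin_cases i <;> fin_cases j <;> simp [hab1, hab2]
  rw [hr, LinearMap.finrank_range_of_inj hι, Module.finrank_fintype_fun_eq_card, Fintype.card_fin]

/-- Commutators with a single matrix unit fill the matrices supported on one row and one column,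
seven positions, subject to trace zero. -/
theorem finrank_range_adMap_jordan (c : ℂ) :
    Module.finrank ℂ (LinearMap.range (adMap
      !![c, 1, 0, 0; 0, c, 0, 0; 0, 0, c, 0; 0, 0, 0, c])) = 6 := by
  obtain ⟨ι, hιa⟩ : ∃ ι : (Fin 6 → ℂ) →ₗ[ℂ] Matrix (Fin 4) (Fin 4) ℂ,
      ∀ w, ι w = !![-w 0, w 1, w 2, w 3; 0, w 0, 0, 0; 0, w 4, 0, 0; 0, w 5, 0, 0] :=
    ⟨{  toFun := fun w => !![-w 0, w 1, w 2, w 3; 0, w 0, 0, 0; 0, w 4, 0, 0; 0, w 5, 0, 0]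
        map_add' := fun v w => by ext i j; fin_cases i <;> fin_cases j <;> simp [add_comm]
        map_smul' := fun z w => by ext i j; fin_cases i <;> fin_cases j <;> simp }, fun _ => rfl⟩
  have hι : Function.Injective ι :=
    Function.LeftInverse.injective (g := fun X => ![X 1 1, X 0 1, X 0 2, X 0 3, X 2 1, X 3 1]) fun w => by
      simp only [hιa]
      funext i
      fin_cases i <;> simp
  have hd : ∀ Y, adMap !![c, 1, 0, 0; 0, c, 0, 0; 0, 0, c, 0; 0, 0, 0, c] Y =
      !![-Y 1 0, Y 0 0 - Y 1 1, -Y 1 2, -Y 1 3; 0, Y 1 0, 0, 0; 0, Y 2 0, 0, 0; 0, Y 3 0, 0, 0] := by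
    intro Y
    ext i j
    simp only [adMap_apply, Matrix.sub_apply, Matrix.mul_apply, Fin.sum_univ_four]
    fin_cases i <;> fin_cases j <;> simp <;> ring
  have hr : LinearMap.range (adMap !![c, 1, 0, 0; 0, c, 0, 0; 0, 0, c, 0; 0, 0, 0, c]) =
      LinearMap.range ι := by
    apply le_antisymm
    · rintro _ ⟨Y, rfl⟩
      refine ⟨![Y 1 0, Y 0 0 - Y 1 1, -Y 1 2, -Y 1 3, Y 2 0, Y 3 0], ?_⟩
      rw [hd, hιa]
      simp
    · rintro _ ⟨w, rfl⟩
      refine ⟨!![w 1, 0, 0, 0; w 0, 0, -w 2, -w 3; w 4, 0, 0, 0; w 5, 0, 0, 0], ?_⟩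
      rw [hd, hιa]
      simp
  rw [hr, LinearMap.finrank_range_of_inj hι, Module.finrank_fintype_fun_eq_card, Fintype.card_fin]

end

noncomputable section

open scoped Matrix.Norms.Operator

/-! ### Tangent spaces of conjugacy classes -/

theorem IsPolynomialMatrix.hasDerivAt_eq_zero {σ : Type} [Fintype σ] {n : ℕ} {S : Set (σ → ℂ)}
    {x v : σ → ℂ} (hv : v ∈ zariskiTangentSpace S x) {F : (σ → ℂ) → Matrix (Fin n) (Fin n) ℂ}
    (hF : IsPolynomialMatrix F) (h0 : ∀ y ∈ S, F y = 0) {D : Matrix (Fin n) (Fin n) ℂ}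
    (hD : HasDerivAt (fun t : ℂ => F (x + t • v)) D 0) : D = 0 := by
  ext i j
  obtain ⟨f, hf⟩ := hF i j
  have h1 := hasFDerivAt_eval f x
  have h2 := fderiv_eq_zero_of_mem_zariskiTangentSpace hv (hF i j)
    (fun y hy => by rw [h0 y hy, Matrix.zero_apply]) (by simpa only [← hf] using h1)
  have h3 : HasDerivAt (fun t : ℂ => x + t • v) v 0 :=
    (((hasDerivAt_id (0 : ℂ)).smul_const v).const_add x).congr_deriv (one_smul ℂ v)
  have h4 : HasDerivAt (fun t : ℂ => MvPolynomial.eval (x + t • v) f) _ 0 :=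
    HasFDerivAt.comp_hasDerivAt (0 : ℂ) (l := fun y => MvPolynomial.eval y f)
      (by simpa using h1) h3
  have h5 : HasDerivAt (fun t : ℂ => F (x + t • v) i j) (D i j) 0 :=
    HasFDerivAt.comp_hasDerivAt (0 : ℂ)
      (LinearMap.toContinuousLinearMap (Matrix.entryLinearMap ℂ ℂ i j)).hasFDerivAt hD
  simp only [hf] at h5
  rw [h5.unique h4, h2, Matrix.zero_apply]

section Tangent

theorem hasDerivAt_linear_line {σ : Type} {n : ℕ} (L : (σ → ℂ) →ₗ[ℂ] Matrix (Fin n) (Fin n) ℂ) (x v : σ → ℂ) :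
    HasDerivAt (fun t : ℂ => L (x + t • v)) (L v) 0 := by
  simp only [map_add, map_smul]
  exact (((hasDerivAt_id (0 : ℂ)).smul_const (L v)).const_add (L x)).congr_deriv (one_smul ℂ _)

variable {σ : Type} [Fintype σ] {n : ℕ} {S : Set (σ → ℂ)} {x v : σ → ℂ}
  {L : (σ → ℂ) →ₗ[ℂ] Matrix (Fin n) (Fin n) ℂ}

/-- Tangent vectors of families of diagonalizable matrices with two eigenvalues. -/
theorem mem_range_adMap_of_quadratic {p q : ℂ} (hpq : p ≠ q) (hL : IsPolynomialMatrix (fun y => L y))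
    (hS : ∀ y ∈ S, (L y - p • 1) * (L y - q • 1) = 0) (hx : x ∈ S)
    (hv : v ∈ zariskiTangentSpace S x) : L v ∈ LinearMap.range (adMap (L x)) := by
  have h1 := hasDerivAt_linear_line L x v
  have h2 := (h1.sub_const (p • 1)).mul (h1.sub_const (q • 1))
  have h3 := IsPolynomialMatrix.hasDerivAt_eq_zero hv
    ((hL.sub (.const (p • 1))).mul (hL.sub (.const (q • 1)))) hS h2
  simp only [zero_smul, add_zero] at h3
  have h4 := hS x hx
  set X := L x
  set V := L v
  have hpq' : q - p ≠ 0 := sub_ne_zero.2 hpq.symm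
  have hs : X - q • 1 = (X - p • 1) - (q - p) • (1 : Matrix (Fin n) (Fin n) ℂ) := by
    rw [sub_smul]; abel
  -- The quadratic equation says that `E` is idempotent, and its derivative that `V = V E + E V`.
  obtain ⟨E, hE⟩ : ∃ E, X - p • 1 = (q - p) • E :=
    ⟨(q - p)⁻¹ • (X - p • 1), by rw [smul_smul, mul_inv_cancel₀ hpq', one_smul]⟩
  rw [hs, hE, ← smul_sub, smul_mul_smul_comm, smul_eq_zero_iff_right (mul_ne_zero hpq' hpq'), mul_sub,
    mul_one, sub_eq_zero] at h4
  rw [hs, hE, ← smul_sub, mul_smul_comm, smul_mul_assoc, ← smul_add,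
    smul_eq_zero_iff_right hpq', mul_sub, mul_one] at h3
  have h5 : V = V * E + E * V := by
    rw [← sub_eq_zero, ← neg_eq_zero, ← h3]; abel
  have h6 : E * V * E = 0 := by
    have := congrArg (fun Z => E * Z) h5
    simp only [mul_add, ← mul_assoc, h4] at this
    simpa using this
  -- Since `E V E = 0`, the commutator of `V E - E V` with `E` is `V E + E V = V`.
  refine ⟨(q - p)⁻¹ • (V * E - E * V), ?_⟩
  rw [← adMap_sub_smul_one X p, hE, adMap_apply, smul_mul_smul_comm, smul_mul_smul_comm,
    inv_mul_cancel₀ hpq', mul_inv_cancel₀ hpq', one_smul, one_smul, sub_mul, mul_sub, mul_assoc V, h4,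
    h6, ← mul_assoc, h6, ← mul_assoc, h4]
  nth_rewrite 3 [h5]
  abel

/-- Tangent vectors of families of nilpotent matrices of rank one, up to a scalar matrix. -/
theorem mem_range_adMap_of_rank_one {c : ℂ} (hL : IsPolynomialMatrix (fun y => L y))
    (hS : ∀ y ∈ S, ∀ A, (L y - c • 1) * A * (L y - c • 1) = ((L y - c • 1) * A).trace • (L y - c • 1))
    (hS' : ∀ y ∈ S, (L y - c • 1) * (L y - c • 1) = 0) (hx : x ∈ S) (hne : L x - c • 1 ≠ 0)
    (hv : v ∈ zariskiTangentSpace S x) : L v ∈ LinearMap.range (adMap (L x)) := by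
  have h1 := (hasDerivAt_linear_line L x v).sub_const (c • 1)
  have hR := hL.sub (.const (c • 1))
  have hsq := IsPolynomialMatrix.hasDerivAt_eq_zero hv (hR.mul hR) hS' (h1.mul h1)
  have key : ∀ A, L v * A * (L x - c • 1) + (L x - c • 1) * A * L v =
      ((L x - c • 1) * A).trace • L v + (L v * A).trace • (L x - c • 1) := by
    intro A
    have h2 : HasDerivAt (fun t : ℂ => ((L (x + t • v) - c • 1) * A).trace) (L v * A).trace 0 :=
      HasFDerivAt.comp_hasDerivAt (0 : ℂ)
        (LinearMap.toContinuousLinearMap (Matrix.traceLinearMap (Fin n) ℂ ℂ)).hasFDerivAt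
        (h1.mul_const A)
    have h3 := IsPolynomialMatrix.hasDerivAt_eq_zero hv
      (((hR.mul (.const A)).mul hR).sub (.smul (hR.mul (.const A)).trace hR))
      (fun y hy => sub_eq_zero.2 (hS y hy A)) (((h1.mul_const A).mul h1).sub (h2.smul h1))
    simp only [zero_smul, add_zero] at h3
    rw [sub_eq_zero] at h3
    exact h3
  simp only [zero_smul, add_zero] at hsq
  rw [← adMap_sub_smul_one (L x) c]
  have hS1 := hS x hx
  have hS2 := hS' x hx
  set R := L x - c • 1
  set X := L v
  -- Nondegeneracy of the trace form, applied to `R ≠ 0`.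
  obtain ⟨A, hA⟩ : ∃ A, (R * A).trace = 1 := by
    by_contra! hcon
    apply hne
    refine Matrix.ext_iff_trace_mul_right.2 fun A => ?_
    by_contra h0
    rw [zero_mul, Matrix.trace_zero] at h0
    apply hcon ((R * A).trace⁻¹ • A)
    rw [mul_smul_comm, Matrix.trace_smul, smul_eq_mul, inv_mul_cancel₀ h0]
  have hX := key A
  have hRA := hS1 A
  rw [hA, one_smul] at hX hRA
  obtain ⟨μ, hμ⟩ : ∃ μ, μ = (R * (A * X)).trace := ⟨_, rfl⟩
  have hXR : X * R = μ • R := by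
    rw [hμ, ← hS1]
    have := congrArg (fun Z => Z * R) hX
    simp only [add_mul, mul_assoc, smul_mul_assoc, hS2] at this
    simpa [mul_assoc] using this.symm
  have hRX : R * X = -(μ • R) := by
    rw [← hXR]
    exact eq_neg_of_add_eq_zero_right hsq
  obtain ⟨τ, hτ⟩ : ∃ τ, τ = (X * A).trace := ⟨_, rfl⟩
  rw [← hτ] at hX
  -- In the commutator with `R` the terms `A R` and `R A` cancel because `X R = μ R` and `R X = -μ
  -- R`. What remains is `X A R + R A X - τ R`, which is `X` by the differentiated rank one
  -- identity.
  refine ⟨X * A - A * X + μ • A - τ • (R * A), ?_⟩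
  have e1 : A * X * R = μ • (A * R) := by rw [mul_assoc, hXR, mul_smul_comm]
  have e2 : R * (X * A) = -(μ • (R * A)) := by rw [← mul_assoc, hRX, neg_mul, smul_mul_assoc]
  have e3 : R * (R * A) = 0 := by rw [← mul_assoc, hS2, zero_mul]
  rw [adMap_apply]
  simp only [sub_mul, add_mul, mul_sub, mul_add, smul_mul_assoc, mul_smul_comm, e1, e2, e3, hRA,
    smul_zero]
  rw [← mul_assoc R A X, ← sub_eq_zero]
  have hX' : X = X * A * R + R * A * X - τ • R := by rw [hX]; abel
  nth_rewrite 3 [hX']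
  abel

end Tangent

/-! ### Dimensions of conjugacy classes -/

theorem isIrreducibleVariety_conjClass {n : ℕ} (A : Matrix (Fin n) (Fin n) ℂ) :
    IsIrreducibleVariety (matrixPoint '' conjClass A) := by
  refine isIrreducibleVariety_of_parametrization
    (δ := fun g : Matrix (Fin n) (Fin n) ℂ => g.det) (φ := fun g => matrixPoint (g * A * g⁻¹))
    differentiable_matrix_det ?_ ⟨1, by simp⟩ ?_ ?_
  · intro g hg
    refine (hasFDerivAt_matrixPoint _).differentiableAt.comp g ?_
    exact (differentiableAt_id.mul_const A).mul (differentiableAt_matrix_inv hg)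
  · intro g hg
    exact ⟨_, mem_conjClass_iff.2 ⟨g, g⁻¹, Matrix.mul_nonsing_inv _ hg.isUnit,
      Matrix.nonsing_inv_mul _ hg.isUnit, rfl⟩, rfl⟩
  · rintro _ ⟨X, hX, rfl⟩
    obtain ⟨g, k, hgk, hkg, rfl⟩ := mem_conjClass_iff.1 hX
    refine subset_closure ⟨g, ?_, ?_⟩
    · intro h0
      have := congrArg Matrix.det hgk
      rw [Matrix.det_mul, h0, zero_mul, Matrix.det_one] at this
      exact zero_ne_one this
    · simp only [Matrix.inv_eq_right_inv hgk]

/-- Curves of conjugates show that commutators are tangent, and `hT` is the reverse inclusion, so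
every tangent space is the range of `adMap`. Its dimension is constant on the class, hence equal to
the generic one. -/
theorem varietyDim_conjClass {n : ℕ} {A : Matrix (Fin n) (Fin n) ℂ}
    (hT : ∀ X ∈ conjClass A, ∀ v ∈ zariskiTangentSpace (matrixPoint '' conjClass A) (matrixPoint X),
      (matrixEquiv n).symm v ∈ LinearMap.range (adMap X)) :
    varietyDim (matrixPoint '' conjClass A) = (Module.finrank ℂ (LinearMap.range (adMap A)) : ℕ) := by
  have key : ∀ X ∈ conjClass A, Module.finrank ℂ
      (zariskiTangentSpace (matrixPoint '' conjClass A) (matrixPoint X)) =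
      Module.finrank ℂ (LinearMap.range (adMap A)) := by
    intro X hX
    have h1 : zariskiTangentSpace (matrixPoint '' conjClass A) (matrixPoint X) =
        (LinearMap.range (adMap X)).map (matrixEquiv n : _ →ₗ[ℂ] _) := by
      apply le_antisymm
      · intro v hv
        exact ⟨_, hT X hX v hv, (matrixEquiv n).apply_symm_apply v⟩
      · rintro _ ⟨_, ⟨Y, rfl⟩, rfl⟩
        have h2 : HasDerivAt (fun t : ℂ => matrixPoint ((1 + t • Y) * X * (1 + t • Y)⁻¹))
            (matrixEquiv n (adMap X Y)) 0 :=
          HasFDerivAt.comp_hasDerivAt (0 : ℂ) (hasFDerivAt_matrixPoint _) (hasDerivAt_conj Y X)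
        have h3 := mem_zariskiTangentSpace_of_hasDerivAt (S := matrixPoint '' conjClass A) h2 (by
          filter_upwards [eventually_det_ne_zero Y] with t ht
          exact ⟨_, conj_mem_conjClass (Matrix.mul_nonsing_inv _ ht.isUnit)
            (Matrix.nonsing_inv_mul _ ht.isUnit) hX, rfl⟩)
        simpa using h3
    rw [h1, LinearEquiv.finrank_map_eq, finrank_range_adMap hX]
  obtain ⟨s, hs, hle, hex⟩ := exists_varietyDim_eq (isIrreducibleVariety_conjClass A)
  -- The polynomial 1 imposes no condition on the point.
  obtain ⟨_, ⟨X, hX, rfl⟩, -, hXs⟩ := hex 1 ⟨matrixPoint A, ⟨A, mem_conjClass_self A, rfl⟩, by simp⟩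
  have h1 := hle _ ⟨X, hX, rfl⟩
  rw [key X hX] at h1 hXs
  rw [hs, le_antisymm h1 hXs]

theorem exists_matrixPoint_inverse (n : ℕ) :
    ∃ L : (Fin n × Fin n → ℂ) →ₗ[ℂ] Matrix (Fin n) (Fin n) ℂ, IsPolynomialMatrix (fun y => L y) ∧
      (∀ v, (matrixEquiv n).symm v = L v) ∧ ∀ X, L (matrixPoint X) = X :=
  ⟨(matrixEquiv n).symm, fun i l => IsPolynomialFun.coord (i, l), fun _ => rfl, fun _ => rfl⟩

theorem varietyDim_conjClass_diagonal {a b : ℂ} (hab : a ≠ b) :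
    varietyDim (matrixPoint '' conjClass (Matrix.diagonal ![a, a, b, b])) = 8 := by
  obtain ⟨L, hL, hL', hLX⟩ := exists_matrixPoint_inverse 4
  rw [varietyDim_conjClass, finrank_range_adMap_diagonal hab]
  · norm_num
  · intro X hX v hv
    rw [hL']
    have hS : ∀ y ∈ matrixPoint '' conjClass (Matrix.diagonal ![a, a, b, b]),
        (L y - a • 1) * (L y - b • 1) = 0 := by
      rintro _ ⟨Y, hY, rfl⟩
      rw [hLX]
      exact quadratic_of_mem_conjClass_diagonal hY
    have := mem_range_adMap_of_quadratic hab hL hS ⟨X, hX, rfl⟩ hv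
    rwa [hLX] at this

theorem varietyDim_conjClass_jordan (c : ℂ) :
    varietyDim (matrixPoint '' conjClass
      !![c, 1, 0, 0; 0, c, 0, 0; 0, 0, c, 0; 0, 0, 0, c]) = 6 := by
  obtain ⟨L, hL, hL', hLX⟩ := exists_matrixPoint_inverse 4
  rw [varietyDim_conjClass, finrank_range_adMap_jordan c]
  · norm_num
  · intro X hX v hv
    rw [hL']
    have hS : ∀ y ∈ matrixPoint '' conjClass !![c, 1, 0, 0; 0, c, 0, 0; 0, 0, c, 0; 0, 0, 0, c],
        (∀ A, (L y - c • 1) * A * (L y - c • 1) = ((L y - c • 1) * A).trace • (L y - c • 1)) ∧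
        (L y - c • 1) * (L y - c • 1) = 0 ∧ L y - c • 1 ≠ 0 := by
      rintro _ ⟨Y, hY, rfl⟩
      rw [hLX]
      exact rank_one_of_mem_conjClass_jordan hY
    have hx := hS _ ⟨X, hX, rfl⟩
    have := mem_range_adMap_of_rank_one hL (fun y hy => (hS y hy).1) (fun y hy => (hS y hy).2.1)
      ⟨X, hX, rfl⟩ hx.2.2 hv
    rwa [hLX] at this

/-- The count is 8 + 8 + 8 + 6 - 16 + 1. -/
theorem expectedDim_quadClasses {a b : Fin 3 → ℂ} (hab : ∀ j, a j ≠ b j) (c : ℂ) :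
    expectedDim (quadClasses a b c) = 15 := by
  rw [expectedDim, Fin.sum_univ_four]
  simp only [quadClasses, Matrix.cons_val]
  rw [varietyDim_conjClass_diagonal (hab 0), varietyDim_conjClass_diagonal (hab 1),
    varietyDim_conjClass_diagonal (hab 2), varietyDim_conjClass_jordan c]
  rfl

end

noncomputable section

open scoped Matrix.Norms.Operator

/-! ### Centralizers -/

/-- The matrices that commute with all members of a tuple. -/
def tupleCentralizer {n k : ℕ} (M : Fin k → Matrix (Fin n) (Fin n) ℂ) :
    Submodule ℂ (Matrix (Fin n) (Fin n) ℂ) := ⨅ j, LinearMap.ker (adMap (M j))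

theorem mem_tupleCentralizer {n k : ℕ} {M : Fin k → Matrix (Fin n) (Fin n) ℂ}
    {Z : Matrix (Fin n) (Fin n) ℂ} : Z ∈ tupleCentralizer M ↔ ∀ j, Z * M j = M j * Z := by
  simp [tupleCentralizer, adMap_apply, sub_eq_zero]

variable {a b : Fin 3 → ℂ} {c : ℂ} {M : Fin 4 → Matrix (Fin 4) (Fin 4) ℂ}

theorem IsJordanBlock.ne_smul_one {P : Fin 4 → Matrix (Fin 2) (Fin 2) ℂ}
    (hP : IsJordanBlock a b c P) : P 3 ≠ c • 1 :=
  (mem_conjClass_jordan_iff.1 hP.mem_jordan).2.2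

/-- Schur's lemma: the diagonal blocks of a centralizing matrix are scalars, and an off-diagonal
block is zero or an isomorphism. The latter is impossible, since `N 3` is scalar and `P 3` is not.
-/
theorem finrank_tupleCentralizer_le (h : StratumCondition a b c) (hM : M ∈ stratumU a b c) :
    Module.finrank ℂ (tupleCentralizer M) ≤ 2 := by
  obtain ⟨g, k, N, P, hgk, hkg, hN, hP, hMj⟩ := (mem_stratumU_iff h).1 hM
  have hNi := hN.isIrreducibleTuple h
  have hPi := hP.isIrreducibleTuple h
  let f : ℂ × ℂ →ₗ[ℂ] Matrix (Fin 4) (Fin 4) ℂ :=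
    (LinearMap.toSpanSingleton ℂ _ (g * blockDiag 1 0 * k)).coprod
      (LinearMap.toSpanSingleton ℂ _ (g * blockDiag 0 1 * k))
  have hle : tupleCentralizer M ≤ LinearMap.range f := by
    intro Z hZ
    rw [mem_tupleCentralizer] at hZ
    obtain ⟨A, B, C, D, hABCD⟩ := exists_eq_blockMatrix (k * Z * g)
    have hcomm : ∀ j, k * Z * g * blockDiag (N j) (P j) = blockDiag (N j) (P j) * (k * Z * g) := by
      intro j
      have h1 : k * M j * g = blockDiag (N j) (P j) := by
        rw [hMj]
        calc k * (g * blockDiag (N j) (P j) * k) * g = (k * g) * blockDiag (N j) (P j) * (k * g) := by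
              simp only [mul_assoc]
          _ = _ := by rw [hkg, one_mul, mul_one]
      rw [← h1, conj_mul_conj hgk, conj_mul_conj hgk, hZ]
    have hb : ∀ j, A * N j = N j * A ∧ B * P j = N j * B ∧ C * N j = P j * C ∧ D * P j = P j * D := by
      intro j
      have h1 := hcomm j
      rw [hABCD, ← blockMatrix_zero_zero, blockMatrix_mul, blockMatrix_mul, blockMatrix_inj] at h1
      simpa using h1
    obtain ⟨z, hz⟩ := hNi.eq_smul_one (Y := A) fun j => (hb j).1.symm
    obtain ⟨w, hw⟩ := hPi.eq_smul_one (Y := D) fun j => (hb j).2.2.2.symm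
    have hB : B = 0 := by
      refine (hPi.eq_zero_or_det_ne_zero (Q' := N) fun j => (hb j).2.1.symm).resolve_right fun hd => ?_
      apply hP.ne_smul_one
      have h1 := (hb 3).2.1
      rw [hN.eq_scalar, smul_mul_assoc, one_mul] at h1
      calc P 3 = B⁻¹ * (B * P 3) := by
            rw [← mul_assoc, Matrix.nonsing_inv_mul _ hd.isUnit, one_mul]
        _ = _ := by rw [h1, mul_smul_comm, Matrix.nonsing_inv_mul _ hd.isUnit]
    have hC : C = 0 := by
      refine (hNi.eq_zero_or_det_ne_zero (Q' := P) fun j => (hb j).2.2.1.symm).resolve_right fun hd => ?_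
      apply hP.ne_smul_one
      have h1 := (hb 3).2.2.1
      rw [hN.eq_scalar, mul_smul_comm, mul_one] at h1
      calc P 3 = (P 3 * C) * C⁻¹ := by
            rw [mul_assoc, Matrix.mul_nonsing_inv _ hd.isUnit, mul_one]
        _ = _ := by rw [← h1, smul_mul_assoc, Matrix.mul_nonsing_inv _ hd.isUnit]
    refine ⟨(z, w), ?_⟩
    have h1 : Z = g * (k * Z * g) * k := by
      calc Z = (g * k) * Z * (g * k) := by rw [hgk, one_mul, mul_one]
        _ = _ := by simp only [mul_assoc]
    rw [h1, hABCD, hB, hC, hz, hw, blockMatrix_zero_zero]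
    have h2 : blockDiag (z • 1) (w • 1) = z • blockDiag 1 0 + w • blockDiag 0 1 := by
      rw [blockDiag_smul, blockDiag_smul, blockDiag_add]
      simp
    rw [h2]
    simp [f, mul_add, add_mul]
  calc Module.finrank ℂ (tupleCentralizer M) ≤ Module.finrank ℂ (LinearMap.range f) :=
        Submodule.finrank_mono hle
    _ ≤ Module.finrank ℂ (ℂ × ℂ) := LinearMap.finrank_range_le f
    _ = 2 := by simp

/-! ### The differential of the product -/

/-- The differential of the product of four matrices. -/
def prodDeriv {n : ℕ} (M : Fin 4 → Matrix (Fin n) (Fin n) ℂ) :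
    (Fin 4 → Matrix (Fin n) (Fin n) ℂ) →ₗ[ℂ] Matrix (Fin n) (Fin n) ℂ :=
  LinearMap.mulRight ℂ (M 1 * M 2 * M 3) ∘ₗ LinearMap.proj 0 +
  LinearMap.mulRight ℂ (M 2 * M 3) ∘ₗ LinearMap.mulLeft ℂ (M 0) ∘ₗ LinearMap.proj 1 +
  LinearMap.mulRight ℂ (M 3) ∘ₗ LinearMap.mulLeft ℂ (M 0 * M 1) ∘ₗ LinearMap.proj 2 +
  LinearMap.mulLeft ℂ (M 0 * M 1 * M 2) ∘ₗ LinearMap.proj 3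

theorem prodDeriv_apply {n : ℕ} (M X : Fin 4 → Matrix (Fin n) (Fin n) ℂ) :
    prodDeriv M X = X 0 * (M 1 * M 2 * M 3) + M 0 * X 1 * (M 2 * M 3) + M 0 * M 1 * X 2 * M 3 +
      M 0 * M 1 * M 2 * X 3 := rfl

/-- The componentwise commutators with the members of a tuple. -/
def adTuple {n : ℕ} (M : Fin 4 → Matrix (Fin n) (Fin n) ℂ) :
    (Fin 4 → Matrix (Fin n) (Fin n) ℂ) →ₗ[ℂ] (Fin 4 → Matrix (Fin n) (Fin n) ℂ) :=
  LinearMap.pi fun j => adMap (M j) ∘ₗ LinearMap.proj j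

/-- Cyclicity moves `Y` to the end of the trace, and nondegeneracy of the trace form removes it. -/
theorem mul_comm_of_trace {n : ℕ} {A B C : Matrix (Fin n) (Fin n) ℂ}
    (h : ∀ Y, (A * (Y * B - B * Y) * C).trace = 0) : B * (C * A) = C * A * B := by
  refine Matrix.ext_iff_trace_mul_right.2 fun Y => ?_
  have h1 := h Y
  rw [mul_sub, sub_mul, Matrix.trace_sub, sub_eq_zero] at h1
  calc (B * (C * A) * Y).trace = (A * (Y * B) * C).trace := by
        rw [Matrix.trace_mul_comm (A * (Y * B)), mul_assoc, Matrix.trace_mul_comm B]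
        simp only [mul_assoc]
    _ = (A * (B * Y) * C).trace := h1
    _ = _ := by
        rw [Matrix.trace_mul_comm (A * (B * Y))]
        simp only [mul_assoc]

/-- Variations of one matrix at a time suffice. Varying `M 0` shows that it commutes with `M 1 * M 2
* M 3 * Z`, which is its inverse times `Z`, hence with `Z`. The same argument then applies to `M 1`
and `M 2`, and `M 3` follows from the product relation. -/
theorem mem_tupleCentralizer_of_trace {n : ℕ} {M : Fin 4 → Matrix (Fin n) (Fin n) ℂ}
    (hprod : M 0 * M 1 * M 2 * M 3 = 1) {Z : Matrix (Fin n) (Fin n) ℂ}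
    (hZ : ∀ Y, (Z * prodDeriv M (adTuple M Y)).trace = 0) : Z ∈ tupleCentralizer M := by
  have hs : ∀ (j : Fin 4) (Y : Matrix (Fin n) (Fin n) ℂ) (i : Fin 4),
      adTuple M (Pi.single j Y) i = if i = j then Y * M j - M j * Y else 0 := by
    intro j Y i
    by_cases hij : i = j
    · subst hij
      simp [adTuple, adMap_apply]
    · simp [adTuple, adMap_apply, hij]
  have h0 : M 0 * (M 1 * M 2 * M 3 * Z) = M 1 * M 2 * M 3 * Z * M 0 := mul_comm_of_trace fun Y => by
    have := hZ (Pi.single 0 Y)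
    rw [prodDeriv_apply] at this
    simpa [hs, mul_assoc] using this
  have h1 : M 1 * (M 2 * M 3 * (Z * M 0)) = M 2 * M 3 * (Z * M 0) * M 1 :=
    mul_comm_of_trace fun Y => by
      have := hZ (Pi.single 1 Y)
      rw [prodDeriv_apply] at this
      simpa [hs, mul_assoc] using this
  have h2 : M 2 * (M 3 * (Z * (M 0 * M 1))) = M 3 * (Z * (M 0 * M 1)) * M 2 :=
    mul_comm_of_trace fun Y => by
      have := hZ (Pi.single 2 Y)
      rw [prodDeriv_apply] at this
      simpa [hs, mul_assoc] using this
  have p1 : M 1 * M 2 * M 3 * M 0 = 1 := by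
    apply mul_eq_one_comm.1
    simpa only [mul_assoc] using hprod
  have p2 : M 2 * M 3 * (M 0 * M 1) = 1 := by
    apply mul_eq_one_comm.1
    simpa only [mul_assoc] using hprod
  have p3 : M 3 * (M 0 * M 1 * M 2) = 1 := mul_eq_one_comm.1 hprod
  have q0 : M 0 * (M 1 * M 2 * M 3 * Z) = Z := by
    rw [← mul_assoc, ← mul_assoc, ← mul_assoc, hprod, one_mul]
  rw [q0] at h0
  have e0 : Z * M 0 = M 0 * Z := by
    conv_rhs => rw [h0]
    rw [← mul_assoc, q0]
  have q1 : M 1 * (M 2 * M 3 * (Z * M 0)) = Z := by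
    conv_rhs => rw [h0]
    simp only [mul_assoc]
  rw [q1] at h1
  have f1 : Z * (M 0 * M 1) = M 0 * M 1 * Z := by
    conv_rhs => rw [h1]
    calc Z * (M 0 * M 1) = M 0 * M 1 * M 2 * M 3 * Z * (M 0 * M 1) := by rw [hprod, one_mul]
      _ = _ := by simp only [mul_assoc]
  have e1 : Z * M 1 = M 1 * Z := by
    calc Z * M 1 = M 1 * M 2 * M 3 * M 0 * Z * M 1 := by rw [p1, one_mul]
      _ = M 1 * M 2 * M 3 * (M 0 * Z) * M 1 := by simp only [mul_assoc]
      _ = M 1 * M 2 * M 3 * (Z * (M 0 * M 1)) := by rw [← e0]; simp only [mul_assoc]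
      _ = M 1 * M 2 * M 3 * M 0 * (M 1 * Z) := by rw [f1]; simp only [mul_assoc]
      _ = _ := by rw [p1, one_mul]
  have q2 : M 2 * (M 3 * (Z * (M 0 * M 1))) = Z := by
    conv_rhs => rw [h1]
    simp only [mul_assoc]
  rw [q2] at h2
  have f2 : Z * (M 0 * M 1 * M 2) = M 0 * M 1 * M 2 * Z := by
    conv_rhs => rw [h2]
    calc Z * (M 0 * M 1 * M 2) = M 0 * M 1 * M 2 * M 3 * Z * (M 0 * M 1 * M 2) := by
          rw [hprod, one_mul]
      _ = _ := by simp only [mul_assoc]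
  have e2 : Z * M 2 = M 2 * Z := by
    calc Z * M 2 = M 2 * M 3 * (M 0 * M 1) * Z * M 2 := by rw [p2, one_mul]
      _ = M 2 * M 3 * (M 0 * M 1 * Z) * M 2 := by simp only [mul_assoc]
      _ = M 2 * M 3 * (Z * (M 0 * M 1 * M 2)) := by rw [← f1]; simp only [mul_assoc]
      _ = M 2 * M 3 * (M 0 * M 1) * (M 2 * Z) := by rw [f2]; simp only [mul_assoc]
      _ = _ := by rw [p2, one_mul]
  have e3 : Z * M 3 = M 3 * Z := by
    calc Z * M 3 = M 3 * (M 0 * M 1 * M 2) * Z * M 3 := by rw [p3, one_mul]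
      _ = M 3 * (M 0 * M 1 * M 2 * Z) * M 3 := by simp only [mul_assoc]
      _ = M 3 * Z * (M 0 * M 1 * M 2 * M 3) := by rw [← f2]; simp only [mul_assoc]
      _ = _ := by rw [hprod, mul_one]
  rw [mem_tupleCentralizer]
  intro j
  fin_cases j
  · exact e0
  · exact e1
  · exact e2
  · exact e3

/-- The rank of the differential of the product on a product of conjugacy classes. -/
theorem finrank_range_prodDeriv {n : ℕ} {M : Fin 4 → Matrix (Fin n) (Fin n) ℂ}
    (hprod : M 0 * M 1 * M 2 * M 3 = 1) :
    n ^ 2 ≤ Module.finrank ℂ ((LinearMap.range (adTuple M)).map (prodDeriv M)) +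
      Module.finrank ℂ (tupleCentralizer M) := by
  set W := (LinearMap.range (adTuple M)).map (prodDeriv M)
  let f : Module.Dual ℂ (Matrix (Fin n) (Fin n) ℂ) →ₗ[ℂ] Matrix (Fin n) (Fin n) ℂ :=
    { toFun := fun φ => Matrix.of fun i j => φ (Matrix.single j i 1)
      map_add' := fun _ _ => rfl
      map_smul' := fun _ _ => rfl }
  have hf : ∀ φ X, φ X = (f φ * X).trace := by
    intro φ X
    conv_lhs => rw [Matrix.matrix_eq_sum_single X]
    simp only [map_sum, Matrix.trace, Matrix.diag_apply, Matrix.mul_apply]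
    rw [Finset.sum_comm]
    refine Finset.sum_congr rfl fun j _ => Finset.sum_congr rfl fun i _ => ?_
    have : Matrix.single i j (X i j) = X i j • (Matrix.single i j 1 : Matrix (Fin n) (Fin n) ℂ) := by
      rw [Matrix.smul_single, smul_eq_mul, mul_one]
    rw [this, map_smul, smul_eq_mul, mul_comm]
    rfl
  have hinj : Function.Injective f := by
    intro φ ψ h
    ext1 X
    rw [hf, hf, h]
  -- Represented by the trace form, the functionals that vanish on the image of the differential are
  -- matrices centralizing the tuple.
  have hmap : W.dualAnnihilator.map f ≤ tupleCentralizer M := by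
    rintro _ ⟨φ, hφ, rfl⟩
    refine mem_tupleCentralizer_of_trace hprod fun Y => ?_
    rw [← hf]
    exact (Submodule.mem_dualAnnihilator φ).1 hφ _ ⟨_, ⟨Y, rfl⟩, rfl⟩
  have h1 := Subspace.finrank_add_finrank_dualAnnihilator_eq W
  have h2 := Submodule.finrank_mono hmap
  rw [← (Submodule.equivMapOfInjective f hinj W.dualAnnihilator).finrank_eq] at h2
  rw [Module.finrank_matrix] at h1
  simp only [Fintype.card_fin, Module.finrank_self, mul_one] at h1
  rw [sq]
  omega

theorem finrank_range_adTuple_le {n : ℕ} (M : Fin 4 → Matrix (Fin n) (Fin n) ℂ) :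
    Module.finrank ℂ (LinearMap.range (adTuple M)) ≤
      ∑ j, Module.finrank ℂ (LinearMap.range (adMap (M j))) := by
  let f : (∀ j, LinearMap.range (adMap (M j))) →ₗ[ℂ] (Fin 4 → Matrix (Fin n) (Fin n) ℂ) :=
    LinearMap.pi fun j => (LinearMap.range (adMap (M j))).subtype ∘ₗ LinearMap.proj j
  have h1 : LinearMap.range (adTuple M) ≤ LinearMap.range f := by
    rintro _ ⟨Y, rfl⟩
    exact ⟨fun j => ⟨adMap (M j) (Y j), Y j, rfl⟩, rfl⟩
  calc _ ≤ Module.finrank ℂ (LinearMap.range f) := Submodule.finrank_mono h1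
    _ ≤ Module.finrank ℂ (∀ j, LinearMap.range (adMap (M j))) := LinearMap.finrank_range_le f
    _ = _ := Module.finrank_pi_fintype ℂ

theorem finrank_inf_ker_add {V W : Type*} [AddCommGroup V] [AddCommGroup W] [Module ℂ V]
    [Module ℂ W] [FiniteDimensional ℂ V] (K : Submodule ℂ V) (f : V →ₗ[ℂ] W) :
    Module.finrank ℂ (K.map f) + Module.finrank ℂ (K ⊓ LinearMap.ker f : Submodule ℂ V) =
      Module.finrank ℂ K := by
  rw [← (f.domRestrict K).finrank_range_add_finrank_ker]
  congr 1
  · rw [LinearMap.range_domRestrict]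
  · rw [LinearMap.ker_domRestrict, ← Submodule.map_comap_subtype]
    exact (Submodule.equivMapOfInjective _ K.injective_subtype _).finrank_eq.symm

/-! ### Tangent spaces of the stratum -/

/-- Tangent vectors have commutators with the `M j` as components, a space of dimension at most 8 +
8 + 8 + 6 = 30, and lie in the kernel of the differential of the product, whose rank is at least 16
- 2 = 14 there. -/
theorem finrank_zariskiTangentSpace_stratumU_le (h : StratumCondition a b c)
    (hM : M ∈ stratumU a b c) :
    Module.finrank ℂ (zariskiTangentSpace (tuplePoint '' stratumU a b c) (tuplePoint M)) ≤ 16 := by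
  obtain ⟨L, hL, hL', hLM⟩ : ∃ L : Fin 4 → (Fin 4 × Fin 4 × Fin 4 → ℂ) →ₗ[ℂ] Matrix (Fin 4) (Fin 4) ℂ,
      (∀ j, IsPolynomialMatrix (fun y => L j y)) ∧ (∀ v j, (tupleEquiv 4 4).symm v j = L j v) ∧
      ∀ M j, L j (tuplePoint M) = M j :=
    ⟨fun j => LinearMap.proj j ∘ₗ ((tupleEquiv 4 4).symm : _ →ₗ[ℂ] (Fin 4 → Matrix (Fin 4) (Fin 4) ℂ)), fun j i l => IsPolynomialFun.coord (j, i, l),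
      fun _ _ => rfl, fun _ _ => rfl⟩
  set S := tuplePoint '' stratumU a b c with hS
  have hcl : ∀ y ∈ S, ∀ j, L j y ∈ quadClasses a b c j := by
    rintro _ ⟨M, hM, rfl⟩ j
    rw [hLM]
    exact hM.1.1 j
  have hpr : ∀ y ∈ S, L 0 y * L 1 y * L 2 y * L 3 y = 1 := by
    rintro _ ⟨M, hM, rfl⟩
    simp only [hLM]
    exact (stratumEquations_of_mem h hM).1.prod_eq
  have hx : tuplePoint M ∈ S := ⟨M, hM, rfl⟩
  have hprod := hpr _ hx
  simp only [hLM] at hprod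
  have hMc := hM.1.1
  have hrank : ∑ j, Module.finrank ℂ (LinearMap.range (adMap (M j))) = 30 := by
    rw [Fin.sum_univ_four, finrank_range_adMap (hMc 0), finrank_range_adMap (hMc 1),
      finrank_range_adMap (hMc 2), finrank_range_adMap (hMc 3),
      finrank_range_adMap_diagonal (h.ne 0), finrank_range_adMap_diagonal (h.ne 1),
      finrank_range_adMap_diagonal (h.ne 2), finrank_range_adMap_jordan c]
  have hsub : (zariskiTangentSpace S (tuplePoint M)).map
      ((tupleEquiv 4 4).symm : _ →ₗ[ℂ] (Fin 4 → Matrix (Fin 4) (Fin 4) ℂ)) ≤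
      LinearMap.range (adTuple M) ⊓ LinearMap.ker (prodDeriv M) := by
    rintro _ ⟨v, hv, rfl⟩
    have hquad : ∀ (j : Fin 4) (p q : ℂ), p ≠ q →
        quadClasses a b c j = conjClass (Matrix.diagonal ![p, p, q, q]) →
        L j v ∈ LinearMap.range (adMap (M j)) := by
      intro j p q hpq hj
      have := mem_range_adMap_of_quadratic hpq (hL j)
        (fun y hy => quadratic_of_mem_conjClass_diagonal (hj ▸ hcl y hy j)) hx hv
      rwa [hLM] at this
    have h3 : L 3 v ∈ LinearMap.range (adMap (M 3)) := by
      have hr : ∀ y ∈ S, _ := fun y hy => rank_one_of_mem_conjClass_jordan (hcl y hy 3)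
      have := mem_range_adMap_of_rank_one (hL 3) (fun y hy => (hr y hy).1)
        (fun y hy => (hr y hy).2.1) hx (hr _ hx).2.2 hv
      rwa [hLM] at this
    have hall : ∀ j, L j v ∈ LinearMap.range (adMap (M j)) := by
      intro j
      fin_cases j
      · exact hquad 0 _ _ (h.ne 0) rfl
      · exact hquad 1 _ _ (h.ne 1) rfl
      · exact hquad 2 _ _ (h.ne 2) rfl
      · exact h3
    refine ⟨?_, ?_⟩
    · choose Y hY using hall
      refine ⟨Y, funext fun j => ?_⟩
      exact (hY j).trans (hL' v j).symm
    · have hd := fun j => hasDerivAt_linear_line (L j) (tuplePoint M) v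
      have h5 := IsPolynomialMatrix.hasDerivAt_eq_zero hv
        (((((hL 0).mul (hL 1)).mul (hL 2)).mul (hL 3)).sub (.const 1))
        (fun y hy => sub_eq_zero.2 (hpr y hy))
        (((((hd 0).mul (hd 1)).mul (hd 2)).mul (hd 3)).sub_const 1)
      simp only [Pi.mul_apply, zero_smul, add_zero, hLM] at h5
      rw [SetLike.mem_coe, LinearMap.mem_ker, prodDeriv_apply]
      rw [← h5]
      simp only [LinearEquiv.coe_coe, hL', add_mul, mul_assoc]
  have h1 := Submodule.finrank_mono hsub
  rw [LinearEquiv.finrank_map_eq] at h1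
  have h2 := finrank_inf_ker_add (LinearMap.range (adTuple M)) (prodDeriv M)
  have h3 := finrank_range_prodDeriv hprod
  have h4 := finrank_range_adTuple_le M
  have h5 := finrank_tupleCentralizer_le h hM
  omega

end

noncomputable section

open scoped Matrix.Norms.Operator

/-! ### The dimension of the stratum -/

variable {a b : Fin 3 → ℂ} {c : ℂ} {M : Fin 4 → Matrix (Fin 4) (Fin 4) ℂ}

/-- An invariant of quadruples that, together with `splittingFactor`, determines the parameters. -/
def mixedFactor (c : ℂ) (M : Fin 4 → Matrix (Fin 4) (Fin 4) ℂ) : ℂ :=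
  (nilPart c M * (M 0 * M 1)).trace

/-- The nilpotent part is `e` times a matrix unit in the second block, so these traces read off
lower left entries of `P 0`, `P 1`, `P 2` and of `P 0 * P 1`. -/
theorem invariants_eq {g k : Matrix (Fin 4) (Fin 4) ℂ} (hgk : g * k = 1) (hkg : k * g = 1)
    {N P : Fin 4 → Matrix (Fin 2) (Fin 2) ℂ} (hN : N 3 = c • 1) {e : ℂ} (hP : P 3 = !![c, e; 0, c])
    (hM : ∀ j, M j = g * blockDiag (N j) (P j) * k) :
    (∀ i, splittingFactor c M i = e * P i.castSucc 1 0) ∧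
      mixedFactor c M = e * (P 0 1 0 * P 1 0 0 + P 0 1 1 * P 1 1 0) := by
  have h1 : P 3 - c • 1 = !![0, e; 0, 0] := by
    rw [hP]
    ext i j
    fin_cases i <;> fin_cases j <;> simp
  have hR := nilPart_eq hgk hN hM
  rw [h1] at hR
  constructor
  · intro i
    rw [splittingFactor, hR, hM, conj_mul_conj hkg, trace_conj_eq hkg, blockDiag_mul,
      trace_blockDiag, Matrix.trace_fin_two, Matrix.trace_fin_two]
    simp [Matrix.mul_apply, Fin.sum_univ_two]
  · rw [mixedFactor, hR, hM, hM, conj_mul_conj hkg, conj_mul_conj hkg, trace_conj_eq hkg,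
      blockDiag_mul, blockDiag_mul, trace_blockDiag, Matrix.trace_fin_two, Matrix.trace_fin_two]
    simp [Matrix.mul_apply, Fin.sum_univ_two]

/-- The first parameter of a quadruple as a function of the other ones. -/
def stratumRho (a b : Fin 3 → ℂ) (c : ℂ) (e : Matrix (Fin 4) (Fin 4) ℂ × ℂ × ℂ) : ℂ :=
  c * chartPoly a b c e.2.1 e.2.2 / (e.2.1 * e.2.2)

theorem stratumRho_ne_zero (h : StratumCondition a b c) {e : Matrix (Fin 4) (Fin 4) ℂ × ℂ × ℂ}
    (he : stratumDenom a b c e ≠ 0) : stratumRho a b c e ≠ 0 := by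
  obtain ⟨-, hlw⟩ := mul_ne_zero_iff.1 he
  obtain ⟨hlw', hp⟩ := mul_ne_zero_iff.1 hlw
  exact div_ne_zero (mul_ne_zero h.c_ne hp) hlw'

/-- The parameters are recovered from the quadruple as quotients of invariants, so the
parametrization can degenerate only along conjugations. -/
theorem invariants_stratumParam (h : StratumCondition a b c)
    {e : Matrix (Fin 4) (Fin 4) ℂ × ℂ × ℂ} (he : stratumDenom a b c e ≠ 0) :
    splittingFactor c (stratumParam a b c e) 0 = stratumRho a b c e ∧
      splittingFactor c (stratumParam a b c e) 1 = stratumRho a b c e * e.2.2 ∧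
      mixedFactor c (stratumParam a b c e) = stratumRho a b c e * e.2.1 := by
  have hg : e.1.det ≠ 0 := left_ne_zero_of_mul he
  obtain ⟨h1, h2⟩ := invariants_eq (M := stratumParam a b c e) (e := stratumRho a b c e)
    (Matrix.mul_nonsing_inv _ hg.isUnit) (Matrix.nonsing_inv_mul _ hg.isUnit)
    (chart_isScalarBlock h).eq_scalar rfl (fun j => rfl)
  refine ⟨?_, ?_, ?_⟩
  · rw [h1]
    simp [chart, chartFst]
  · rw [h1]
    simp [chart, chartSnd]
  · rw [h2]
    simp [chart, chartFst, chartSnd]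

/-- The part of the stratum where the three invariants are nonzero is relatively open and covered by
the parametrization: they are `ρ`, `ρ w` and `ρ l` of the normal form. -/
theorem exists_stratumParam_eq_of_invariants (h : StratumCondition a b c) (hM : M ∈ stratumU a b c)
    (h0 : splittingFactor c M 0 ≠ 0) (h1 : splittingFactor c M 1 ≠ 0) (h2 : mixedFactor c M ≠ 0) :
    ∃ e, stratumDenom a b c e ≠ 0 ∧ stratumParam a b c e = M := by
  obtain ⟨g, k, P, hgk, hkg, hP, h3, hg⟩ := (mem_stratumU_iff_normal h).1 hM
  obtain rfl : M = fun j => g * blockDiag (chart a b c 0 (a 1) 0 j) (P j) * k := funext hg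
  obtain ⟨e1, e2⟩ := invariants_eq hgk hkg (chart_isScalarBlock h).eq_scalar h3 hg
  rw [e1, one_mul] at h0 h1
  rw [e2, one_mul] at h2
  have h0' : P 0 1 0 ≠ 0 := h0
  have h1' : P 1 1 0 ≠ 0 := h1
  obtain ⟨ρ, l, w, hρ, hw, hl, hrel, u, v, huv, hvu, hu⟩ := hP.toIsBlockTuple.exists_chart h h3 h0'
  refine exists_stratumParam_eq hgk ⟨ρ, l, w, ?_, ?_, ?_, hrel, u, v, huv, hvu, hu⟩
  · rw [hρ, one_mul]
    exact h0'
  · rintro rfl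
    apply h2
    have ht : (P 0).trace = a 0 + b 0 :=
      ((mem_conjClass_diagonal_iff (h.ne 0)).1 (hP.mem_class 0)).1
    rw [Matrix.trace_fin_two] at ht
    have hw' : P 1 1 0 = P 0 1 0 * w := by rw [hw]; field_simp
    rw [hw']
    linear_combination P 0 1 0 * w * ht - P 0 1 0 * hl
  · rw [hw]
    exact div_ne_zero h1' h0'

theorem differentiable_invariants (c : ℂ) : (∀ i, Differentiable ℂ fun M => splittingFactor c M i) ∧
    Differentiable ℂ (mixedFactor c) := by
  have ht : Differentiable ℂ (fun A : Matrix (Fin 4) (Fin 4) ℂ => A.trace) :=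
    (LinearMap.toContinuousLinearMap (Matrix.traceLinearMap (Fin 4) ℂ ℂ)).differentiable
  have hM : ∀ j, Differentiable ℂ (fun M : Fin 4 → Matrix (Fin 4) (Fin 4) ℂ => M j) := fun j =>
    differentiable_apply j
  have hR : Differentiable ℂ (nilPart c) := (hM 3).sub_const _
  exact ⟨fun i => ht.comp (hR.mul (hM _)), ht.comp (hR.mul ((hM 0).mul (hM 1)))⟩

/-- The image of the differential of the parametrization is tangent to the stratum. A vector in its
kernel moves neither `l` nor `w`, and its matrix component gives an element of the centralizer of
`M`, so the rank is at least 18 - 2. -/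
theorem le_finrank_zariskiTangentSpace_stratumU (h : StratumCondition a b c)
    {e : Matrix (Fin 4) (Fin 4) ℂ × ℂ × ℂ} (he : stratumDenom a b c e ≠ 0) :
    16 ≤ Module.finrank ℂ (zariskiTangentSpace (tuplePoint '' stratumU a b c)
      (tuplePoint (stratumParam a b c e))) := by
  have hD := (differentiableAt_stratumParam h he).hasFDerivAt
  set D := fderiv ℂ (stratumParam a b c) e
  set M := stratumParam a b c e with hM
  have hMU : M ∈ stratumU a b c := stratumParam_mem h he
  have hg : e.1.det ≠ 0 := left_ne_zero_of_mul he
  have hline : ∀ d, HasDerivAt (fun t : ℂ => e + t • d) d 0 := fun d =>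
    (((hasDerivAt_id (0 : ℂ)).smul_const d).const_add e).congr_deriv (one_smul ℂ d)
  have hcurve : ∀ d, HasDerivAt (fun t : ℂ => stratumParam a b c (e + t • d)) (D d) 0 := fun d => by
    have h1 : HasFDerivAt (stratumParam a b c) D (e + (0 : ℂ) • d) := by
      rw [zero_smul, add_zero]
      exact hD
    exact h1.comp_hasDerivAt (0 : ℂ) (hline d)
  have hev : ∀ d, ∀ᶠ t : ℂ in nhds 0, stratumDenom a b c (e + t • d) ≠ 0 := fun d =>
    (differentiable_stratumDenom.continuous.continuousAt.comp
      (hline d).continuousAt).eventually_ne (by simpa using he)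
  have htan : (LinearMap.range D.toLinearMap).map (tupleEquiv 4 4).toLinearMap ≤
      zariskiTangentSpace (tuplePoint '' stratumU a b c) (tuplePoint M) := by
    rintro _ ⟨_, ⟨d, rfl⟩, rfl⟩
    have h1 : HasDerivAt (fun t : ℂ => tuplePoint (stratumParam a b c (e + t • d)))
        (tupleEquiv 4 4 (D d)) 0 :=
      HasFDerivAt.comp_hasDerivAt (0 : ℂ) (hasFDerivAt_tuplePoint _) (hcurve d)
    have h2 := mem_zariskiTangentSpace_of_hasDerivAt (S := tuplePoint '' stratumU a b c) h1 (by
      filter_upwards [hev d] with t ht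
      exact ⟨_, stratumParam_mem h ht, rfl⟩)
    simpa using h2
  have hker : ∀ d, D d = 0 → d.2.1 = 0 ∧ d.2.2 = 0 ∧ d.1 * e.1⁻¹ ∈ tupleCentralizer M := by
    intro d hd
    have hinv : ∀ F : (Fin 4 → Matrix (Fin 4) (Fin 4) ℂ) → ℂ, Differentiable ℂ F →
        HasDerivAt (fun t : ℂ => F (stratumParam a b c (e + t • d))) 0 0 := by
      intro F hF
      have h1 : HasDerivAt (fun t : ℂ => F (stratumParam a b c (e + t • d))) _ 0 :=
        HasFDerivAt.comp_hasDerivAt (0 : ℂ) (hF _).hasFDerivAt (hcurve d)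
      rw [hd] at h1
      exact h1.congr_deriv (ContinuousLinearMap.map_zero _)
    obtain ⟨hF, hF'⟩ := differentiable_invariants c
    have hρ : HasDerivAt (fun t : ℂ => stratumRho a b c (e + t • d)) 0 0 :=
      (hinv _ (hF 0)).congr_of_eventuallyEq (by
        filter_upwards [hev d] with t ht
        exact (invariants_stratumParam h ht).1.symm)
    have hw : HasDerivAt (fun t : ℂ => stratumRho a b c (e + t • d) * (e + t • d).2.2) 0 0 :=
      (hinv _ (hF 1)).congr_of_eventuallyEq (by
        filter_upwards [hev d] with t ht
        exact (invariants_stratumParam h ht).2.1.symm)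
    have hl : HasDerivAt (fun t : ℂ => stratumRho a b c (e + t • d) * (e + t • d).2.1) 0 0 :=
      (hinv _ hF').congr_of_eventuallyEq (by
        filter_upwards [hev d] with t ht
        exact (invariants_stratumParam h ht).2.2.symm)
    have hρ0 := stratumRho_ne_zero h he
    have hl' := (hρ.mul (hline d).snd.fst).unique hl
    have hw' := (hρ.mul (hline d).snd.snd).unique hw
    simp only [zero_mul, zero_add, zero_smul, add_zero, mul_eq_zero, hρ0, false_or] at hl' hw'
    -- As `d` changes neither `l` nor `w`, the curve is conjugation of `M` by `1 + t • (d.1 *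
    -- e.1⁻¹)`, and its zero velocity is a commutator.
    refine ⟨hl', hw', mem_tupleCentralizer.2 fun j => ?_⟩
    have h1 := hasDerivAt_conj (d.1 * e.1⁻¹) (M j)
    have h2 : (fun t : ℂ => (1 + t • (d.1 * e.1⁻¹)) * M j * (1 + t • (d.1 * e.1⁻¹))⁻¹) =
        fun t : ℂ => stratumParam a b c (e + t • d) j := by
      funext t
      have h3 : (e + t • d).1 = (1 + t • (d.1 * e.1⁻¹)) * e.1 := by
        rw [add_mul, one_mul, smul_mul_assoc, mul_assoc, Matrix.nonsing_inv_mul _ hg.isUnit, mul_one]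
        rfl
      have h4 : (e + t • d).2 = e.2 := by
        ext <;> simp [hl', hw']
      rw [hM]
      simp only [stratumParam, h3, h4, Matrix.mul_inv_rev, mul_assoc]
    rw [h2] at h1
    have h5 := h1.unique (hasDerivAt_pi.1 (hcurve d) j)
    rw [hd, Pi.zero_apply] at h5
    exact sub_eq_zero.1 h5
  let ψ : Matrix (Fin 4) (Fin 4) ℂ × ℂ × ℂ →ₗ[ℂ] Matrix (Fin 4) (Fin 4) ℂ :=
    LinearMap.mulRight ℂ e.1⁻¹ ∘ₗ LinearMap.fst ℂ _ _
  have h1 := finrank_inf_ker_add (LinearMap.ker D.toLinearMap) ψ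
  have h2 : LinearMap.ker D.toLinearMap ⊓ LinearMap.ker ψ = ⊥ := by
    rw [eq_bot_iff]
    rintro d ⟨hd, hd'⟩
    obtain ⟨h3, h4, -⟩ := hker d hd
    have h5 : d.1 * e.1⁻¹ = 0 := hd'
    have h6 : d.1 = 0 := by
      calc d.1 = d.1 * e.1⁻¹ * e.1 := by
            rw [mul_assoc, Matrix.nonsing_inv_mul _ hg.isUnit, mul_one]
        _ = 0 := by rw [h5, zero_mul]
    exact (Submodule.mem_bot ℂ).2 (Prod.ext h6 (Prod.ext h3 h4))
  have h3 : (LinearMap.ker D.toLinearMap).map ψ ≤ tupleCentralizer M := by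
    rintro _ ⟨d, hd, rfl⟩
    exact (hker d hd).2.2
  rw [h2, finrank_bot, add_zero] at h1
  have h4 := Submodule.finrank_mono h3
  have h5 := finrank_tupleCentralizer_le h hMU
  have h6 := Submodule.finrank_mono htan
  rw [LinearEquiv.finrank_map_eq] at h6
  have h7 := D.toLinearMap.finrank_range_add_finrank_ker
  simp only [Module.finrank_prod, Module.finrank_matrix, Fintype.card_fin, Module.finrank_self] at h7
  omega

/-- At a generic point, which may be chosen in the image of the parametrization, the tangent
dimension is at least 16 and at most `s`. Everywhere it is at least `s` and at most 16. This gives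
the dimension and smoothness together. -/
theorem varietyDim_stratumU (h : StratumCondition a b c) :
    varietyDim (tuplePoint '' stratumU a b c) = 16 ∧
      IsSmoothVariety (tuplePoint '' stratumU a b c) := by
  obtain ⟨s, hs, hle, hex⟩ := exists_varietyDim_eq (isIrreducibleVariety_stratumU h)
  have hM : ∀ j : Fin 4, IsPolynomialMatrix
      (fun x : Fin 4 × Fin 4 × Fin 4 → ℂ => (tupleEquiv 4 4).symm x j) := IsPolynomialMatrix.tuple
  have hR : IsPolynomialMatrix (fun x => nilPart c ((tupleEquiv 4 4).symm x)) :=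
    (hM 3).sub (.const _)
  -- The product of the three invariants, as a polynomial whose nonvanishing places a point of the
  -- stratum in the image of the parametrization.
  obtain ⟨f, hf⟩ := ((hR.mul (hM 0)).trace.mul (hR.mul (hM 1)).trace).mul
    (hR.mul ((hM 0).mul (hM 1))).trace
  have hf' : ∀ M, MvPolynomial.eval (tuplePoint M) f =
      splittingFactor c M 0 * splittingFactor c M 1 * mixedFactor c M := fun M =>
    (hf (tuplePoint M)).symm
  obtain ⟨e, he⟩ := exists_stratumDenom_ne_zero a b c
  have hfe : MvPolynomial.eval (tuplePoint (stratumParam a b c e)) f ≠ 0 := by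
    obtain ⟨h1, h2, h3⟩ := invariants_stratumParam h he
    obtain ⟨-, hlw⟩ := mul_ne_zero_iff.1 he
    obtain ⟨hlw', -⟩ := mul_ne_zero_iff.1 hlw
    obtain ⟨hl, hw⟩ := mul_ne_zero_iff.1 hlw'
    have hρ := stratumRho_ne_zero h he
    rw [hf', h1, h2, h3]
    exact mul_ne_zero (mul_ne_zero hρ (mul_ne_zero hρ hw)) (mul_ne_zero hρ hl)
  obtain ⟨_, ⟨M, hM, rfl⟩, hne, hT⟩ := hex f ⟨_, ⟨_, stratumParam_mem h he, rfl⟩, hfe⟩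
  rw [hf', mul_ne_zero_iff, mul_ne_zero_iff] at hne
  obtain ⟨e', he', rfl⟩ := exists_stratumParam_eq_of_invariants h hM hne.1.1 hne.1.2 hne.2
  have h1 := le_finrank_zariskiTangentSpace_stratumU h he'
  have h2 := hle _ ⟨_, hM, rfl⟩
  have h3 := finrank_zariskiTangentSpace_stratumU_le h hM
  obtain rfl : s = 16 := by omega
  refine ⟨hs, ?_⟩
  rintro _ ⟨M, hM, rfl⟩
  rw [hs, le_antisymm (finrank_zariskiTangentSpace_stratumU_le h hM) (hle _ ⟨M, hM, rfl⟩)]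

end

/-! ### The theorem -/

theorem mainTheorem6 (a b : Fin 3 → ℂ) (c : ℂ) (hab : ∀ j, a j ≠ b j)
    (hrel : IsRelativelyGenericEigenvalues (quadEigenvalues a b c))
    (hnot : ¬ IsGenericEigenvalues (quadEigenvalues a b c)) :
    IsAffineSubvariety (tuplePoint '' stratumU a b c) ∧
      IsIrreducibleVariety (tuplePoint '' stratumU a b c) ∧
      IsSmoothVariety (tuplePoint '' stratumU a b c) ∧
      varietyDim (tuplePoint '' stratumU a b c) = 16 ∧
      expectedDim (quadClasses a b c) = 15 := by
  have h := stratumCondition_of_relativelyGeneric hab hrel hnot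
  obtain ⟨hdim, hsmooth⟩ := varietyDim_stratumU h
  exact ⟨isAffineSubvariety_stratumU h, isIrreducibleVariety_stratumU h, hsmooth, hdim,
    expectedDim_quadClasses hab c⟩
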